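/- Let $\eta^1,\eta^2,\eta^3$ be the left-invariant coframe on $\mathbb S^3$ with $d\eta^1=-2\,\eta^2\wedge\eta^3$ and cyclically, and $e_1,e_2,e_3$ the dual frame. Let $I\subseteq\mathbb R$ be a non-empty open interval, let $F,C:I\to(0,\infty)$ be smooth, and on $I\times\mathbb S^3$, with coordinate $z$ on $I$ and orientation $dz\wedge\eta^1\wedge\eta^2\wedge\eta^3$, consider the metric $$g=C\Big(\tfrac1{4F}dz^2+F(\eta^1)^2+(\eta^2)^2+(\eta^3)^2\Big)$$ and the almost complex structures $$J^\pm=\mp2F\,\partial_z\otimes\eta^1\pm\tfrac1{2F}e_1\otimes dz-e_2\otimes\eta^3+e_3\otimes\eta^2 .$$ A Kähler metric is called extremal if the gradient of its scalar curvature $s$ is a (real) holomorphic vector field. Put $\mathcal L^\pm=\big(\mp\tfrac12\tfrac d{dz}+1\big)\big(\mp\tfrac d{dz}+1\big)$. Let $(\ast)$ denote the condition $$F=1+\tfrac12C_1e^{-2z}+C_2e^{-z}+C_3e^{z}+\tfrac12C_4e^{2z}\quad\text{on } I,\text{ for some real constants } C_1,\dots,C_4 .$$ 1. $g$ is extremal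 Kähler with respect to $J^+$ if and only if $C=C_0e^{-z}$ for a constant $C_0$ and $\mathcal L^+(\mathcal L^-(F))-1=0$. It is extremal Kähler with respect to $J^-$ if and only if $C=C_0e^{z}$ for a constant $C_0$ and $\mathcal L^+(\mathcal L^-(F))-1=0$. The equation $\mathcal L^+(\mathcal L^-(F))-1=0$ is equivalent to $(\ast)$. If $(\ast)$ holds and $C=C_0e^{-z}$, then $s=-\frac{24}{C_0}(C_1e^{-z}+C_2)$, which is constant if and only if $C_1=0$; if $(\ast)$ holds and $C=C_0e^{z}$, then $s=-\frac{24}{C_0}(C_3+C_4e^{z})$, which is constant if and only if $C_4=0$. 2. $g$ is Bach-flat if and only if $(\ast)$ holds with $C_1C_4-C_2C_3=0$. 3. $g$ is Kähler–Einstein with respect to $J^+$ if and only if $C=C_0e^{-z}$ for a constant $C_0$ and $(\ast)$ holds with $C_1=C_3=0$. 4. $W^+=0$ if and only if $\mathcal L^+(F)-1=0$, equivalently $F=1+C_3e^{z}+\frac12C_4e^{2z}$ for some constants. $W^-=0$ if and only if $\mathcal L^-(F)-1=0$, equivalently $F=1+\frac12C_1e^{-2z}+C_2e^{-z}$ for some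 constants. 5. If $g$ is Bach-flat, then some metric $\frac{C'}{C}g$ with $C':I\to(0,\infty)$ smooth is extremal Kähler with respect to $J^+$. If $W^+=0$, or $W^-=0$, or $g$ is Kähler–Einstein with respect to $J^+$, then $g$ is Bach-flat. 6. (Moduli.) Consider pairs $(F,C)$ of real-analytic functions on $\mathbb R$ with $C>0$, with $F>0$ somewhere and $F\not\equiv1$ (the conformally flat case $F\equiv 1$ is set aside); such a pair stands for the metric $g$ on $\{F>0\}\times\mathbb S^3$. Give spaces of such pairs the topology of pointwise convergence of $F$ and $C$. Call two pairs homothetic if they differ by a translation in $z$ and multiplication of $g$ by a positive constant, and conformally homothetic if they differ by a translation in $z$ and multiplication of $g$ by a positive function of $z$. Say that a set of pairs modulo one of these relations is a $k$-parameter family if the quotient space is non-empty and every point has a neighbourhood homeomorphic to an open subset of $\mathbb R^k$. Then - the extremal Kähler metrics for $J^+$, up to homothety, are a $3$-parameter family; - the Bach-flat metrics, up to conformal homothety, are a $2$-parameter family, and form a subspace of the previous family; - the metrics with $W^+=0$, and likewise those with $W^-=0$, up to conformal homothety, are a $1$-parameter family and form a subspace of the family of Bach-flat metrics up to conformal homothety;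 - the Kähler–Einstein metrics for $J^+$, up to homothety, are a $1$-parameter family and form a subspace of the family of Bach-flat metrics up to conformal homothety. Here "subspace" means that there is a topological embedding of quotient spaces which sends the class of each metric to the class of a conformally homothetic one. -/

import Mathlib

open scoped Quaternion ContDiff

namespace U2Ansatz

/-! ### The manifold `I × S³` and its left-invariant frame

`I × S³` is realised as the open set of quaternions `q = e^z u`, `|u| = 1`, `z ∈ I`.  In this
picture `∂/∂z` and the left-invariant fields `e₁, e₂, e₃` on `S³` are the vector fields
`q ↦ q`, `q ↦ q i`, `q ↦ q j`, `q ↦ q k`, and the dual coframe `dz, η¹, η², η³` consists of the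
four real components of `q⁻¹ dq`; in particular `dη¹ = -2 η² ∧ η³` and cyclically. -/

/-- The quaternion units `1, i, j, k`. -/
noncomputable def unitQ : Fin 4 → ℍ[ℝ] :=
  ![⟨1, 0, 0, 0⟩, ⟨0, 1, 0, 0⟩, ⟨0, 0, 1, 0⟩, ⟨0, 0, 0, 1⟩]

/-- The global frame `∂/∂z, e₁, e₂, e₃`. -/
noncomputable def frame (a : Fin 4) (q : ℍ[ℝ]) : ℍ[ℝ] := q * unitQ a

/-- The dual coframe `dz, η¹, η², η³`. -/
noncomputable def coframe (a : Fin 4) (q v : ℍ[ℝ]) : ℝ :=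
  ![(q⁻¹ * v).re, (q⁻¹ * v).imI, (q⁻¹ * v).imJ, (q⁻¹ * v).imK] a

/-- The coordinate `z`. -/
noncomputable def zcoord (q : ℍ[ℝ]) : ℝ := Real.log ‖q‖

/-- The manifold `I × S³`. -/
def mfd (I : Set ℝ) : Set ℍ[ℝ] := {q | q ≠ 0 ∧ zcoord q ∈ I}

/-! ### Riemannian geometry by moving frames

A metric is given by its bilinear forms `g q v w`; tensors are given by their components in the
frame above, as functions of the point. -/

/-- Derivative of a function along the `a`-th frame field. -/
noncomputable def frameDeriv (a : Fin 4) (f : ℍ[ℝ] → ℝ) (q : ℍ[ℝ]) : ℝ :=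
  fderiv ℝ f q (frame a q)

/-- The component along the `c`-th frame field of the Lie bracket of the `a`-th and `b`-th. -/
noncomputable def structFun (a b c : Fin 4) (q : ℍ[ℝ]) : ℝ :=
  coframe c q (VectorField.lieBracket ℝ (frame a) (frame b) q)

/-- The components `g_ab`. -/
noncomputable def gram (g : ℍ[ℝ] → ℍ[ℝ] → ℍ[ℝ] → ℝ) (q : ℍ[ℝ]) : Matrix (Fin 4) (Fin 4) ℝ :=
  Matrix.of fun a b => g q (frame a q) (frame b q)

/-- The components `g^ab`. -/
noncomputable def gramInv (g : ℍ[ℝ] → ℍ[ℝ] → ℍ[ℝ] → ℝ) (q : ℍ[ℝ]) : Matrix (Fin 4) (Fin 4) ℝ :=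
  (gram g q)⁻¹

/-- The Koszul formula for `g(∇_a e_b, e_c)`. -/
noncomputable def koszul (g : ℍ[ℝ] → ℍ[ℝ] → ℍ[ℝ] → ℝ) (a b c : Fin 4) (q : ℍ[ℝ]) : ℝ :=
  (1 / 2) * (frameDeriv a (fun x => gram g x b c) q + frameDeriv b (fun x => gram g x a c) q
    - frameDeriv c (fun x => gram g x a b) q
    + ∑ m, (structFun a b m q * gram g q m c - structFun a c m q * gram g q m b
      - structFun b c m q * gram g q m a))

/-- The Levi-Civita connection: the `d`-th component of `∇_a e_b`. -/
noncomputable def christoffel (g : ℍ[ℝ] → ℍ[ℝ] → ℍ[ℝ] → ℝ) (a b d : Fin 4) (q : ℍ[ℝ]) : ℝ :=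
  ∑ c, gramInv g q d c * koszul g a b c q

/-- The Riemann tensor: the `d`-th component of
`R(e_a, e_b) e_c = ∇_a ∇_b e_c - ∇_b ∇_a e_c - ∇_{[a,b]} e_c`. -/
noncomputable def riemann (g : ℍ[ℝ] → ℍ[ℝ] → ℍ[ℝ] → ℝ) (a b c d : Fin 4) (q : ℍ[ℝ]) : ℝ :=
  frameDeriv a (christoffel g b c d) q - frameDeriv b (christoffel g a c d) q
    + ∑ m, (christoffel g b c m q * christoffel g a m d q
      - christoffel g a c m q * christoffel g b m d q
      - structFun a b m q * christoffel g m c d q)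

/-- `Ric(Y, Z) = tr (X ↦ R(X, Y) Z)`. -/
noncomputable def ricci (g : ℍ[ℝ] → ℍ[ℝ] → ℍ[ℝ] → ℝ) (b c : Fin 4) (q : ℍ[ℝ]) : ℝ :=
  ∑ a, riemann g a b c a q

/-- Scalar curvature. -/
noncomputable def scal (g : ℍ[ℝ] → ℍ[ℝ] → ℍ[ℝ] → ℝ) (q : ℍ[ℝ]) : ℝ :=
  ∑ a, ∑ b, gramInv g q a b * ricci g a b q

/-- The Weyl tensor `W_abcd`, the totally trace-free part of `R_abcd = g(R(e_a, e_b) e_c, e_d)`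
in dimension four. -/
noncomputable def weyl (g : ℍ[ℝ] → ℍ[ℝ] → ℍ[ℝ] → ℝ) (i : Fin 4 → Fin 4) (q : ℍ[ℝ]) : ℝ :=
  (∑ m, riemann g (i 0) (i 1) (i 2) m q * gram g q m (i 3))
    - (1 / 2) * (gram g q (i 0) (i 3) * ricci g (i 1) (i 2) q
      + gram g q (i 1) (i 2) * ricci g (i 0) (i 3) q
      - gram g q (i 0) (i 2) * ricci g (i 1) (i 3) q
      - gram g q (i 1) (i 3) * ricci g (i 0) (i 2) q)
    + (scal g q / 6) * (gram g q (i 0) (i 3) * gram g q (i 1) (i 2)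
      - gram g q (i 0) (i 2) * gram g q (i 1) (i 3))

/-- The alternating symbol on four indices, with value `1` at `(0, 1, 2, 3)`. -/
noncomputable def altSymbol (a b c d : Fin 4) : ℝ :=
  (Int.sign (((b : ℤ) - (a : ℤ)) * ((c : ℤ) - (a : ℤ)) * ((d : ℤ) - (a : ℤ))
    * ((c : ℤ) - (b : ℤ)) * ((d : ℤ) - (b : ℤ)) * ((d : ℤ) - (c : ℤ))) : ℝ)

/-- The Hodge star, for the orientation `dz ∧ η¹ ∧ η² ∧ η³`, applied to the Weyl tensor in its
first pair of indices. -/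
noncomputable def starWeyl (g : ℍ[ℝ] → ℍ[ℝ] → ℍ[ℝ] → ℝ) (i : Fin 4 → Fin 4) (q : ℍ[ℝ]) : ℝ :=
  (1 / 2) * ∑ m, ∑ n, ∑ m', ∑ n', Real.sqrt (gram g q).det * altSymbol (i 0) (i 1) m n
    * gramInv g q m m' * gramInv g q n n' * weyl g ![m', n', i 2, i 3] q

/-- The self-dual Weyl tensor `W⁺`. -/
noncomputable def weylPlus (g : ℍ[ℝ] → ℍ[ℝ] → ℍ[ℝ] → ℝ) (i : Fin 4 → Fin 4) (q : ℍ[ℝ]) : ℝ :=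
  (1 / 2) * (weyl g i q + starWeyl g i q)

/-- The anti-self-dual Weyl tensor `W⁻`. -/
noncomputable def weylMinus (g : ℍ[ℝ] → ℍ[ℝ] → ℍ[ℝ] → ℝ) (i : Fin 4 → Fin 4) (q : ℍ[ℝ]) : ℝ :=
  (1 / 2) * (weyl g i q - starWeyl g i q)

/-- Covariant derivative of a covariant tensor; the new (first) index is the direction of
differentiation. -/
noncomputable def covDeriv (g : ℍ[ℝ] → ℍ[ℝ] → ℍ[ℝ] → ℝ) {n : ℕ}
    (T : (Fin n → Fin 4) → ℍ[ℝ] → ℝ) (i : Fin (n + 1) → Fin 4) (q : ℍ[ℝ]) : ℝ :=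
  frameDeriv (i 0) (T (Fin.tail i)) q
    - ∑ k : Fin n, ∑ m : Fin 4,
        christoffel g (i 0) (Fin.tail i k) m q * T (Function.update (Fin.tail i) k m) q

/-- The Bach tensor `B_ij = ∇^t ∇^s W_sijt + ½ Ric^st W_sijt`. -/
noncomputable def bach (g : ℍ[ℝ] → ℍ[ℝ] → ℍ[ℝ] → ℝ) (i j : Fin 4) (q : ℍ[ℝ]) : ℝ :=
  ∑ s, ∑ t, ∑ s', ∑ t', gramInv g q s s' * gramInv g q t t' *
    (covDeriv g (covDeriv g (weyl g)) ![t', s', s, i, j, t] q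
      + (1 / 2) * ricci g s' t' q * weyl g ![s, i, j, t] q)

/-- The gradient of a function. -/
noncomputable def grad (g : ℍ[ℝ] → ℍ[ℝ] → ℍ[ℝ] → ℝ) (f : ℍ[ℝ] → ℝ) (q : ℍ[ℝ]) : ℍ[ℝ] :=
  ∑ a, ∑ b, (gramInv g q a b * frameDeriv b f q) • frame a q

/-- Einstein: `Ric = k g` for a constant `k`. -/
def IsEinsteinOn (g : ℍ[ℝ] → ℍ[ℝ] → ℍ[ℝ] → ℝ) (M : Set ℍ[ℝ]) : Prop :=
  ∃ k : ℝ, ∀ q ∈ M, ∀ a b, ricci g a b q = k * gram g q a b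

/-- Bach-flat. -/
def IsBachFlatOn (g : ℍ[ℝ] → ℍ[ℝ] → ℍ[ℝ] → ℝ) (M : Set ℍ[ℝ]) : Prop :=
  ∀ q ∈ M, ∀ i j, bach g i j q = 0

/-- `W⁺ = 0`. -/
def IsWeylPlusFlatOn (g : ℍ[ℝ] → ℍ[ℝ] → ℍ[ℝ] → ℝ) (M : Set ℍ[ℝ]) : Prop :=
  ∀ q ∈ M, ∀ i, weylPlus g i q = 0

/-- `W⁻ = 0`. -/
def IsWeylMinusFlatOn (g : ℍ[ℝ] → ℍ[ℝ] → ℍ[ℝ] → ℝ) (M : Set ℍ[ℝ]) : Prop :=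
  ∀ q ∈ M, ∀ i, weylMinus g i q = 0

/-! ### Kähler and extremal Kähler metrics -/

/-- The Nijenhuis tensor of `J` on two vector fields. -/
noncomputable def nijenhuis (J : ℍ[ℝ] → ℍ[ℝ] → ℍ[ℝ]) (X Y : ℍ[ℝ] → ℍ[ℝ]) (q : ℍ[ℝ]) : ℍ[ℝ] :=
  VectorField.lieBracket ℝ (fun x => J x (X x)) (fun x => J x (Y x)) q
    - J q (VectorField.lieBracket ℝ (fun x => J x (X x)) Y q)
    - J q (VectorField.lieBracket ℝ X (fun x => J x (Y x)) q)
    - VectorField.lieBracket ℝ X Y q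

/-- The exterior derivative of the two-form `φ`, evaluated on three frame fields. -/
noncomputable def extDerivTwo (φ : ℍ[ℝ] → ℍ[ℝ] → ℍ[ℝ] → ℝ) (a b c : Fin 4) (q : ℍ[ℝ]) : ℝ :=
  frameDeriv a (fun x => φ x (frame b x) (frame c x)) q
    - frameDeriv b (fun x => φ x (frame a x) (frame c x)) q
    + frameDeriv c (fun x => φ x (frame a x) (frame b x)) q
    - φ q (VectorField.lieBracket ℝ (frame a) (frame b) q) (frame c q)
    + φ q (VectorField.lieBracket ℝ (frame a) (frame c) q) (frame b q)
    - φ q (VectorField.lieBracket ℝ (frame b) (frame c) q) (frame a q)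

/-- `(g, J)` is Kähler on the open set `M`: `J` is an integrable almost complex structure,
`g` is Hermitian, and the form `ω = g(J·, ·)` is closed. -/
structure IsKahlerOn (g : ℍ[ℝ] → ℍ[ℝ] → ℍ[ℝ] → ℝ) (J : ℍ[ℝ] → ℍ[ℝ] → ℍ[ℝ])
    (M : Set ℍ[ℝ]) : Prop where
  sq : ∀ q ∈ M, ∀ v, J q (J q v) = -v
  hermitian : ∀ q ∈ M, ∀ v w, g q (J q v) (J q w) = g q v w
  integrable : ∀ q ∈ M, ∀ a b, nijenhuis J (frame a) (frame b) q = 0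
  closed : ∀ q ∈ M, ∀ a b c, extDerivTwo (fun x v w => g x (J x v) w) a b c q = 0

/-- The vector field `X` is (real) holomorphic: `L_X J = 0`. -/
def IsHolomorphicOn (J : ℍ[ℝ] → ℍ[ℝ] → ℍ[ℝ]) (X : ℍ[ℝ] → ℍ[ℝ]) (M : Set ℍ[ℝ]) : Prop :=
  ∀ q ∈ M, ∀ a, VectorField.lieBracket ℝ X (fun x => J x (frame a x)) q
    = J q (VectorField.lieBracket ℝ X (frame a) q)

/-- Extremal Kähler, in the sense of Calabi: Kähler, and the gradient of the scalar curvature is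
a holomorphic vector field. -/
def IsExtremalKahlerOn (g : ℍ[ℝ] → ℍ[ℝ] → ℍ[ℝ] → ℝ) (J : ℍ[ℝ] → ℍ[ℝ] → ℍ[ℝ])
    (M : Set ℍ[ℝ]) : Prop :=
  IsKahlerOn g J M ∧ IsHolomorphicOn J (grad g (scal g)) M

/-- Kähler–Einstein. -/
def IsKahlerEinsteinOn (g : ℍ[ℝ] → ℍ[ℝ] → ℍ[ℝ] → ℝ) (J : ℍ[ℝ] → ℍ[ℝ] → ℍ[ℝ])
    (M : Set ℍ[ℝ]) : Prop :=
  IsKahlerOn g J M ∧ IsEinsteinOn g M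

/-! ### The `U(2)`-invariant ansatz -/

/-- `g = C (dz² / (4F) + F (η¹)² + (η²)² + (η³)²)`. -/
noncomputable def ansatzMetric (F C : ℝ → ℝ) (q v w : ℍ[ℝ]) : ℝ :=
  C (zcoord q) * (1 / (4 * F (zcoord q)) * (coframe 0 q v * coframe 0 q w)
    + F (zcoord q) * (coframe 1 q v * coframe 1 q w)
    + coframe 2 q v * coframe 2 q w + coframe 3 q v * coframe 3 q w)

/-- `J_f = -2f ∂_z ⊗ η¹ + (1 / 2f) e₁ ⊗ dz - e₂ ⊗ η³ + e₃ ⊗ η²`. -/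
noncomputable def ansatzJ (f : ℝ → ℝ) (q v : ℍ[ℝ]) : ℍ[ℝ] :=
  (-2 * f (zcoord q) * coframe 1 q v) • frame 0 q
    + (1 / (2 * f (zcoord q)) * coframe 0 q v) • frame 1 q
    - coframe 3 q v • frame 2 q + coframe 2 q v • frame 3 q

/-- `J⁺ = J_F`. -/
noncomputable def JPlus (F : ℝ → ℝ) : ℍ[ℝ] → ℍ[ℝ] → ℍ[ℝ] := ansatzJ F

/-- `J⁻ = J_{-F}`. -/
noncomputable def JMinus (F : ℝ → ℝ) : ℍ[ℝ] → ℍ[ℝ] → ℍ[ℝ] := ansatzJ fun z => -F z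

/-- The first-order operator `k d/dz + 1`. -/
noncomputable def shiftOp (k : ℝ) (F : ℝ → ℝ) (z : ℝ) : ℝ := k * deriv F z + F z

/-- `𝓛⁺ = (-½ d/dz + 1)(-d/dz + 1)`. -/
noncomputable def LPlus (F : ℝ → ℝ) : ℝ → ℝ := shiftOp (-(1 / 2)) (shiftOp (-1) F)

/-- `𝓛⁻ = (½ d/dz + 1)(d/dz + 1)`. -/
noncomputable def LMinus (F : ℝ → ℝ) : ℝ → ℝ := shiftOp (1 / 2) (shiftOp 1 F)

/-- `1 + ½ C₁ e^{-2z} + C₂ e^{-z} + C₃ e^z + ½ C₄ e^{2z}`. -/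
noncomputable def famF (c₁ c₂ c₃ c₄ z : ℝ) : ℝ :=
  1 + (1 / 2) * c₁ * Real.exp (-2 * z) + c₂ * Real.exp (-z) + c₃ * Real.exp z
    + (1 / 2) * c₄ * Real.exp (2 * z)

/-! ### Moduli

A solution is recorded by its pair `(F, C)` of real-analytic functions on the line, `C > 0`; the
metric lives where `F > 0`, which is required to be non-empty.  The conformally flat case `F = 1`,
where the translation action is not free, is left out.  Spaces of solutions carry the topology of
pointwise convergence of `F` and `C`. -/

/-- The pairs `(F, C)` above. -/
def globalPairs : Set ((ℝ → ℝ) × (ℝ → ℝ)) :=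
  {p | AnalyticOnNhd ℝ p.1 Set.univ ∧ AnalyticOnNhd ℝ p.2 Set.univ ∧ (∀ z, 0 < p.2 z)
    ∧ (∃ z, 0 < p.1 z) ∧ p.1 ≠ fun _ => 1}

/-- The domain of the metric given by `p = (F, C)`. -/
def pairDomain (p : (ℝ → ℝ) × (ℝ → ℝ)) : Set ℍ[ℝ] := mfd {z | 0 < p.1 z}

/-- Homothety: a translation in `z` followed by multiplication of the metric by a positive
constant. -/
def Homothetic (p p' : (ℝ → ℝ) × (ℝ → ℝ)) : Prop :=
  ∃ t l : ℝ, 0 < l ∧ ∀ z, p'.1 (z + t) = p.1 z ∧ p'.2 (z + t) = l * p.2 z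

/-- A translation in `z` followed by multiplication of the metric by a positive function. -/
def ConformallyHomothetic (p p' : (ℝ → ℝ) × (ℝ → ℝ)) : Prop :=
  ∃ (t : ℝ) (u : ℝ → ℝ), (∀ z, 0 < u z) ∧
    ∀ z, p'.1 (z + t) = p.1 z ∧ p'.2 (z + t) = u z * p.2 z

/-- Homothety as an equivalence relation on a family of solutions. -/
def homothetySetoid (S : Set ((ℝ → ℝ) × (ℝ → ℝ))) : Setoid S where
  r p p' := Homothetic p.1 p'.1
  iseqv :=
    { refl := fun p => ⟨0, 1, one_pos, fun z => by simp⟩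
      symm := by
        rintro p p' ⟨t, l, hl, h⟩
        refine ⟨-t, l⁻¹, inv_pos.2 hl, fun z => ?_⟩
        obtain ⟨h1, h2⟩ := h (z + -t)
        rw [neg_add_cancel_right] at h1 h2
        exact ⟨h1.symm, by rw [h2, inv_mul_cancel_left₀ hl.ne']⟩
      trans := by
        rintro p p' p'' ⟨t, l, hl, h⟩ ⟨t', l', hl', h'⟩
        refine ⟨t + t', l' * l, mul_pos hl' hl, fun z => ?_⟩
        obtain ⟨h1, h2⟩ := h z
        obtain ⟨h1', h2'⟩ := h' (z + t)
        rw [← add_assoc]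
        exact ⟨h1'.trans h1, by rw [h2', h2, mul_assoc]⟩ }

/-- Homothety and conformal change as an equivalence relation on a family of solutions. -/
def conformalSetoid (S : Set ((ℝ → ℝ) × (ℝ → ℝ))) : Setoid S where
  r p p' := ConformallyHomothetic p.1 p'.1
  iseqv :=
    { refl := fun p => ⟨0, fun _ => 1, fun _ => one_pos, fun z => by simp⟩
      symm := by
        rintro p p' ⟨t, u, hu, h⟩
        refine ⟨-t, fun z => (u (z + -t))⁻¹, fun z => inv_pos.2 (hu _), fun z => ?_⟩
        obtain ⟨h1, h2⟩ := h (z + -t)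
        rw [neg_add_cancel_right] at h1 h2
        exact ⟨h1.symm, by rw [h2, inv_mul_cancel_left₀ (hu _).ne']⟩
      trans := by
        rintro p p' p'' ⟨t, u, hu, h⟩ ⟨t', u', hu', h'⟩
        refine ⟨t + t', fun z => u' (z + t) * u z, fun z => mul_pos (hu' _) (hu _), fun z => ?_⟩
        obtain ⟨h1, h2⟩ := h z
        obtain ⟨h1', h2'⟩ := h' (z + t)
        rw [← add_assoc]
        exact ⟨h1'.trans h1, by rw [h2', h2, mul_assoc]⟩ }

/-- Solutions that are extremal Kähler for `J⁺`. -/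
def extremalPairs : Set ((ℝ → ℝ) × (ℝ → ℝ)) :=
  {p ∈ globalPairs | IsExtremalKahlerOn (ansatzMetric p.1 p.2) (JPlus p.1) (pairDomain p)}

/-- Solutions that are Kähler–Einstein for `J⁺`. -/
def kahlerEinsteinPairs : Set ((ℝ → ℝ) × (ℝ → ℝ)) :=
  {p ∈ globalPairs | IsKahlerEinsteinOn (ansatzMetric p.1 p.2) (JPlus p.1) (pairDomain p)}

/-- Solutions that are Bach-flat. -/
def bachFlatPairs : Set ((ℝ → ℝ) × (ℝ → ℝ)) :=
  {p ∈ globalPairs | IsBachFlatOn (ansatzMetric p.1 p.2) (pairDomain p)}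

/-- Solutions with `W⁺ = 0`. -/
def weylPlusFlatPairs : Set ((ℝ → ℝ) × (ℝ → ℝ)) :=
  {p ∈ globalPairs | IsWeylPlusFlatOn (ansatzMetric p.1 p.2) (pairDomain p)}

/-- Solutions with `W⁻ = 0`. -/
def weylMinusFlatPairs : Set ((ℝ → ℝ) × (ℝ → ℝ)) :=
  {p ∈ globalPairs | IsWeylMinusFlatOn (ansatzMetric p.1 p.2) (pairDomain p)}

/-- The family `S` modulo `s` is an `n`-parameter family: with the quotient topology it is
non-empty and locally homeomorphic to `ℝⁿ`. -/
def IsParameterFamily (n : ℕ) {S : Set ((ℝ → ℝ) × (ℝ → ℝ))} (s : Setoid S) : Prop :=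
  Nonempty (Quotient s) ∧ Nonempty (ChartedSpace (EuclideanSpace ℝ (Fin n)) (Quotient s))

/-- Up to conformal factors, the family `S` modulo `s` is a subspace of the family `S'` modulo
`s'`: there is a topological embedding sending the class of each solution to the class of a
conformally related one. -/
def IsSubfamily {S S' : Set ((ℝ → ℝ) × (ℝ → ℝ))} (s : Setoid S) (s' : Setoid S') : Prop :=
  ∃ ι : Quotient s → Quotient s', Topology.IsEmbedding ι ∧
    ∀ p : S, ∃ p' : S', ι (Quotient.mk s p) = Quotient.mk s' p' ∧ ConformallyHomothetic p.1 p'.1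

end U2Ansatz

open U2Ansatz

/-!
The proof reduces every condition to an ordinary differential equation and then describes the
solutions by their coefficients.

**Reduction.** In the frame `∂/∂z, e₁, e₂, e₃` the structure functions are constant and the metric
is diagonal with entries that depend on `z` only, so that all tensors have components that are
functions of `z`, and frame derivatives are derivatives in `z` (`frameDeriv_radial`). The conformal
factor enters the connection through `C' / C`. It drops out of the Weyl tensor, whose two halves are
fixed tensors multiplied by `F'' ∓ 3 F' + 2 F - 2`, that is by `2 (𝓛^± F - 1)` (`weylPlus_eq`,
`weylMinus_eq`). It drops out of the Bach tensor as well (`bach_eq`), which is diagonal: `B_00` is a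
quadratic first integral of the linear equation `F'''' - 5 F'' + 4 F - 4 = 0`, that is of
`4 (𝓛⁺ 𝓛⁻ F - 1) = 0`, and the remaining components vanish if that equation and `B_00 = 0` hold.

The Kähler form for `J^±` is `C (±½ dz ∧ η¹ + η² ∧ η³)`, which is closed if and only if `C' = ∓C`
(`isKahlerOn_iff`). The scalar curvature `s` is then `-8 (𝓛^± F - 1) / C`. Its gradient is a
multiple of `F s' / C ∂/∂z`, and a field `u ∂/∂z` is holomorphic if and only if `u / F` is constant
(`isHolomorphicOn_iff`); thus the metric is extremal if and only if `s' / C` is constant, which is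
once more the equation `𝓛⁺ 𝓛⁻ F = 1`. The Einstein condition becomes a pair of linear equations
(`isKahlerEinsteinOn_iff_jet`).

**Solutions.** The equations have constant coefficients with characteristic exponents among
`±1`, `±2`, and are solved by applying to `F - 1` the product of all factors `D - λ` but one
(`exists_eq_famF_iff` and its variants). On a solution, `B_00` is a multiple of `C₁ C₄ - C₂ C₃`.

**Moduli.** A global solution is analytic, hence given on the whole line by a vector of four
coefficients, and `famV` is a topological embedding (`isEmbedding_famV`). Both equivalence relations
reduce to translation in `z`, which multiplies the coefficients by the characters `e^{2t}`, `e^t`,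
`e^{-t}`, `e^{-2t}`; hence each space of solutions modulo equivalence is homeomorphic to the orbits
of this action on an invariant set of coefficients (`exists_homeomorph_orbit`). The projection to
the orbits is open, and every orbit with `c i ≠ 0` contains exactly one vector with `c i = ±1`, so
that slices `c i = ±1` provide charts (`IsSlice.exists_chart`): three-dimensional for all vectors,
two-dimensional for the cone `C₁ C₄ = C₂ C₃`, and one-dimensional for the coordinate planes in it
that correspond to `W⁺ = 0`, `W⁻ = 0` and to the Kähler–Einstein metrics. Inclusions between these
sets induce embeddings of orbit spaces (`exists_isEmbedding_orbit`).
-/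

open Filter Topology

namespace U2Ansatz

/-! ### Calculus in the left-invariant frame -/

theorem fin4_cases (i : Fin 4) : i = 0 ∨ i = 1 ∨ i = 2 ∨ i = 3 := by
  fin_cases i <;> simp

theorem vec4_zero {α : Type*} (a b c d : α) : (![a, b, c, d] : Fin 4 → α) 0 = a := rfl
theorem vec4_one {α : Type*} (a b c d : α) : (![a, b, c, d] : Fin 4 → α) 1 = b := rfl
theorem vec4_two {α : Type*} (a b c d : α) : (![a, b, c, d] : Fin 4 → α) 2 = c := rfl
theorem vec4_three {α : Type*} (a b c d : α) : (![a, b, c, d] : Fin 4 → α) 3 = d := rfl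

theorem re_unitQ (a : Fin 4) : (unitQ a).re = (![1, 0, 0, 0] : Fin 4 → ℝ) a := by
  rcases fin4_cases a with rfl | rfl | rfl | rfl <;> rfl

theorem imI_unitQ (a : Fin 4) : (unitQ a).imI = (![0, 1, 0, 0] : Fin 4 → ℝ) a := by
  rcases fin4_cases a with rfl | rfl | rfl | rfl <;> rfl

theorem imJ_unitQ (a : Fin 4) : (unitQ a).imJ = (![0, 0, 1, 0] : Fin 4 → ℝ) a := by
  rcases fin4_cases a with rfl | rfl | rfl | rfl <;> rfl

theorem imK_unitQ (a : Fin 4) : (unitQ a).imK = (![0, 0, 0, 1] : Fin 4 → ℝ) a := by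
  rcases fin4_cases a with rfl | rfl | rfl | rfl <;> rfl

/-- The components of a quaternion in the basis `1, i, j, k`. -/
noncomputable def comp (a : Fin 4) (v : ℍ[ℝ]) : ℝ := ![v.re, v.imI, v.imJ, v.imK] a

theorem comp_unitQ (a b : Fin 4) : comp a (unitQ b) = if a = b then 1 else 0 := by
  rcases fin4_cases a with rfl | rfl | rfl | rfl <;>
    rcases fin4_cases b with rfl | rfl | rfl | rfl <;>
    simp [comp, re_unitQ, imI_unitQ, imJ_unitQ, imK_unitQ]

theorem coframe_frame_mul {q : ℍ[ℝ]} (hq : q ≠ 0) (a : Fin 4) (v : ℍ[ℝ]) :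
    coframe a q (q * v) = comp a v := by
  simp [coframe, comp, inv_mul_cancel_left₀ hq]

theorem coframe_frame {q : ℍ[ℝ]} (hq : q ≠ 0) (a b : Fin 4) :
    coframe a q (frame b q) = if a = b then 1 else 0 := by
  rw [frame, coframe_frame_mul hq, comp_unitQ]

theorem coframe_add (a : Fin 4) (q v w : ℍ[ℝ]) :
    coframe a q (v + w) = coframe a q v + coframe a q w := by
  rcases fin4_cases a with rfl | rfl | rfl | rfl <;> simp [coframe, mul_add]

theorem coframe_smul (a : Fin 4) (q : ℍ[ℝ]) (r : ℝ) (v : ℍ[ℝ]) :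
    coframe a q (r • v) = r * coframe a q v := by
  rcases fin4_cases a with rfl | rfl | rfl | rfl <;> simp [coframe]

theorem coframe_sum {ι : Type*} (s : Finset ι) (a : Fin 4) (q : ℍ[ℝ]) (v : ι → ℍ[ℝ]) :
    coframe a q (∑ i ∈ s, v i) = ∑ i ∈ s, coframe a q (v i) := by
  classical
  induction s using Finset.induction_on with
  | empty => rcases fin4_cases a with rfl | rfl | rfl | rfl <;> simp [coframe]
  | insert i s hi ih => rw [Finset.sum_insert hi, Finset.sum_insert hi, coframe_add, ih]

theorem sum_comp_smul (v : ℍ[ℝ]) : ∑ a, comp a v • unitQ a = v := by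
  ext <;> simp [Fin.sum_univ_four, comp, re_unitQ, imI_unitQ, imJ_unitQ, imK_unitQ]

theorem sum_coframe_smul {q : ℍ[ℝ]} (hq : q ≠ 0) (v : ℍ[ℝ]) :
    ∑ a, coframe a q v • frame a q = v := by
  have h : v = q * (q⁻¹ * v) := (mul_inv_cancel_left₀ hq v).symm
  have h2 : ∀ a, coframe a q v = comp a (q⁻¹ * v) := fun a => rfl
  conv_rhs => rw [h, ← sum_comp_smul (q⁻¹ * v), Finset.mul_sum]
  simp [h2, frame]

/-- The structure constants `[e_a, e_b] = ∑ c, structConst a b c e_c`. -/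
noncomputable def structConst (a b c : Fin 4) : ℝ :=
  (![![![0, 0, 0, 0], ![0, 0, 0, 0], ![0, 0, 0, 0], ![0, 0, 0, 0]],
    ![![0, 0, 0, 0], ![0, 0, 0, 0], ![0, 0, 0, 2], ![0, 0, -2, 0]],
    ![![0, 0, 0, 0], ![0, 0, 0, -2], ![0, 0, 0, 0], ![0, 2, 0, 0]],
    ![![0, 0, 0, 0], ![0, 0, 2, 0], ![0, -2, 0, 0], ![0, 0, 0, 0]]] :
      Fin 4 → Fin 4 → Fin 4 → ℝ) a b c

theorem differentiable_frame (a : Fin 4) : Differentiable ℝ (frame a) :=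
  (differentiable_id.mul_const (unitQ a) : Differentiable ℝ fun q : ℍ[ℝ] => q * unitQ a)

theorem fderiv_frame (a : Fin 4) (q v : ℍ[ℝ]) : fderiv ℝ (frame a) q v = v * unitQ a := by
  have h := ((ContinuousLinearMap.mul ℝ ℍ[ℝ]).flip (unitQ a)).hasFDerivAt (x := q)
  have h2 : frame a = (ContinuousLinearMap.mul ℝ ℍ[ℝ]).flip (unitQ a) := rfl
  rw [h2, h.fderiv]
  simp

theorem unitQ_commutator (a b : Fin 4) :
    unitQ a * unitQ b - unitQ b * unitQ a = ∑ c, structConst a b c • unitQ c := by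
  rcases fin4_cases a with rfl | rfl | rfl | rfl <;>
    rcases fin4_cases b with rfl | rfl | rfl | rfl <;>
    ext <;> simp [Fin.sum_univ_four, structConst, re_unitQ, imI_unitQ, imJ_unitQ, imK_unitQ] <;>
    norm_num

theorem lieBracket_frame (a b : Fin 4) (q : ℍ[ℝ]) :
    VectorField.lieBracket ℝ (frame a) (frame b) q = ∑ c, structConst a b c • frame c q := by
  rw [VectorField.lieBracket, fderiv_frame, fderiv_frame]
  simp only [frame]
  rw [mul_assoc, mul_assoc, ← mul_sub, unitQ_commutator, Finset.mul_sum]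
  simp

/-- The structure functions of the frame are constant: the coframe has `dη¹ = -2 η² ∧ η³` and
cyclically, and `∂/∂z` commutes with the frame. -/
theorem structFun_eq {q : ℍ[ℝ]} (hq : q ≠ 0) (a b c : Fin 4) :
    structFun a b c q = structConst a b c := by
  rw [structFun, lieBracket_frame, coframe_sum]
  simp [coframe_smul, coframe_frame hq]

theorem hasFDerivAt_zcoord {q : ℍ[ℝ]} (hq : q ≠ 0) :
    HasFDerivAt zcoord ((‖q‖ ^ 2)⁻¹ • innerSL ℝ q) q := by
  -- the square of the norm is differentiable without a case distinction: `z = ½ log ‖q‖²`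
  have h := ((hasStrictFDerivAt_norm_sq q).hasFDerivAt.log
    (pow_ne_zero 2 (norm_ne_zero_iff.2 hq))).const_mul (1 / 2 : ℝ)
  have h2 : zcoord = fun x : ℍ[ℝ] => 1 / 2 * Real.log (‖x‖ ^ 2) := by
    funext x
    rw [Real.log_pow, zcoord]
    push_cast
    ring
  rw [h2]
  convert! h using 1
  ext v
  simp
  ring

theorem fderiv_zcoord_frame {q : ℍ[ℝ]} (hq : q ≠ 0) (a : Fin 4) :
    fderiv ℝ zcoord q (frame a q) = if a = 0 then 1 else 0 := by
  have hn : ‖q‖ ^ 2 = q.re ^ 2 + q.imI ^ 2 + q.imJ ^ 2 + q.imK ^ 2 := by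
    rw [sq, ← Quaternion.normSq_eq_norm_mul_self, Quaternion.normSq_def']
  have h0 : ‖q‖ ^ 2 ≠ 0 := pow_ne_zero 2 (norm_ne_zero_iff.2 hq)
  rw [(hasFDerivAt_zcoord hq).fderiv]
  have h : inner ℝ q (frame a q) = if a = 0 then ‖q‖ ^ 2 else 0 := by
    rw [hn, Quaternion.inner_def]
    rcases fin4_cases a with rfl | rfl | rfl | rfl <;>
      simp [frame, re_unitQ, imI_unitQ, imJ_unitQ, imK_unitQ] <;> ring
  simp only [smul_apply, innerSL_apply_apply, h, smul_eq_mul]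
  split_ifs <;> simp [h0]

theorem continuousAt_zcoord {q : ℍ[ℝ]} (hq : q ≠ 0) : ContinuousAt zcoord q :=
  (hasFDerivAt_zcoord hq).continuousAt

theorem mfd_mem_nhds {I : Set ℝ} (hI : IsOpen I) {q : ℍ[ℝ]} (hq : q ∈ mfd I) : mfd I ∈ 𝓝 q :=
  inter_mem (isOpen_ne.mem_nhds hq.1) ((continuousAt_zcoord hq.1).preimage_mem_nhds
    (hI.mem_nhds hq.2))

theorem exists_mem_mfd {I : Set ℝ} {z : ℝ} (hz : z ∈ I) : ∃ q ∈ mfd I, zcoord q = z := by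
  have h : zcoord ((Real.exp z : ℝ) : ℍ[ℝ]) = z := by
    rw [zcoord, Quaternion.norm_coe, Real.norm_eq_abs, Real.abs_exp, Real.log_exp]
  refine ⟨((Real.exp z : ℝ) : ℍ[ℝ]), ⟨?_, by rwa [h]⟩, h⟩
  rw [← norm_ne_zero_iff, Quaternion.norm_coe]
  exact norm_ne_zero_iff.2 (Real.exp_pos z).ne'

theorem hasFDerivAt_comp_zcoord {f : ℝ → ℝ} {f' : ℝ} {q : ℍ[ℝ]} (hq : q ≠ 0)
    (hf : HasDerivAt f f' (zcoord q)) :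
    HasFDerivAt (fun x => f (zcoord x)) (f' • fderiv ℝ zcoord q) q := by
  have h := (hasFDerivAt_zcoord hq)
  rw [h.fderiv]
  exact hf.comp_hasFDerivAt q h

theorem fderiv_comp_zcoord_frame {f : ℝ → ℝ} {f' : ℝ} {q : ℍ[ℝ]} (hq : q ≠ 0)
    (hf : HasDerivAt f f' (zcoord q)) (a : Fin 4) :
    fderiv ℝ (fun x => f (zcoord x)) q (frame a q) = if a = 0 then f' else 0 := by
  rw [(hasFDerivAt_comp_zcoord hq hf).fderiv, smul_apply,
    fderiv_zcoord_frame hq]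
  simp

/-- A function which depends on `z` only is differentiated by the frame as a function of `z`. -/
theorem frameDeriv_radial {I : Set ℝ} (hI : IsOpen I) {T : ℍ[ℝ] → ℝ} {t : ℝ → ℝ} {t' : ℝ}
    (h : ∀ x ∈ mfd I, T x = t (zcoord x)) {q : ℍ[ℝ]} (hq : q ∈ mfd I)
    (ht : HasDerivAt t t' (zcoord q)) (a : Fin 4) :
    frameDeriv a T q = if a = 0 then t' else 0 := by
  have h1 : T =ᶠ[𝓝 q] fun x => t (zcoord x) :=
    Filter.mem_of_superset (mfd_mem_nhds hI hq) h
  rw [frameDeriv, h1.fderiv_eq, fderiv_comp_zcoord_frame hq.1 ht]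

/-! ### The metric and its Levi-Civita connection -/

/-- The standing assumptions on the profile functions `F`, `C` of the ansatz on an open set `I`. -/
structure IsProfile (I : Set ℝ) (F C : ℝ → ℝ) : Prop where
  isOpen : IsOpen I
  smooth_F : ContDiffOn ℝ ∞ F I
  smooth_C : ContDiffOn ℝ ∞ C I
  pos_F : ∀ z ∈ I, 0 < F z
  pos_C : ∀ z ∈ I, 0 < C z

theorem contDiffOn_infty_deriv {I : Set ℝ} (hI : IsOpen I) {f : ℝ → ℝ}
    (hf : ContDiffOn ℝ ∞ f I) : ContDiffOn ℝ ∞ (deriv f) I :=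
  hf.deriv_of_isOpen hI (by simp)

theorem hasDerivAt_of_contDiffOn_infty {I : Set ℝ} (hI : IsOpen I) {f : ℝ → ℝ}
    (hf : ContDiffOn ℝ ∞ f I) {z : ℝ} (hz : z ∈ I) : HasDerivAt f (deriv f z) z :=
  ((hf.contDiffAt (hI.mem_nhds hz)).differentiableAt (by simp)).hasDerivAt

namespace IsProfile

variable {I : Set ℝ} {F C : ℝ → ℝ} (h : IsProfile I F C)

include h

theorem smooth_logDeriv_F : ContDiffOn ℝ ∞ (logDeriv F) I :=
  (contDiffOn_infty_deriv h.isOpen h.smooth_F).div h.smooth_F fun z hz => (h.pos_F z hz).ne'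

theorem smooth_logDeriv_C : ContDiffOn ℝ ∞ (logDeriv C) I :=
  (contDiffOn_infty_deriv h.isOpen h.smooth_C).div h.smooth_C fun z hz => (h.pos_C z hz).ne'

theorem hasDerivAt_F {z : ℝ} (hz : z ∈ I) : HasDerivAt F (F z * logDeriv F z) z := by
  have := hasDerivAt_of_contDiffOn_infty h.isOpen h.smooth_F hz
  rwa [logDeriv_apply, mul_div_cancel₀ _ (h.pos_F z hz).ne']

theorem hasDerivAt_C {z : ℝ} (hz : z ∈ I) : HasDerivAt C (C z * logDeriv C z) z := by
  have := hasDerivAt_of_contDiffOn_infty h.isOpen h.smooth_C hz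
  rwa [logDeriv_apply, mul_div_cancel₀ _ (h.pos_C z hz).ne']

theorem hasDerivAt_logDeriv_F {z : ℝ} (hz : z ∈ I) :
    HasDerivAt (logDeriv F) (deriv (logDeriv F) z) z :=
  hasDerivAt_of_contDiffOn_infty h.isOpen h.smooth_logDeriv_F hz

theorem hasDerivAt_logDeriv_C {z : ℝ} (hz : z ∈ I) :
    HasDerivAt (logDeriv C) (deriv (logDeriv C) z) z :=
  hasDerivAt_of_contDiffOn_infty h.isOpen h.smooth_logDeriv_C hz

end IsProfile

/-- The diagonal components of the metric, up to the conformal factor, where `f` is the value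
of `F`. -/
noncomputable def diagT (f : ℝ) : Fin 4 → ℝ := ![1 / (4 * f), f, 1, 1]

/-- The inverses of the entries of `diagT f`. -/
noncomputable def diagInvT (f : ℝ) : Fin 4 → ℝ := ![4 * f, 1 / f, 1, 1]

/-- The logarithmic derivatives of the entries of `diagT`, where `p` is the value of `F' / F`. -/
noncomputable def diagLogT (p : ℝ) : Fin 4 → ℝ := ![-p, p, 0, 0]

/-- The components of a connection with the symmetries of the ansatz; the Levi-Civita connection
is `connT (connJet f p k) 1`. The constants in the components carry the factor `e`, so that the
derivative in `z` of `connT x 1` is `connT x' 0`. -/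
noncomputable def connT (x : Fin 6 → ℝ) (e : ℝ) (a b d : Fin 4) : ℝ :=
  (![![![x 0, 0, 0, 0], ![0, x 1, 0, 0], ![0, 0, x 2, 0], ![0, 0, 0, x 2]],
    ![![0, x 1, 0, 0], ![-x 3, 0, 0, 0], ![0, 0, 0, 2 * e - x 5], ![0, 0, x 5 - 2 * e, 0]],
    ![![0, 0, x 2, 0], ![0, 0, 0, -x 5], ![-x 4, 0, 0, 0], ![0, e, 0, 0]],
    ![![0, 0, 0, x 2], ![0, 0, x 5, 0], ![0, -e, 0, 0], ![-x 4, 0, 0, 0]]] :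
      Fin 4 → Fin 4 → Fin 4 → ℝ) a b d

/-- The parameters of the Levi-Civita connection, in terms of the values `f`, `p`, `k` of `F`,
`F' / F`, `C' / C`. -/
noncomputable def connJet (f p k : ℝ) : Fin 6 → ℝ :=
  ![(k - p) / 2, (k + p) / 2, k / 2, 2 * f ^ 2 * (k + p), 2 * f * k, f]

/-- The derivative of `connJet`, in terms of the values `p'`, `k'` of the derivatives of `p`
and `k`. -/
noncomputable def connJetDeriv (f p k p' k' : ℝ) : Fin 6 → ℝ :=
  ![(k' - p') / 2, (k' + p') / 2, k' / 2, 2 * f ^ 2 * (2 * p * (k + p) + (k' + p')),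
    2 * f * (p * k + k'), f * p]

theorem connJet_zero (f p k : ℝ) : connJet f p k 0 = (k - p) / 2 := rfl
theorem connJet_one (f p k : ℝ) : connJet f p k 1 = (k + p) / 2 := rfl
theorem connJet_two (f p k : ℝ) : connJet f p k 2 = k / 2 := rfl
theorem connJet_three (f p k : ℝ) : connJet f p k 3 = 2 * f ^ 2 * (k + p) := rfl
theorem connJet_four (f p k : ℝ) : connJet f p k 4 = 2 * f * k := rfl
theorem connJet_five (f p k : ℝ) : connJet f p k 5 = f := rfl

theorem connJetDeriv_zero (f p k p' k' : ℝ) : connJetDeriv f p k p' k' 0 = (k' - p') / 2 := rfl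
theorem connJetDeriv_one (f p k p' k' : ℝ) : connJetDeriv f p k p' k' 1 = (k' + p') / 2 := rfl
theorem connJetDeriv_two (f p k p' k' : ℝ) : connJetDeriv f p k p' k' 2 = k' / 2 := rfl
theorem connJetDeriv_three (f p k p' k' : ℝ) :
    connJetDeriv f p k p' k' 3 = 2 * f ^ 2 * (2 * p * (k + p) + (k' + p')) := rfl
theorem connJetDeriv_four (f p k p' k' : ℝ) :
    connJetDeriv f p k p' k' 4 = 2 * f * (p * k + k') := rfl
theorem connJetDeriv_five (f p k p' k' : ℝ) : connJetDeriv f p k p' k' 5 = f * p := rfl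

theorem diagT_mul_diagInvT {f : ℝ} (hf : f ≠ 0) (a : Fin 4) : diagT f a * diagInvT f a = 1 := by
  rcases fin4_cases a with rfl | rfl | rfl | rfl <;> simp [diagT, diagInvT] <;> field_simp

theorem diagT_ne_zero {f : ℝ} (hf : f ≠ 0) (a : Fin 4) : diagT f a ≠ 0 :=
  left_ne_zero_of_mul (by rw [diagT_mul_diagInvT hf a]; exact one_ne_zero)

theorem ansatzMetric_frame (F C : ℝ → ℝ) {q : ℍ[ℝ]} (hq : q ≠ 0) (a b : Fin 4) :
    ansatzMetric F C q (frame a q) (frame b q)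
      = if a = b then C (zcoord q) * diagT (F (zcoord q)) a else 0 := by
  simp only [ansatzMetric, coframe_frame hq]
  rcases fin4_cases a with rfl | rfl | rfl | rfl <;>
    rcases fin4_cases b with rfl | rfl | rfl | rfl <;> simp [diagT]

theorem gram_ansatz (F C : ℝ → ℝ) {q : ℍ[ℝ]} (hq : q ≠ 0) (a b : Fin 4) :
    gram (ansatzMetric F C) q a b = if a = b then C (zcoord q) * diagT (F (zcoord q)) a else 0 :=
  ansatzMetric_frame F C hq a b

namespace IsProfile

variable {I : Set ℝ} {F C : ℝ → ℝ} (h : IsProfile I F C)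

include h

theorem gramInv_ansatz {q : ℍ[ℝ]} (hq : q ∈ mfd I) (a b : Fin 4) :
    gramInv (ansatzMetric F C) q a b
      = if a = b then (C (zcoord q))⁻¹ * diagInvT (F (zcoord q)) a else 0 := by
  have hF := (h.pos_F _ hq.2).ne'
  have hC := (h.pos_C _ hq.2).ne'
  have h1 : gram (ansatzMetric F C) q
      = Matrix.diagonal fun a => C (zcoord q) * diagT (F (zcoord q)) a := by
    ext a b
    rw [gram_ansatz F C hq.1, Matrix.diagonal_apply]
  have h2 : (gram (ansatzMetric F C) q)⁻¹
      = Matrix.diagonal fun a => (C (zcoord q))⁻¹ * diagInvT (F (zcoord q)) a := by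
    apply Matrix.inv_eq_right_inv
    rw [h1, Matrix.diagonal_mul_diagonal, ← Matrix.diagonal_one]
    congr 1
    funext a
    rw [mul_mul_mul_comm, mul_inv_cancel₀ hC, diagT_mul_diagInvT hF, one_mul]
  rw [gramInv, h2, Matrix.diagonal_apply]

theorem hasDerivAt_diagT {z : ℝ} (hz : z ∈ I) (a : Fin 4) :
    HasDerivAt (fun z => C z * diagT (F z) a)
      (C z * diagT (F z) a * (logDeriv C z + diagLogT (logDeriv F z) a)) z := by
  have hF := h.hasDerivAt_F hz
  have hC := h.hasDerivAt_C hz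
  have hF0 := (h.pos_F _ hz).ne'
  rcases fin4_cases a with rfl | rfl | rfl | rfl
  · refine (hC.mul ((hasDerivAt_const z (1 : ℝ)).div (hF.const_mul 4)
      (mul_ne_zero four_ne_zero hF0))).congr_deriv ?_
    simp only [diagT, diagLogT, vec4_zero, Pi.div_apply]
    field_simp
    ring
  · refine (hC.mul hF).congr_deriv ?_
    simp only [diagT, diagLogT, vec4_one]
    ring
  · refine (hC.mul (hasDerivAt_const z (1 : ℝ))).congr_deriv ?_
    simp only [diagT, diagLogT, vec4_two]
    ring
  · refine (hC.mul (hasDerivAt_const z (1 : ℝ))).congr_deriv ?_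
    simp only [diagT, diagLogT, vec4_three]
    ring

theorem frameDeriv_gram {q : ℍ[ℝ]} (hq : q ∈ mfd I) (a b c : Fin 4) :
    frameDeriv a (fun x => gram (ansatzMetric F C) x b c) q
      = if a = 0 then if b = c then C (zcoord q) * diagT (F (zcoord q)) b
          * (logDeriv C (zcoord q) + diagLogT (logDeriv F (zcoord q)) b) else 0 else 0 := by
  by_cases hbc : b = c
  · rw [frameDeriv_radial h.isOpen
      (fun x hx => (gram_ansatz F C hx.1 b c).trans (if_pos hbc)) hq (h.hasDerivAt_diagT hq.2 b),
      if_pos hbc]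
  · rw [frameDeriv_radial h.isOpen (t := fun _ => 0)
      (fun x hx => (gram_ansatz F C hx.1 b c).trans (if_neg hbc)) hq (hasDerivAt_const _ _),
      if_neg hbc]

/-- The Koszul formula for the ansatz; the conformal factor enters through `C' / C` only. -/
theorem christoffel_ansatz {q : ℍ[ℝ]} (hq : q ∈ mfd I) (a b d : Fin 4) :
    christoffel (ansatzMetric F C) a b d q
      = connT (connJet (F (zcoord q)) (logDeriv F (zcoord q)) (logDeriv C (zcoord q))) 1 a b d := by
  have hF := (h.pos_F _ hq.2).ne'
  have hC := (h.pos_C _ hq.2).ne'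
  simp only [christoffel, h.gramInv_ansatz hq, koszul, h.frameDeriv_gram hq, gram_ansatz F C hq.1,
    structFun_eq hq.1, ite_mul, zero_mul, mul_ite, mul_zero, Finset.sum_ite_eq, Finset.mem_univ,
    if_true, Finset.sum_sub_distrib, Finset.sum_ite_eq']
  generalize F (zcoord q) = f at *
  generalize C (zcoord q) = c at *
  generalize logDeriv F (zcoord q) = p
  generalize logDeriv C (zcoord q) = k
  rcases fin4_cases a with rfl | rfl | rfl | rfl <;>
    rcases fin4_cases b with rfl | rfl | rfl | rfl <;>
    rcases fin4_cases d with rfl | rfl | rfl | rfl <;>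
    simp only [diagT, diagInvT, diagLogT, connT, connJet_zero, connJet_one, connJet_two,
      connJet_three, connJet_four, connJet_five, structConst, vec4_zero, vec4_one, vec4_two,
      vec4_three, Fin.reduceEq, if_true, if_false] <;>
    field_simp <;> ring

theorem hasDerivAt_connJet {z : ℝ} (hz : z ∈ I) (i : Fin 6) :
    HasDerivAt (fun z => connJet (F z) (logDeriv F z) (logDeriv C z) i)
      (connJetDeriv (F z) (logDeriv F z) (logDeriv C z) (deriv (logDeriv F) z)
        (deriv (logDeriv C) z) i) z := by
  have hF := h.hasDerivAt_F hz
  have hp := h.hasDerivAt_logDeriv_F hz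
  have hk := h.hasDerivAt_logDeriv_C hz
  fin_cases i
  · exact (hk.sub hp).div_const 2
  · exact (hk.add hp).div_const 2
  · exact hk.div_const 2
  · refine (((hF.pow 2).const_mul 2).mul (hk.add hp)).congr_deriv ?_
    simp [connJetDeriv]
    ring
  · refine ((hF.const_mul 2).mul hk).congr_deriv ?_
    simp [connJetDeriv]
    ring
  · exact hF

theorem hasDerivAt_connT {z : ℝ} (hz : z ∈ I) (a b d : Fin 4) :
    HasDerivAt (fun z => connT (connJet (F z) (logDeriv F z) (logDeriv C z)) 1 a b d)
      (connT (connJetDeriv (F z) (logDeriv F z) (logDeriv C z) (deriv (logDeriv F) z)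
        (deriv (logDeriv C) z)) 0 a b d) z := by
  have hx := h.hasDerivAt_connJet hz
  rcases fin4_cases a with rfl | rfl | rfl | rfl <;>
    rcases fin4_cases b with rfl | rfl | rfl | rfl <;>
    rcases fin4_cases d with rfl | rfl | rfl | rfl <;>
    simp only [connT, vec4_zero, vec4_one, vec4_two, vec4_three, mul_one, mul_zero, neg_zero,
      zero_sub, sub_zero] <;>
    first
    | exact hasDerivAt_const _ _
    | exact hx _
    | exact (hx _).neg
    | exact (hx _).sub_const 2
    | exact (hx _).const_sub 2

end IsProfile

/-! ### The curvature tensor -/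

/-- The antisymmetric `4 × 4` matrix with the given entries above the diagonal. -/
def asymT {R : Type*} [Zero R] [Neg R] (x01 x02 x03 x12 x13 x23 : R) : Fin 4 → Fin 4 → R :=
  ![![0, x01, x02, x03], ![-x01, 0, x12, x13], ![-x02, -x12, 0, x23], ![-x03, -x13, -x23, 0]]

/-- The tensors with the algebraic symmetries of a curvature tensor which are invariant under the
symmetries of the ansatz: `x_ab` is the component with indices `a b a b`, and `v` accounts for the
components with four distinct indices, whose cyclic sum vanishes. -/
noncomputable def curvT (x01 x02 x12 x23 v : ℝ) (a b c d : Fin 4) : ℝ :=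
  (![![0, asymT x01 0 0 0 0 (-2 * v), asymT 0 x02 0 0 (-v) 0, asymT 0 0 x02 v 0 0],
    ![-asymT x01 0 0 0 0 (-2 * v), 0, asymT 0 0 v x12 0 0, asymT 0 (-v) 0 0 x12 0],
    ![-asymT 0 x02 0 0 (-v) 0, -asymT 0 0 v x12 0 0, 0, asymT (-2 * v) 0 0 0 0 x23],
    ![-asymT 0 0 x02 v 0 0, -asymT 0 (-v) 0 0 x12 0, -asymT (-2 * v) 0 0 0 0 x23, 0]] :
      Fin 4 → Fin 4 → Fin 4 → Fin 4 → ℝ) a b c d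

namespace IsProfile

variable {I : Set ℝ} {F C : ℝ → ℝ} (h : IsProfile I F C)

include h

set_option maxHeartbeats 1000000 in
/-- The Riemann tensor, in terms of the values `f`, `p`, `k` of `F`, `F' / F`, `C' / C` and the
derivatives `p'`, `k'` of the last two. The index `d`, which is raised in `riemann`,
accounts for the factor `diagInvT f d`. -/
theorem riemann_ansatz {q : ℍ[ℝ]} (hq : q ∈ mfd I) {f p k p' k' : ℝ} (hf : F (zcoord q) = f)
    (hp : logDeriv F (zcoord q) = p) (hk : logDeriv C (zcoord q) = k)
    (hp' : deriv (logDeriv F) (zcoord q) = p') (hk' : deriv (logDeriv C) (zcoord q) = k')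
    (a b c d : Fin 4) :
    riemann (ansatzMetric F C) a b c d q
      = curvT (f * (k' + p * k + p' + p ^ 2) / 2) (k' / 2 + p * k / 4)
          (f ^ 2 * (k ^ 2 - 1 + p * k)) (f * k ^ 2 + 3 * f - 4) (f * p / 2) a b c d
        * diagInvT f d := by
  have hF := (h.pos_F _ hq.2).ne'
  have hfd : ∀ a b c d, frameDeriv a (christoffel (ansatzMetric F C) b c d) q
      = if a = 0 then connT (connJetDeriv f p k p' k') 0 b c d else 0 := by
    intro a b c d
    rw [frameDeriv_radial h.isOpen (fun x hx => h.christoffel_ansatz hx b c d) hq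
      (h.hasDerivAt_connT hq.2 b c d), hf, hp, hk, hp', hk']
  simp only [riemann, hfd, h.christoffel_ansatz hq, structFun_eq hq.1, hf, hp, hk]
  rw [hf] at hF
  -- what remains is, for each choice of indices, an identity of rational functions of the jet
  rcases fin4_cases a with rfl | rfl | rfl | rfl <;>
    rcases fin4_cases b with rfl | rfl | rfl | rfl <;>
    rcases fin4_cases c with rfl | rfl | rfl | rfl <;>
    rcases fin4_cases d with rfl | rfl | rfl | rfl <;>
    simp only [Fin.sum_univ_four, diagInvT, curvT, asymT, connT, connJet_zero, connJet_one,
      connJet_two, connJet_three, connJet_four, connJet_five, connJetDeriv_zero,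
      connJetDeriv_one, connJetDeriv_two, connJetDeriv_three, connJetDeriv_four,
      connJetDeriv_five, structConst, vec4_zero, vec4_one, vec4_two, vec4_three, Fin.reduceEq,
      if_true, if_false, mul_zero, zero_mul, add_zero, zero_add, sub_zero, zero_sub, neg_zero,
      mul_one, one_mul, Pi.neg_apply, Pi.zero_apply] <;>
    (try field_simp) <;> (try ring)

end IsProfile

/-! ### The Ricci and Weyl tensors -/

/-- The diagonal components of the Ricci tensor, in terms of the values of `F`, `F'`, `F''`,
`C' / C` and its derivative. -/
noncomputable def ricciT (f f₁ f₂ k k₁ : ℝ) : Fin 4 → ℝ :=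
  ![-(3 / 2) * k₁ - f₁ * k / f - f₂ / (2 * f),
    -2 * f ^ 2 * k ^ 2 - 2 * f ^ 2 * k₁ + 2 * f ^ 2 - 4 * f * f₁ * k - 2 * f * f₂,
    -2 * f * k ^ 2 - 2 * f * k₁ - 2 * f - 2 * f₁ * k + 4,
    -2 * f * k ^ 2 - 2 * f * k₁ - 2 * f - 2 * f₁ * k + 4]

/-- The scalar curvature up to the conformal factor. -/
noncomputable def scalT (f f₁ f₂ k k₁ : ℝ) : ℝ :=
  -6 * f * k ^ 2 - 12 * f * k₁ - 2 * f - 12 * f₁ * k - 4 * f₂ + 8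

namespace IsProfile

variable {I : Set ℝ} {F C : ℝ → ℝ} (h : IsProfile I F C)

include h

theorem deriv_logDeriv_F {z : ℝ} (hz : z ∈ I) :
    deriv (logDeriv F) z = deriv (deriv F) z / F z - (deriv F z / F z) ^ 2 := by
  have h1 := hasDerivAt_of_contDiffOn_infty h.isOpen h.smooth_F hz
  have h2 := hasDerivAt_of_contDiffOn_infty h.isOpen
    (contDiffOn_infty_deriv h.isOpen h.smooth_F) hz
  have hF := (h.pos_F z hz).ne'
  have h3 : HasDerivAt (logDeriv F) _ z := h2.div h1 hF
  rw [h3.deriv]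
  field_simp

theorem riemann_eq {q : ℍ[ℝ]} (hq : q ∈ mfd I) {f f₁ f₂ k k₁ : ℝ} (hf : F (zcoord q) = f)
    (hf₁ : deriv F (zcoord q) = f₁) (hf₂ : deriv (deriv F) (zcoord q) = f₂)
    (hk : logDeriv C (zcoord q) = k) (hk₁ : deriv (logDeriv C) (zcoord q) = k₁)
    (a b c d : Fin 4) :
    riemann (ansatzMetric F C) a b c d q
      = curvT ((f * k₁ + f₁ * k + f₂) / 2) (k₁ / 2 + f₁ * k / (4 * f))
          (f ^ 2 * k ^ 2 - f ^ 2 + f * f₁ * k) (f * k ^ 2 + 3 * f - 4) (f₁ / 2) a b c d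
        * diagInvT f d := by
  have hF := (h.pos_F _ hq.2).ne'
  rw [hf] at hF
  rw [h.riemann_ansatz hq hf (logDeriv_apply F _) hk (h.deriv_logDeriv_F hq.2) hk₁, hf, hf₁, hf₂]
  congr 2 <;> field_simp
  ring

theorem ricci_eq {q : ℍ[ℝ]} (hq : q ∈ mfd I) {f f₁ f₂ k k₁ : ℝ} (hf : F (zcoord q) = f)
    (hf₁ : deriv F (zcoord q) = f₁) (hf₂ : deriv (deriv F) (zcoord q) = f₂)
    (hk : logDeriv C (zcoord q) = k) (hk₁ : deriv (logDeriv C) (zcoord q) = k₁)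
    (a b : Fin 4) :
    ricci (ansatzMetric F C) a b q = if a = b then ricciT f f₁ f₂ k k₁ a else 0 := by
  have hF := (h.pos_F _ hq.2).ne'
  rw [hf] at hF
  simp only [ricci, h.riemann_eq hq hf hf₁ hf₂ hk hk₁]
  rcases fin4_cases a with rfl | rfl | rfl | rfl <;>
    rcases fin4_cases b with rfl | rfl | rfl | rfl <;>
    simp only [Fin.sum_univ_four, diagInvT, curvT, asymT, ricciT, vec4_zero, vec4_one, vec4_two,
      vec4_three, Fin.reduceEq, if_true, if_false, zero_mul, add_zero, zero_add, neg_zero,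
      Pi.neg_apply, Pi.zero_apply] <;>
    field_simp <;> ring

theorem scal_eq {q : ℍ[ℝ]} (hq : q ∈ mfd I) {f f₁ f₂ k k₁ : ℝ} (hf : F (zcoord q) = f)
    (hf₁ : deriv F (zcoord q) = f₁) (hf₂ : deriv (deriv F) (zcoord q) = f₂)
    (hk : logDeriv C (zcoord q) = k) (hk₁ : deriv (logDeriv C) (zcoord q) = k₁) :
    scal (ansatzMetric F C) q = (C (zcoord q))⁻¹ * scalT f f₁ f₂ k k₁ := by
  have hF := (h.pos_F _ hq.2).ne'
  rw [hf] at hF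
  simp only [scal, h.ricci_eq hq hf hf₁ hf₂ hk hk₁, h.gramInv_ansatz hq, hf, mul_ite, mul_zero,
    Finset.sum_ite_eq, Finset.mem_univ, if_true]
  simp only [Fin.sum_univ_four, diagInvT, ricciT, scalT, vec4_zero, vec4_one, vec4_two,
    vec4_three]
  field_simp
  ring

set_option maxHeartbeats 1000000 in
/-- The Weyl tensor is conformally invariant: the derivatives of `C` cancel. It depends on two
quantities only, `F'' + 2 F - 2` and `F'`. -/
theorem weyl_eq {q : ℍ[ℝ]} (hq : q ∈ mfd I) {f f₁ f₂ : ℝ} (hf : F (zcoord q) = f)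
    (hf₁ : deriv F (zcoord q) = f₁) (hf₂ : deriv (deriv F) (zcoord q) = f₂) (i : Fin 4 → Fin 4) :
    weyl (ansatzMetric F C) i q
      = C (zcoord q) * curvT ((f₂ + 2 * f - 2) / 6) (-(f₂ + 2 * f - 2) / (12 * f))
          (-f * (f₂ + 2 * f - 2) / 3) (2 * (f₂ + 2 * f - 2) / 3) (f₁ / 2)
          (i 0) (i 1) (i 2) (i 3) := by
  have hF := (h.pos_F _ hq.2).ne'
  have hC := (h.pos_C _ hq.2).ne'
  rw [hf] at hF
  obtain ⟨k, hk⟩ : ∃ k, logDeriv C (zcoord q) = k := ⟨_, rfl⟩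
  obtain ⟨k₁, hk₁⟩ : ∃ k₁, deriv (logDeriv C) (zcoord q) = k₁ := ⟨_, rfl⟩
  simp only [weyl, h.riemann_eq hq hf hf₁ hf₂ hk hk₁, h.ricci_eq hq hf hf₁ hf₂ hk hk₁,
    h.scal_eq hq hf hf₁ hf₂ hk hk₁, gram_ansatz F C hq.1, hf, mul_ite, mul_zero, ite_mul, zero_mul,
    Finset.sum_ite_eq', Finset.mem_univ, if_true]
  generalize C (zcoord q) = c at *
  generalize i 0 = a₀
  generalize i 1 = a₁
  generalize i 2 = a₂
  generalize i 3 = a₃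
  rcases fin4_cases a₀ with rfl | rfl | rfl | rfl <;>
    rcases fin4_cases a₁ with rfl | rfl | rfl | rfl <;>
    rcases fin4_cases a₂ with rfl | rfl | rfl | rfl <;>
    rcases fin4_cases a₃ with rfl | rfl | rfl | rfl <;>
    simp only [diagT, diagInvT, curvT, asymT, ricciT, scalT, vec4_zero, vec4_one, vec4_two,
      vec4_three, Fin.reduceEq, if_true, if_false, mul_zero, zero_mul, add_zero, sub_zero,
      zero_sub, neg_zero, sub_self, Pi.neg_apply, Pi.zero_apply] <;>
    (try field_simp) <;> (try ring)

end IsProfile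

/-! ### The self-dual and anti-self-dual Weyl tensors -/

/-- The values of the alternating symbol. -/
def altT : Fin 4 → Fin 4 → Fin 4 → Fin 4 → ℤ :=
  ![![0, asymT 0 0 0 0 0 1, asymT 0 0 0 0 (-1) 0, asymT 0 0 0 1 0 0],
    ![-asymT 0 0 0 0 0 1, 0, asymT 0 0 1 0 0 0, asymT 0 (-1) 0 0 0 0],
    ![-asymT 0 0 0 0 (-1) 0, -asymT 0 0 1 0 0 0, 0, asymT 1 0 0 0 0 0],
    ![-asymT 0 0 0 1 0 0, -asymT 0 (-1) 0 0 0 0, -asymT 1 0 0 0 0 0, 0]]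

theorem altSymbol_eq (a b c d : Fin 4) : altSymbol a b c d = altT a b c d := by
  have h : ∀ a b c d : Fin 4, Int.sign (((b : ℤ) - (a : ℤ)) * ((c : ℤ) - (a : ℤ))
      * ((d : ℤ) - (a : ℤ)) * ((c : ℤ) - (b : ℤ)) * ((d : ℤ) - (b : ℤ)) * ((d : ℤ) - (c : ℤ)))
      = altT a b c d := by decide
  rw [altSymbol, h]

theorem curvT_add (x₁ x₂ x₃ x₄ x₅ y₁ y₂ y₃ y₄ y₅ : ℝ) (a b c d : Fin 4) :
    curvT (x₁ + y₁) (x₂ + y₂) (x₃ + y₃) (x₄ + y₄) (x₅ + y₅) a b c d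
      = curvT x₁ x₂ x₃ x₄ x₅ a b c d + curvT y₁ y₂ y₃ y₄ y₅ a b c d := by
  rcases fin4_cases a with rfl | rfl | rfl | rfl <;>
    rcases fin4_cases b with rfl | rfl | rfl | rfl <;>
    rcases fin4_cases c with rfl | rfl | rfl | rfl <;>
    rcases fin4_cases d with rfl | rfl | rfl | rfl <;>
    simp only [curvT, asymT, vec4_zero, vec4_one, vec4_two, vec4_three, Pi.neg_apply,
      Pi.zero_apply, neg_zero, add_zero] <;> ring

/-- Together with additivity: `curvT` is linear in its five parameters. -/
theorem curvT_smul (r x₁ x₂ x₃ x₄ x₅ : ℝ) (a b c d : Fin 4) :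
    curvT (r * x₁) (r * x₂) (r * x₃) (r * x₄) (r * x₅) a b c d
      = r * curvT x₁ x₂ x₃ x₄ x₅ a b c d := by
  rcases fin4_cases a with rfl | rfl | rfl | rfl <;>
    rcases fin4_cases b with rfl | rfl | rfl | rfl <;>
    rcases fin4_cases c with rfl | rfl | rfl | rfl <;>
    rcases fin4_cases d with rfl | rfl | rfl | rfl <;>
    simp only [curvT, asymT, vec4_zero, vec4_one, vec4_two, vec4_three, Pi.neg_apply,
      Pi.zero_apply, neg_zero, mul_zero] <;> ring

theorem det_gram_ansatz (F C : ℝ → ℝ) {q : ℍ[ℝ]} (hq : q ≠ 0) (hF : F (zcoord q) ≠ 0) :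
    (gram (ansatzMetric F C) q).det = (C (zcoord q) ^ 2 / 2) ^ 2 := by
  have h1 : gram (ansatzMetric F C) q
      = Matrix.diagonal fun a => C (zcoord q) * diagT (F (zcoord q)) a := by
    ext a b
    rw [gram_ansatz F C hq, Matrix.diagonal_apply]
  rw [h1, Matrix.det_diagonal, Fin.prod_univ_four]
  simp only [diagT, vec4_zero, vec4_one, vec4_two, vec4_three]
  field_simp
  ring

namespace IsProfile

variable {I : Set ℝ} {F C : ℝ → ℝ} (h : IsProfile I F C)

include h

/-- The Hodge star exchanges the roles of `F'' + 2 F - 2` and `-3 F'`. -/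
theorem starWeyl_eq {q : ℍ[ℝ]} (hq : q ∈ mfd I) {f f₁ f₂ : ℝ} (hf : F (zcoord q) = f)
    (hf₁ : deriv F (zcoord q) = f₁) (hf₂ : deriv (deriv F) (zcoord q) = f₂) (i : Fin 4 → Fin 4) :
    starWeyl (ansatzMetric F C) i q
      = C (zcoord q) * curvT (-f₁ / 2) (f₁ / (4 * f)) (f * f₁) (-2 * f₁) (-(f₂ + 2 * f - 2) / 6)
          (i 0) (i 1) (i 2) (i 3) := by
  have hF := (h.pos_F _ hq.2).ne'
  have hC := (h.pos_C _ hq.2).ne'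
  simp only [starWeyl, h.gramInv_ansatz hq, h.weyl_eq hq hf hf₁ hf₂, det_gram_ansatz F C hq.1 hF,
    Real.sqrt_sq (by positivity : 0 ≤ C (zcoord q) ^ 2 / 2), hf, mul_ite, mul_zero, ite_mul,
    zero_mul, Finset.sum_ite_eq, Finset.mem_univ, if_true, altSymbol_eq, vec4_zero, vec4_one,
    vec4_two, vec4_three]
  rw [hf] at hF
  generalize C (zcoord q) = c at *
  generalize i 0 = a₀
  generalize i 1 = a₁
  generalize i 2 = a₂
  generalize i 3 = a₃
  rcases fin4_cases a₀ with rfl | rfl | rfl | rfl <;>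
    rcases fin4_cases a₁ with rfl | rfl | rfl | rfl <;>
    simp only [Fin.sum_univ_four, altT, asymT, curvT, vec4_zero, vec4_one, vec4_two, vec4_three,
      Pi.neg_apply, Pi.zero_apply, neg_zero, Int.cast_zero, Int.cast_one, Int.cast_neg, mul_zero,
      zero_mul, add_zero, zero_add, neg_neg, mul_one, diagInvT] <;>
    rcases fin4_cases a₂ with rfl | rfl | rfl | rfl <;>
    rcases fin4_cases a₃ with rfl | rfl | rfl | rfl <;>
    simp only [vec4_zero, vec4_one, vec4_two, vec4_three, neg_zero, mul_zero, add_zero] <;>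
    (try field_simp) <;> (try ring)

/-- The self-dual Weyl tensor is a multiple of a tensor that vanishes nowhere, as it is for a Kähler
metric; the factor is a multiple of `𝓛⁺ F - 1`. -/
theorem weylPlus_eq {q : ℍ[ℝ]} (hq : q ∈ mfd I) {f f₁ f₂ : ℝ} (hf : F (zcoord q) = f)
    (hf₁ : deriv F (zcoord q) = f₁) (hf₂ : deriv (deriv F) (zcoord q) = f₂) (i : Fin 4 → Fin 4) :
    weylPlus (ansatzMetric F C) i q
      = C (zcoord q) * ((f₂ - 3 * f₁ + 2 * f - 2) / 12)
          * curvT 1 (-1 / (2 * f)) (-2 * f) 4 (-1) (i 0) (i 1) (i 2) (i 3) := by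
  have hF := (h.pos_F _ hq.2).ne'
  rw [hf] at hF
  rw [weylPlus, h.weyl_eq hq hf hf₁ hf₂, h.starWeyl_eq hq hf hf₁ hf₂, ← mul_add, ← curvT_add,
    mul_left_comm, ← curvT_smul (1 / 2), mul_assoc, ← curvT_smul ((f₂ - 3 * f₁ + 2 * f - 2) / 12)]
  congr 2 <;> field_simp <;> ring

/-- The counterpart of `weylPlus_eq` for the opposite orientation, with `𝓛⁻ F - 1`. -/
theorem weylMinus_eq {q : ℍ[ℝ]} (hq : q ∈ mfd I) {f f₁ f₂ : ℝ} (hf : F (zcoord q) = f)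
    (hf₁ : deriv F (zcoord q) = f₁) (hf₂ : deriv (deriv F) (zcoord q) = f₂) (i : Fin 4 → Fin 4) :
    weylMinus (ansatzMetric F C) i q
      = C (zcoord q) * ((f₂ + 3 * f₁ + 2 * f - 2) / 12)
          * curvT 1 (-1 / (2 * f)) (-2 * f) 4 1 (i 0) (i 1) (i 2) (i 3) := by
  have hF := (h.pos_F _ hq.2).ne'
  rw [hf] at hF
  have hneg : ∀ x y : ℝ, x - y = x + (-1) * y := fun x y => by ring
  rw [weylMinus, h.weyl_eq hq hf hf₁ hf₂, h.starWeyl_eq hq hf hf₁ hf₂, ← mul_sub, hneg,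
    ← curvT_smul (-1), ← curvT_add, mul_left_comm, ← curvT_smul (1 / 2), mul_assoc,
    ← curvT_smul ((f₂ + 3 * f₁ + 2 * f - 2) / 12)]
  congr 2 <;> field_simp <;> ring

theorem isWeylPlusFlatOn_iff_jet :
    IsWeylPlusFlatOn (ansatzMetric F C) (mfd I)
      ↔ ∀ z ∈ I, deriv (deriv F) z - 3 * deriv F z + 2 * F z - 2 = 0 := by
  constructor
  · intro hW z hz
    obtain ⟨q, hq, rfl⟩ := exists_mem_mfd hz
    have h1 := hW q hq ![0, 1, 0, 1]
    rw [h.weylPlus_eq hq rfl rfl rfl] at h1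
    have hC := h.pos_C _ hz
    simp only [vec4_zero, vec4_one, vec4_two, vec4_three, curvT, asymT] at h1
    simp only [mul_one, mul_eq_zero, hC.ne', false_or] at h1
    linarith
  · intro hW q hq i
    rw [h.weylPlus_eq hq rfl rfl rfl, hW _ hq.2]
    simp

theorem isWeylMinusFlatOn_iff_jet :
    IsWeylMinusFlatOn (ansatzMetric F C) (mfd I)
      ↔ ∀ z ∈ I, deriv (deriv F) z + 3 * deriv F z + 2 * F z - 2 = 0 := by
  constructor
  · intro hW z hz
    obtain ⟨q, hq, rfl⟩ := exists_mem_mfd hz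
    have h1 := hW q hq ![0, 1, 0, 1]
    rw [h.weylMinus_eq hq rfl rfl rfl] at h1
    have hC := h.pos_C _ hz
    simp only [vec4_zero, vec4_one, vec4_two, vec4_three, curvT, asymT] at h1
    simp only [mul_one, mul_eq_zero, hC.ne', false_or] at h1
    linarith
  · intro hW q hq i
    rw [h.weylMinus_eq hq rfl rfl rfl, hW _ hq.2]
    simp

end IsProfile

/-! ### The divergence of the Weyl tensor -/

/-- Covariant differentiation commutes with the contraction of two indices: `hcompat` says that
the inverse metric `diag g`, with derivative `diag g'` in the direction `0`, is parallel for the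
connection with components `Γ`. -/
theorem contract_covDeriv {g g' : Fin 4 → ℝ} {Γ : Fin 4 → Fin 4 → Fin 4 → ℝ}
    (hcompat : ∀ t s m, g s * Γ t s m + g m * Γ t m s
      = if t = 0 then if s = m then -g' s else 0 else 0)
    (R R' : Fin 4 → Fin 4 → Fin 4 → Fin 4 → Fin 4 → ℝ) (t i j r : Fin 4) :
    ∑ s, g s * ((if t = 0 then R' s s i j r else 0)
        - ∑ m, (Γ t s m * R m s i j r + Γ t s m * R s m i j r + Γ t i m * R s s m j r
          + Γ t j m * R s s i m r + Γ t r m * R s s i j m))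
      = (if t = 0 then ∑ s, (g' s * R s s i j r + g s * R' s s i j r) else 0)
        - ∑ m, (Γ t i m * (∑ s, g s * R s s m j r) + Γ t j m * (∑ s, g s * R s s i m r)
          + Γ t r m * (∑ s, g s * R s s i j m)) := by
  have key : ∑ s, ∑ m, (g s * (Γ t s m * R m s i j r) + g s * (Γ t s m * R s m i j r))
      = if t = 0 then -∑ s, g' s * R s s i j r else 0 := by
    have h1 : ∑ s, ∑ m, g s * (Γ t s m * R m s i j r)
        = ∑ s, ∑ m, g m * (Γ t m s * R s m i j r) := Finset.sum_comm
    simp only [Finset.sum_add_distrib]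
    rw [h1]
    simp only [← Finset.sum_add_distrib]
    have h2 : ∀ s m, g m * (Γ t m s * R s m i j r) + g s * (Γ t s m * R s m i j r)
        = (if t = 0 then if s = m then -g' s else 0 else 0) * R s m i j r := by
      intro s m
      rw [← hcompat]
      ring
    simp only [h2]
    split_ifs with h0
    · simp
    · simp
  have h3 : ∀ s, g s * ((if t = 0 then R' s s i j r else 0)
        - ∑ m, (Γ t s m * R m s i j r + Γ t s m * R s m i j r + Γ t i m * R s s m j r
          + Γ t j m * R s s i m r + Γ t r m * R s s i j m))
      = (if t = 0 then g s * R' s s i j r else 0)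
        - ∑ m, (g s * (Γ t s m * R m s i j r) + g s * (Γ t s m * R s m i j r))
        - ∑ m, (Γ t i m * (g s * R s s m j r) + Γ t j m * (g s * R s s i m r)
          + Γ t r m * (g s * R s s i j m)) := by
    intro s
    rw [sub_sub, ← Finset.sum_add_distrib, mul_sub, Finset.mul_sum, mul_ite, mul_zero]
    congr 1
    exact Finset.sum_congr rfl fun m _ => by ring
  simp only [h3, Finset.sum_sub_distrib, key, Finset.mul_sum]
  rw [Finset.sum_comm (f := fun s m => Γ t i m * (g s * R s s m j r)
    + Γ t j m * (g s * R s s i m r) + Γ t r m * (g s * R s s i j m))]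
  simp only [Finset.sum_add_distrib]
  split_ifs <;> simp
  ring

/-- The components of the Levi-Civita connection as functions of `z`. -/
noncomputable def connR (F C : ℝ → ℝ) (a b d : Fin 4) (z : ℝ) : ℝ :=
  connT (connJet (F z) (logDeriv F z) (logDeriv C z)) 1 a b d

/-- The components of the Weyl tensor as functions of `z`. -/
noncomputable def weylR (F C : ℝ → ℝ) (a b c d : Fin 4) (z : ℝ) : ℝ :=
  C z * curvT ((deriv (deriv F) z + 2 * F z - 2) / 6)
    (-(deriv (deriv F) z + 2 * F z - 2) / (12 * F z))
    (-F z * (deriv (deriv F) z + 2 * F z - 2) / 3) (2 * (deriv (deriv F) z + 2 * F z - 2) / 3)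
    (deriv F z / 2) a b c d

/-- The components of the covariant derivative of the Weyl tensor as functions of `z`. -/
noncomputable def covWeylR (F C : ℝ → ℝ) (e a b c d : Fin 4) (z : ℝ) : ℝ :=
  (if e = 0 then deriv (weylR F C a b c d) z else 0)
    - ∑ m, (connR F C e a m z * weylR F C m b c d z + connR F C e b m z * weylR F C a m c d z
      + connR F C e c m z * weylR F C a b m d z + connR F C e d m z * weylR F C a b c m z)

theorem curvT_eq_sum (x₁ x₂ x₃ x₄ x₅ : ℝ) (a b c d : Fin 4) :
    curvT x₁ x₂ x₃ x₄ x₅ a b c d = x₁ * curvT 1 0 0 0 0 a b c d + x₂ * curvT 0 1 0 0 0 a b c d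
      + x₃ * curvT 0 0 1 0 0 a b c d + x₄ * curvT 0 0 0 1 0 a b c d
      + x₅ * curvT 0 0 0 0 1 a b c d := by
  simp only [← curvT_smul, ← curvT_add]
  congr 1 <;> ring

theorem hasDerivAt_curvT {x₁ x₂ x₃ x₄ x₅ : ℝ → ℝ} {y₁ y₂ y₃ y₄ y₅ z : ℝ}
    (h₁ : HasDerivAt x₁ y₁ z) (h₂ : HasDerivAt x₂ y₂ z) (h₃ : HasDerivAt x₃ y₃ z)
    (h₄ : HasDerivAt x₄ y₄ z) (h₅ : HasDerivAt x₅ y₅ z) (a b c d : Fin 4) :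
    HasDerivAt (fun z => curvT (x₁ z) (x₂ z) (x₃ z) (x₄ z) (x₅ z) a b c d)
      (curvT y₁ y₂ y₃ y₄ y₅ a b c d) z := by
  rw [curvT_eq_sum y₁]
  simp only [curvT_eq_sum (x₁ _)]
  exact ((((h₁.mul_const _).add (h₂.mul_const _)).add (h₃.mul_const _)).add
    (h₄.mul_const _)).add (h₅.mul_const _)

theorem contDiffOn_curvT {I : Set ℝ} {x₁ x₂ x₃ x₄ x₅ : ℝ → ℝ} (h₁ : ContDiffOn ℝ ∞ x₁ I)
    (h₂ : ContDiffOn ℝ ∞ x₂ I) (h₃ : ContDiffOn ℝ ∞ x₃ I) (h₄ : ContDiffOn ℝ ∞ x₄ I)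
    (h₅ : ContDiffOn ℝ ∞ x₅ I) (a b c d : Fin 4) :
    ContDiffOn ℝ ∞ (fun z => curvT (x₁ z) (x₂ z) (x₃ z) (x₄ z) (x₅ z) a b c d) I := by
  simp only [curvT_eq_sum (x₁ _)]
  exact ((((h₁.mul contDiffOn_const).add (h₂.mul contDiffOn_const)).add
    (h₃.mul contDiffOn_const)).add (h₄.mul contDiffOn_const)).add (h₅.mul contDiffOn_const)

/-- The tensors with the symmetries that the divergence of the Weyl tensor has for the ansatz. -/
noncomputable def divT (x x' y : ℝ) (i j t : Fin 4) : ℝ :=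
  (![![![0, 0, 0, 0], ![0, 0, 0, 0], ![0, 0, 0, 0], ![0, 0, 0, 0]],
    ![![0, x', 0, 0], ![-x', 0, 0, 0], ![0, 0, 0, 2 * y], ![0, 0, -2 * y, 0]],
    ![![0, 0, -x, 0], ![0, 0, 0, y], ![x, 0, 0, 0], ![0, -y, 0, 0]],
    ![![0, 0, 0, -x], ![0, 0, -y, 0], ![0, y, 0, 0], ![x, 0, 0, 0]]] :
      Fin 4 → Fin 4 → Fin 4 → ℝ) i j t

theorem hasDerivAt_divT {x x' y : ℝ → ℝ} {dx dx' dy z : ℝ} (hx : HasDerivAt x dx z)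
    (hx' : HasDerivAt x' dx' z) (hy : HasDerivAt y dy z) (i j t : Fin 4) :
    HasDerivAt (fun z => divT (x z) (x' z) (y z) i j t) (divT dx dx' dy i j t) z := by
  rcases fin4_cases i with rfl | rfl | rfl | rfl <;>
    rcases fin4_cases j with rfl | rfl | rfl | rfl <;>
    rcases fin4_cases t with rfl | rfl | rfl | rfl <;>
    simp only [divT, vec4_zero, vec4_one, vec4_two, vec4_three] <;>
    first
    | exact hasDerivAt_const _ _
    | exact hx
    | exact hx'
    | exact hy
    | exact hx.neg
    | exact hx'.neg
    | exact hy.neg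
    | exact hy.const_mul 2
    | exact hy.const_mul (-2)

namespace IsProfile

variable {I : Set ℝ} {F C : ℝ → ℝ} (h : IsProfile I F C)

include h

theorem contDiffOn_connR (a b d : Fin 4) : ContDiffOn ℝ ∞ (connR F C a b d) I := by
  have hF := h.smooth_F
  have hp := h.smooth_logDeriv_F
  have hk := h.smooth_logDeriv_C
  have hx : ∀ i, ContDiffOn ℝ ∞ (fun z => connJet (F z) (logDeriv F z) (logDeriv C z) i) I := by
    intro i
    fin_cases i
    · exact (hk.sub hp).div_const 2
    · exact (hk.add hp).div_const 2
    · exact hk.div_const 2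
    · exact (contDiffOn_const.mul (hF.pow 2)).mul (hk.add hp)
    · exact (contDiffOn_const.mul hF).mul hk
    · exact hF
  unfold connR
  rcases fin4_cases a with rfl | rfl | rfl | rfl <;>
    rcases fin4_cases b with rfl | rfl | rfl | rfl <;>
    rcases fin4_cases d with rfl | rfl | rfl | rfl <;>
    simp only [connT, vec4_zero, vec4_one, vec4_two, vec4_three] <;>
    first
    | exact contDiffOn_const
    | exact hx _
    | exact (hx _).neg
    | exact (hx _).sub contDiffOn_const
    | exact contDiffOn_const.sub (hx _)

theorem contDiffOn_weylR (a b c d : Fin 4) : ContDiffOn ℝ ∞ (weylR F C a b c d) I := by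
  have hF := h.smooth_F
  have hF1 := contDiffOn_infty_deriv h.isOpen hF
  have hF2 := contDiffOn_infty_deriv h.isOpen hF1
  have hu : ContDiffOn ℝ ∞ (fun z => deriv (deriv F) z + 2 * F z - 2) I :=
    (hF2.add (contDiffOn_const.mul hF)).sub contDiffOn_const
  refine h.smooth_C.mul (contDiffOn_curvT (hu.div_const 6) ?_ ?_ ?_ (hF1.div_const 2) a b c d)
  · exact hu.neg.div (contDiffOn_const.mul hF) fun z hz =>
      mul_ne_zero (by norm_num) (h.pos_F z hz).ne'
  · exact (hF.neg.mul hu).div_const 3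
  · exact (contDiffOn_const.mul hu).div_const 3

theorem contDiffOn_covWeylR (e a b c d : Fin 4) : ContDiffOn ℝ ∞ (covWeylR F C e a b c d) I := by
  have hW := h.contDiffOn_weylR
  have hG := h.contDiffOn_connR
  refine ContDiffOn.sub ?_ (ContDiffOn.sum fun m _ => ?_)
  · split_ifs
    · exact contDiffOn_infty_deriv h.isOpen (hW a b c d)
    · exact contDiffOn_const
  · exact ((((hG e a m).mul (hW m b c d)).add ((hG e b m).mul (hW a m c d))).add
      ((hG e c m).mul (hW a b m d))).add ((hG e d m).mul (hW a b c m))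

/-- The covariant derivative of a tensor whose components depend on `z` only. -/
theorem covDeriv_radial {n : ℕ} {T : (Fin n → Fin 4) → ℍ[ℝ] → ℝ} {t : (Fin n → Fin 4) → ℝ → ℝ}
    (hT : ∀ j, ∀ x ∈ mfd I, T j x = t j (zcoord x)) (ht : ∀ j, ContDiffOn ℝ ∞ (t j) I)
    {q : ℍ[ℝ]} (hq : q ∈ mfd I) (i : Fin (n + 1) → Fin 4) :
    covDeriv (ansatzMetric F C) T i q
      = (if i 0 = 0 then deriv (t (Fin.tail i)) (zcoord q) else 0)
        - ∑ k : Fin n, ∑ m : Fin 4, connR F C (i 0) (Fin.tail i k) m (zcoord q)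
          * t (Function.update (Fin.tail i) k m) (zcoord q) := by
  rw [covDeriv, frameDeriv_radial h.isOpen (hT _) hq
    (hasDerivAt_of_contDiffOn_infty h.isOpen (ht _) hq.2)]
  simp only [h.christoffel_ansatz hq, hT _ q hq]
  rfl

theorem weyl_eq_weylR {q : ℍ[ℝ]} (hq : q ∈ mfd I) (i : Fin 4 → Fin 4) :
    weyl (ansatzMetric F C) i q = weylR F C (i 0) (i 1) (i 2) (i 3) (zcoord q) :=
  h.weyl_eq hq rfl rfl rfl i

theorem covDeriv_weyl_eq {q : ℍ[ℝ]} (hq : q ∈ mfd I) (i : Fin 5 → Fin 4) :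
    covDeriv (ansatzMetric F C) (weyl (ansatzMetric F C)) i q
      = covWeylR F C (i 0) (i 1) (i 2) (i 3) (i 4) (zcoord q) := by
  rw [h.covDeriv_radial (fun j x hx => h.weyl_eq_weylR hx j) (fun j => h.contDiffOn_weylR _ _ _ _)
    hq, covWeylR]
  simp only [Fin.sum_univ_four (f := fun k => ∑ m, connR F C (i 0) (Fin.tail i k) m (zcoord q) * _),
    ← Finset.sum_add_distrib]
  simp [Fin.tail, Function.update]

theorem covDeriv_covDeriv_weyl_eq {q : ℍ[ℝ]} (hq : q ∈ mfd I) (t s i j r : Fin 4) :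
    covDeriv (ansatzMetric F C) (covDeriv (ansatzMetric F C) (weyl (ansatzMetric F C)))
        ![t, s, s, i, j, r] q
      = (if t = 0 then deriv (covWeylR F C s s i j r) (zcoord q) else 0)
        - ∑ m, (connR F C t s m (zcoord q) * covWeylR F C m s i j r (zcoord q)
          + connR F C t s m (zcoord q) * covWeylR F C s m i j r (zcoord q)
          + connR F C t i m (zcoord q) * covWeylR F C s s m j r (zcoord q)
          + connR F C t j m (zcoord q) * covWeylR F C s s i m r (zcoord q)
          + connR F C t r m (zcoord q) * covWeylR F C s s i j m (zcoord q)) := by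
  rw [h.covDeriv_radial (fun j x hx => h.covDeriv_weyl_eq hx j)
    (fun j => h.contDiffOn_covWeylR _ _ _ _ _) hq]
  simp only [Fin.sum_univ_five, ← Finset.sum_add_distrib]
  simp [Fin.tail, Function.update]
  rfl

end IsProfile

/-! ### The Bach tensor -/

/-- The components of the divergence of the Weyl tensor as functions of `z`. -/
noncomputable def divWeylR (F C : ℝ → ℝ) (i j t : Fin 4) (z : ℝ) : ℝ :=
  ∑ s, (C z)⁻¹ * diagInvT (F z) s * covWeylR F C s s i j t z

/-- The diagonal components of the Bach tensor up to the conformal factor, in terms of the values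
of `F`, …, `F''''`. -/
noncomputable def bachT (f f₁ f₂ f₃ f₄ : ℝ) : Fin 4 → ℝ :=
  ![(-(2 / 3) * (f - 1) ^ 2 + 5 / 6 * f₁ ^ 2 - 1 / 3 * f₁ * f₃ + 1 / 6 * f₂ ^ 2) / f,
    -40 / 3 * f ^ 3 + 40 / 3 * f ^ 2 * f₂ - 8 / 3 * f ^ 2 * f₄ + 16 * f ^ 2 + 10 / 3 * f * f₁ ^ 2
      - 4 / 3 * f * f₁ * f₃ + 2 / 3 * f * f₂ ^ 2 - 8 / 3 * f,
    8 * f ^ 2 - 20 / 3 * f * f₂ + 4 / 3 * f * f₄ - 32 / 3 * f - 10 / 3 * f₁ ^ 2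
      + 4 / 3 * f₁ * f₃ - 2 / 3 * f₂ ^ 2 + 8 / 3,
    8 * f ^ 2 - 20 / 3 * f * f₂ + 4 / 3 * f * f₄ - 32 / 3 * f - 10 / 3 * f₁ ^ 2
      + 4 / 3 * f₁ * f₃ - 2 / 3 * f₂ ^ 2 + 8 / 3]

/-- The inverse metric is parallel, in the form needed by `contract_covDeriv`. -/
theorem diagInv_compat {f : ℝ} (hf : f ≠ 0) (c p k : ℝ) (t s m : Fin 4) :
    c⁻¹ * diagInvT f s * connT (connJet f p k) 1 t s m
        + c⁻¹ * diagInvT f m * connT (connJet f p k) 1 t m s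
      = if t = 0 then if s = m then -(-(c⁻¹ * diagInvT f s * (k + diagLogT p s))) else 0
        else 0 := by
  rcases fin4_cases t with rfl | rfl | rfl | rfl <;>
    rcases fin4_cases s with rfl | rfl | rfl | rfl <;>
    rcases fin4_cases m with rfl | rfl | rfl | rfl <;>
    simp only [diagInvT, diagLogT, connT, connJet_zero, connJet_one, connJet_two, connJet_three,
      connJet_four, connJet_five, vec4_zero, vec4_one, vec4_two, vec4_three, Fin.reduceEq,
      if_true, if_false, mul_zero, add_zero] <;>
    (try field_simp) <;> (try ring)

namespace IsProfile

variable {I : Set ℝ} {F C : ℝ → ℝ} (h : IsProfile I F C)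

include h

theorem hasDerivAt_diagInvT {z : ℝ} (hz : z ∈ I) (a : Fin 4) :
    HasDerivAt (fun z => (C z)⁻¹ * diagInvT (F z) a)
      (-((C z)⁻¹ * diagInvT (F z) a * (logDeriv C z + diagLogT (logDeriv F z) a))) z := by
  have h1 := h.hasDerivAt_diagT hz a
  have hne : ∀ y ∈ I, C y * diagT (F y) a ≠ 0 := fun y hy =>
    mul_ne_zero (h.pos_C y hy).ne' (diagT_ne_zero (h.pos_F y hy).ne' a)
  have hinv : ∀ y ∈ I, (C y)⁻¹ * diagInvT (F y) a = (C y * diagT (F y) a)⁻¹ := by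
    intro y hy
    rw [mul_inv, eq_inv_of_mul_eq_one_right (diagT_mul_diagInvT (h.pos_F y hy).ne' a)]
  have h2 := (h1.inv (hne z hz)).congr_of_eventuallyEq
    (f₁ := fun z => (C z)⁻¹ * diagInvT (F z) a)
    (Filter.mem_of_superset (h.isOpen.mem_nhds hz) hinv)
  refine h2.congr_deriv ?_
  rw [hinv z hz]
  have := hne z hz
  field_simp

theorem hasDerivAt_weylR {z : ℝ} (hz : z ∈ I) {c f f₁ f₂ f₃ k : ℝ} (hc : C z = c) (hf : F z = f)
    (hf₁ : deriv F z = f₁) (hf₂ : deriv (deriv F) z = f₂) (hf₃ : deriv (deriv (deriv F)) z = f₃)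
    (hk : logDeriv C z = k) (a b c' d : Fin 4) :
    HasDerivAt (weylR F C a b c' d)
      (c * curvT ((f₃ + 2 * f₁) / 6 + k * ((f₂ + 2 * f - 2) / 6))
        (-(f₃ + 2 * f₁) / (12 * f) + (f₂ + 2 * f - 2) * f₁ / (12 * f ^ 2)
          + k * (-(f₂ + 2 * f - 2) / (12 * f)))
        (-(f₁ * (f₂ + 2 * f - 2) + f * (f₃ + 2 * f₁)) / 3 + k * (-f * (f₂ + 2 * f - 2) / 3))
        (2 * (f₃ + 2 * f₁) / 3 + k * (2 * (f₂ + 2 * f - 2) / 3)) (f₂ / 2 + k * (f₁ / 2)) a b c' d)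
      z := by
  have hF := hasDerivAt_of_contDiffOn_infty h.isOpen h.smooth_F hz
  have sF1 := contDiffOn_infty_deriv h.isOpen h.smooth_F
  have hF1 := hasDerivAt_of_contDiffOn_infty h.isOpen sF1 hz
  have hF2 := hasDerivAt_of_contDiffOn_infty h.isOpen (contDiffOn_infty_deriv h.isOpen sF1) hz
  have hC := h.hasDerivAt_C hz
  have hF0 := (h.pos_F z hz).ne'
  have hu := (hF2.add (hF.const_mul 2)).sub_const 2
  have hw := hasDerivAt_curvT (hu.div_const 6)
    (hu.neg.div (hF.const_mul 12) (mul_ne_zero (by norm_num) hF0))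
    ((hF.neg.mul hu).div_const 3) ((hu.const_mul 2).div_const 3) (hF1.div_const 2) a b c' d
  refine (hC.mul hw).congr_deriv ?_
  simp only [Pi.add_apply, Pi.neg_apply, Pi.mul_apply, Pi.div_apply]
  rw [hf] at hF0
  rw [hc, hf, hf₁, hf₂, hf₃, hk, mul_assoc, ← mul_add, ← curvT_smul k, ← curvT_add]
  congr 2 <;> field_simp <;> ring

set_option maxHeartbeats 4000000 in
/-- The divergence of the Weyl tensor. Unlike the Weyl tensor it depends on `C' / C`. -/
theorem divWeylR_eq {z : ℝ} (hz : z ∈ I) {f f₁ f₂ f₃ k : ℝ} (hf : F z = f)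
    (hf₁ : deriv F z = f₁) (hf₂ : deriv (deriv F) z = f₂) (hf₃ : deriv (deriv (deriv F)) z = f₃)
    (hk : logDeriv C z = k) (i j t : Fin 4) :
    divWeylR F C i j t z = divT (f * k / 3 - 5 / 6 * f₁ + f₂ * k / 6 + f₃ / 3 - k / 3)
      (2 * f * (f * k / 3 - 5 / 6 * f₁ + f₂ * k / 6 + f₃ / 3 - k / 3))
      (2 * f ^ 2 - f * f₁ * k - f * f₂ - 2 * f) i j t := by
  have hF0 := (h.pos_F z hz).ne'
  have hC0 := (h.pos_C z hz).ne'
  obtain ⟨c, hc⟩ : ∃ c, C z = c := ⟨_, rfl⟩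
  simp only [divWeylR, covWeylR, (h.hasDerivAt_weylR hz hc hf hf₁ hf₂ hf₃ hk _ _ _ _).deriv,
    connR, weylR, logDeriv_apply F, hc, hf, hf₁, hf₂, hk]
  rw [hf] at hF0
  rw [hc] at hC0
  rcases fin4_cases i with rfl | rfl | rfl | rfl <;>
    rcases fin4_cases j with rfl | rfl | rfl | rfl <;>
    rcases fin4_cases t with rfl | rfl | rfl | rfl <;>
    simp only [Fin.sum_univ_four, diagInvT, curvT, asymT, divT, connT, connJet_zero, connJet_one,
      connJet_two, connJet_three, connJet_four, connJet_five, vec4_zero, vec4_one, vec4_two,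
      vec4_three, Fin.reduceEq, if_true, if_false, mul_zero, zero_mul, add_zero, zero_add,
      zero_sub, neg_zero, sub_self, Pi.neg_apply, Pi.zero_apply] <;>
    (try field_simp) <;> (try ring)

end IsProfile

namespace IsProfile

variable {I : Set ℝ} {F C : ℝ → ℝ} (h : IsProfile I F C)

include h

theorem hasDerivAt_divWeylR {z : ℝ} (hz : z ∈ I) {f f₁ f₂ f₃ f₄ k k₁ : ℝ} (hf : F z = f)
    (hf₁ : deriv F z = f₁) (hf₂ : deriv (deriv F) z = f₂) (hf₃ : deriv (deriv (deriv F)) z = f₃)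
    (hf₄ : deriv (deriv (deriv (deriv F))) z = f₄) (hk : logDeriv C z = k)
    (hk₁ : deriv (logDeriv C) z = k₁) (i j t : Fin 4) :
    HasDerivAt (divWeylR F C i j t)
      (divT (f₁ * k / 3 + f * k₁ / 3 - 5 / 6 * f₂ + f₃ * k / 6 + f₂ * k₁ / 6 + f₄ / 3 - k₁ / 3)
        (2 * f₁ * (f * k / 3 - 5 / 6 * f₁ + f₂ * k / 6 + f₃ / 3 - k / 3)
          + 2 * f * (f₁ * k / 3 + f * k₁ / 3 - 5 / 6 * f₂ + f₃ * k / 6 + f₂ * k₁ / 6 + f₄ / 3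
            - k₁ / 3))
        (4 * f * f₁ - f₁ ^ 2 * k - f * f₂ * k - f * f₁ * k₁ - f₁ * f₂ - f * f₃ - 2 * f₁) i j t)
      z := by
  have hF := hasDerivAt_of_contDiffOn_infty h.isOpen h.smooth_F hz
  have sF1 := contDiffOn_infty_deriv h.isOpen h.smooth_F
  have hF1 := hasDerivAt_of_contDiffOn_infty h.isOpen sF1 hz
  have sF2 := contDiffOn_infty_deriv h.isOpen sF1
  have hF2 := hasDerivAt_of_contDiffOn_infty h.isOpen sF2 hz
  have hF3 := hasDerivAt_of_contDiffOn_infty h.isOpen (contDiffOn_infty_deriv h.isOpen sF2) hz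
  have hK := h.hasDerivAt_logDeriv_C hz
  rw [hf₁] at hF
  rw [hf₂] at hF1
  rw [hf₃] at hF2
  rw [hf₄] at hF3
  rw [hk₁] at hK
  have hX := (((((hF.mul hK).div_const 3).sub (hF1.const_mul (5 / 6))).add
    ((hF2.mul hK).div_const 6)).add (hF3.div_const 3)).sub (hK.div_const 3)
  have hX' := (hF.const_mul 2).mul hX
  have hY := (((((hF.pow 2).const_mul 2).sub ((hF.mul hF1).mul hK)).sub (hF.mul hF2)).sub
    (hF.const_mul 2))
  have hD := (hasDerivAt_divT hX hX' hY i j t).congr_of_eventuallyEq (f₁ := divWeylR F C i j t)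
    (Filter.mem_of_superset (h.isOpen.mem_nhds hz)
      fun y hy => h.divWeylR_eq hy rfl rfl rfl rfl rfl i j t)
  refine hD.congr_deriv ?_
  simp only [Pi.add_apply, Pi.sub_apply, Pi.mul_apply, hf, hf₁, hf₂, hf₃, hk]
  congr 1 <;> ring

/-- The double divergence in the Bach tensor is the divergence of the divergence `divWeylR`, because
the contraction of two indices commutes with covariant differentiation. The second derivatives of
the individual components of the Weyl tensor need not be computed. -/
theorem bach_eq_divWeylR {q : ℍ[ℝ]} (hq : q ∈ mfd I) (i j : Fin 4) :
    bach (ansatzMetric F C) i j q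
      = ∑ t, (C (zcoord q))⁻¹ * diagInvT (F (zcoord q)) t
          * ((if t = 0 then deriv (divWeylR F C i j t) (zcoord q) else 0)
            - ∑ m, (connR F C t i m (zcoord q) * divWeylR F C m j t (zcoord q)
              + connR F C t j m (zcoord q) * divWeylR F C i m t (zcoord q)
              + connR F C t t m (zcoord q) * divWeylR F C i j m (zcoord q)))
        + ∑ t, (1 / 2) * ((C (zcoord q))⁻¹ * diagInvT (F (zcoord q)) t) ^ 2
          * ricciT (F (zcoord q)) (deriv F (zcoord q)) (deriv (deriv F) (zcoord q))
            (logDeriv C (zcoord q)) (deriv (logDeriv C) (zcoord q)) t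
          * weylR F C t i j t (zcoord q) := by
  have hz := hq.2
  have hderiv : ∀ i j t, deriv (divWeylR F C i j t) (zcoord q)
      = ∑ s, (-((C (zcoord q))⁻¹ * diagInvT (F (zcoord q)) s
          * (logDeriv C (zcoord q) + diagLogT (logDeriv F (zcoord q)) s))
            * covWeylR F C s s i j t (zcoord q)
          + (C (zcoord q))⁻¹ * diagInvT (F (zcoord q)) s
            * deriv (covWeylR F C s s i j t) (zcoord q)) := by
    intro i j t
    refine HasDerivAt.deriv ?_
    exact HasDerivAt.fun_sum fun s _ => (h.hasDerivAt_diagInvT hz s).mul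
      (hasDerivAt_of_contDiffOn_infty h.isOpen (h.contDiffOn_covWeylR s s i j t) hz)
  have hcontr := fun t => contract_covDeriv
    (diagInv_compat (h.pos_F _ hz).ne' (C (zcoord q)) (logDeriv F (zcoord q))
      (logDeriv C (zcoord q)))
    (fun a b c d e => covWeylR F C a b c d e (zcoord q))
    (fun a b c d e => deriv (covWeylR F C a b c d e) (zcoord q)) t i j t
  simp only [bach, h.gramInv_ansatz hq, mul_ite, mul_zero, ite_mul, zero_mul, Finset.sum_ite_eq,
    Finset.mem_univ, if_true]
  rw [Finset.sum_comm, ← Finset.sum_add_distrib]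
  refine Finset.sum_congr rfl fun t _ => ?_
  simp only [h.covDeriv_covDeriv_weyl_eq hq, h.weyl_eq_weylR hq, hderiv,
    h.ricci_eq hq rfl rfl rfl rfl rfl, vec4_zero, vec4_one, vec4_two, vec4_three]
  simp only [divWeylR, connR] at hcontr ⊢
  rw [← hcontr t, Finset.mul_sum]
  simp only [mul_add, Finset.sum_add_distrib]
  congr 1
  · exact Finset.sum_congr rfl fun s _ => by ring
  · simp only [mul_ite, mul_zero, ite_mul, zero_mul, Finset.sum_ite_eq', Finset.mem_univ, if_true]
    ring

set_option maxHeartbeats 4000000 in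
/-- The Bach tensor is diagonal, and conformally invariant of weight `-1`: the derivatives of `C`
cancel. -/
theorem bach_eq {q : ℍ[ℝ]} (hq : q ∈ mfd I) {f f₁ f₂ f₃ f₄ : ℝ} (hf : F (zcoord q) = f)
    (hf₁ : deriv F (zcoord q) = f₁) (hf₂ : deriv (deriv F) (zcoord q) = f₂)
    (hf₃ : deriv (deriv (deriv F)) (zcoord q) = f₃)
    (hf₄ : deriv (deriv (deriv (deriv F))) (zcoord q) = f₄) (i j : Fin 4) :
    bach (ansatzMetric F C) i j q
      = if i = j then (C (zcoord q))⁻¹ * bachT f f₁ f₂ f₃ f₄ i else 0 := by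
  have hF0 := (h.pos_F _ hq.2).ne'
  have hC0 := (h.pos_C _ hq.2).ne'
  obtain ⟨k, hk⟩ : ∃ k, logDeriv C (zcoord q) = k := ⟨_, rfl⟩
  obtain ⟨k₁, hk₁⟩ : ∃ k₁, deriv (logDeriv C) (zcoord q) = k₁ := ⟨_, rfl⟩
  obtain ⟨c, hc⟩ : ∃ c, C (zcoord q) = c := ⟨_, rfl⟩
  rw [h.bach_eq_divWeylR hq]
  simp only [(h.hasDerivAt_divWeylR hq.2 hf hf₁ hf₂ hf₃ hf₄ hk hk₁ _ _ _).deriv,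
    h.divWeylR_eq hq.2 hf hf₁ hf₂ hf₃ hk, connR, weylR, logDeriv_apply F, hf, hf₁, hf₂, hk, hk₁, hc]
  rw [hf] at hF0
  rw [hc] at hC0
  rcases fin4_cases i with rfl | rfl | rfl | rfl <;>
    rcases fin4_cases j with rfl | rfl | rfl | rfl <;>
    simp only [Fin.sum_univ_four, diagInvT, curvT, asymT, divT, connT, connJet_zero, connJet_one,
      connJet_two, connJet_three, connJet_four, connJet_five, ricciT, bachT, vec4_zero, vec4_one,
      vec4_two, vec4_three, Fin.reduceEq, if_true, if_false, mul_zero, zero_mul, add_zero,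
      zero_add, zero_sub, neg_zero, sub_self, Pi.neg_apply, Pi.zero_apply] <;>
    (try field_simp) <;> (try ring)

/-- The component `B_00` is a first integral of the fourth-order equation, which itself is a
combination of `B_00` and `B_22`. -/
theorem isBachFlatOn_iff_jet :
    IsBachFlatOn (ansatzMetric F C) (mfd I) ↔ ∀ z ∈ I,
      deriv (deriv (deriv (deriv F))) z - 5 * deriv (deriv F) z + 4 * F z - 4 = 0 ∧
      -(2 / 3) * (F z - 1) ^ 2 + 5 / 6 * deriv F z ^ 2
        - 1 / 3 * deriv F z * deriv (deriv (deriv F)) z + 1 / 6 * deriv (deriv F) z ^ 2 = 0 := by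
  constructor
  · intro hB z hz
    obtain ⟨q, hq, rfl⟩ := exists_mem_mfd hz
    have hC := (h.pos_C _ hz).ne'
    have hF := (h.pos_F _ hz).ne'
    have h0 := hB q hq 0 0
    have h2 := hB q hq 2 2
    rw [h.bach_eq hq rfl rfl rfl rfl rfl, if_pos rfl, mul_eq_zero, inv_eq_zero,
      or_iff_right hC] at h0 h2
    simp only [bachT, vec4_zero, vec4_two] at h0 h2
    rw [div_eq_zero_iff, or_iff_left hF] at h0
    refine ⟨?_, h0⟩
    have h3 : F (zcoord q) * (deriv (deriv (deriv (deriv F))) (zcoord q)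
        - 5 * deriv (deriv F) (zcoord q) + 4 * F (zcoord q) - 4) = 0 := by
      linear_combination 3 / 4 * h2 + 3 * h0
    exact (mul_eq_zero.1 h3).resolve_left hF
  · intro hB q hq i j
    rw [h.bach_eq hq rfl rfl rfl rfl rfl]
    obtain ⟨h4, h0⟩ := hB _ hq.2
    split_ifs
    · have h5 : bachT (F (zcoord q)) (deriv F (zcoord q)) (deriv (deriv F) (zcoord q))
          (deriv (deriv (deriv F)) (zcoord q)) (deriv (deriv (deriv (deriv F))) (zcoord q)) i
          = 0 := by
        rcases fin4_cases i with rfl | rfl | rfl | rfl <;>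
          simp only [bachT, vec4_zero, vec4_one, vec4_two, vec4_three]
        · rw [h0, zero_div]
        · linear_combination 4 * F (zcoord q) * h0 - 8 / 3 * F (zcoord q) ^ 2 * h4
        · linear_combination -4 * h0 + 4 / 3 * F (zcoord q) * h4
        · linear_combination -4 * h0 + 4 / 3 * F (zcoord q) * h4
      rw [h5, mul_zero]
    · rfl

end IsProfile

/-! ### Complex structures and Kähler metrics -/

/-- The action of `ansatzJ` on components with respect to the frame. -/
noncomputable def jT (s : ℝ) (x : Fin 4 → ℝ) : Fin 4 → ℝ :=
  ![-2 * s * x 1, 1 / (2 * s) * x 0, -x 3, x 2]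

theorem ansatzJ_eq (f : ℝ → ℝ) (q v : ℍ[ℝ]) :
    ansatzJ f q v = ∑ d, jT (f (zcoord q)) (fun a => coframe a q v) d • frame d q := by
  simp only [ansatzJ, Fin.sum_univ_four, jT, vec4_zero, vec4_one, vec4_two, vec4_three, neg_smul]
  abel

theorem coframe_sum_smul_frame {q : ℍ[ℝ]} (hq : q ≠ 0) (x : Fin 4 → ℝ) (a : Fin 4) :
    coframe a q (∑ d, x d • frame d q) = x a := by
  simp [coframe_sum, coframe_smul, coframe_frame hq]

theorem ansatzJ_sum (f : ℝ → ℝ) {q : ℍ[ℝ]} (hq : q ≠ 0) (x : Fin 4 → ℝ) :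
    ansatzJ f q (∑ d, x d • frame d q) = ∑ d, jT (f (zcoord q)) x d • frame d q := by
  rw [ansatzJ_eq]
  simp only [coframe_sum_smul_frame hq]

theorem coframe_ansatzJ (f : ℝ → ℝ) {q : ℍ[ℝ]} (hq : q ≠ 0) (v : ℍ[ℝ]) (a : Fin 4) :
    coframe a q (ansatzJ f q v) = jT (f (zcoord q)) (fun a => coframe a q v) a := by
  rw [ansatzJ_eq, coframe_sum_smul_frame hq]

/-- The index of the frame field which is proportional to the image of a given one under the
complex structure. -/
def jIdx : Fin 4 → Fin 4 := ![1, 0, 3, 2]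

/-- The factor of proportionality. -/
noncomputable def jCoef (s : ℝ) : Fin 4 → ℝ := ![1 / (2 * s), -2 * s, 1, -1]

theorem ansatzJ_frame (f : ℝ → ℝ) {q : ℍ[ℝ]} (hq : q ≠ 0) (a : Fin 4) :
    ansatzJ f q (frame a q) = jCoef (f (zcoord q)) a • frame (jIdx a) q := by
  simp only [ansatzJ, coframe_frame hq]
  rcases fin4_cases a with rfl | rfl | rfl | rfl <;> simp [jCoef, jIdx]

theorem differentiableAt_comp_zcoord {u : ℝ → ℝ} {q : ℍ[ℝ]} (hq : q ≠ 0)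
    (hu : DifferentiableAt ℝ u (zcoord q)) : DifferentiableAt ℝ (fun x => u (zcoord x)) q :=
  (hasFDerivAt_comp_zcoord hq hu.hasDerivAt).differentiableAt

theorem lieBracket_smul_frame {u v : ℝ → ℝ} {u' v' : ℝ} {q : ℍ[ℝ]} (hq : q ≠ 0)
    (hu : HasDerivAt u u' (zcoord q)) (hv : HasDerivAt v v' (zcoord q)) (a b : Fin 4) :
    VectorField.lieBracket ℝ (fun x => u (zcoord x) • frame a x)
        (fun x => v (zcoord x) • frame b x) q
      = ∑ d, (u (zcoord q) * v (zcoord q) * structConst a b d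
          + (if a = 0 then u (zcoord q) * v' else 0) * (if d = b then 1 else 0)
          - (if b = 0 then v (zcoord q) * u' else 0) * (if d = a then 1 else 0)) • frame d q := by
  rw [VectorField.lieBracket_smul_right (differentiableAt_comp_zcoord hq hv.differentiableAt)
      (differentiable_frame b q),
    VectorField.lieBracket_smul_left (differentiableAt_comp_zcoord hq hu.differentiableAt)
      (differentiable_frame a q), lieBracket_frame, map_smul,
    fderiv_comp_zcoord_frame hq hv, fderiv_comp_zcoord_frame hq hu]
  simp only [sub_smul, add_smul, Finset.sum_add_distrib, Finset.sum_sub_distrib, mul_ite, mul_one,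
    mul_zero, ite_smul, zero_smul, Finset.sum_ite_eq', Finset.mem_univ, if_true, smul_eq_mul,
    mul_smul, ← Finset.smul_sum, smul_add, neg_smul, smul_neg]
  by_cases ha : a = 0 <;> by_cases hb : b = 0 <;>
    simp only [ha, hb, if_true, if_false, neg_zero, smul_zero, add_zero, zero_add, sub_zero] <;>
    rw [smul_comm (u (zcoord q)) (v (zcoord q))] <;> abel

theorem ansatzMetric_frame_right (F C : ℝ → ℝ) {q : ℍ[ℝ]} (hq : q ≠ 0) (v : ℍ[ℝ]) (c : Fin 4) :
    ansatzMetric F C q v (frame c q)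
      = C (zcoord q) * diagT (F (zcoord q)) c * coframe c q v := by
  simp only [ansatzMetric, coframe_frame hq]
  rcases fin4_cases c with rfl | rfl | rfl | rfl <;> simp [diagT] <;> ring

/-- The derivative of `jCoef`, where `s'` is the derivative of `s`. -/
noncomputable def jCoefDeriv (s s' : ℝ) : Fin 4 → ℝ := ![-s' / (2 * s ^ 2), -2 * s', 0, 0]

theorem hasDerivAt_jCoef {f : ℝ → ℝ} {f' z : ℝ} (hf : HasDerivAt f f' z) (h0 : f z ≠ 0)
    (a : Fin 4) : HasDerivAt (fun z => jCoef (f z) a) (jCoefDeriv (f z) f' a) z := by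
  rcases fin4_cases a with rfl | rfl | rfl | rfl
  · refine ((hasDerivAt_const z (1 : ℝ)).div (hf.const_mul 2)
      (mul_ne_zero two_ne_zero h0)).congr_deriv ?_
    simp only [jCoefDeriv, vec4_zero]
    field_simp
    ring
  · exact hf.const_mul (-2)
  · exact hasDerivAt_const z 1
  · exact hasDerivAt_const z (-1)

/-- The complex structure `J_f` is integrable for every `f`: the forms `dz / (2 f) + i η¹` and
`η² + i η³` generate a differential ideal. -/
theorem nijenhuis_ansatzJ {I : Set ℝ} (hI : IsOpen I) {f : ℝ → ℝ} (hf : DifferentiableOn ℝ f I)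
    (h0 : ∀ z ∈ I, f z ≠ 0) {q : ℍ[ℝ]} (hq : q ∈ mfd I) (a b : Fin 4) :
    nijenhuis (ansatzJ f) (frame a) (frame b) q = 0 := by
  have hd := (hf.differentiableAt (hI.mem_nhds hq.2)).hasDerivAt
  have hs := h0 _ hq.2
  have hJ : ∀ a, (fun x => ansatzJ f x (frame a x))
      =ᶠ[𝓝 q] fun x => (fun z => jCoef (f z) a) (zcoord x) • frame (jIdx a) x := fun a =>
    Filter.mem_of_superset (mfd_mem_nhds hI hq) fun x hx => ansatzJ_frame f hx.1 a
  have h1 : ∀ a, frame a =ᶠ[𝓝 q] fun x => (fun _ => (1 : ℝ)) (zcoord x) • frame a x := fun a =>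
    Filter.Eventually.of_forall fun x => (one_smul ℝ _).symm
  have hone := hasDerivAt_const (zcoord q) (1 : ℝ)
  have hc := fun a => hasDerivAt_jCoef hd hs a
  rw [nijenhuis, (hJ a).lieBracket_vectorField_eq (hJ b),
    (hJ a).lieBracket_vectorField_eq (h1 b), (h1 a).lieBracket_vectorField_eq (hJ b),
    lieBracket_frame, lieBracket_smul_frame hq.1 (hc a) (hc b),
    lieBracket_smul_frame hq.1 (hc a) hone, lieBracket_smul_frame hq.1 hone (hc b),
    ansatzJ_sum f hq.1, ansatzJ_sum f hq.1]
  simp only [← Finset.sum_sub_distrib, ← sub_smul]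
  refine Finset.sum_eq_zero fun d _ => ?_
  generalize f (zcoord q) = s at *
  generalize deriv f (zcoord q) = s'
  refine smul_eq_zero_of_left ?_ _
  rcases fin4_cases a with rfl | rfl | rfl | rfl <;>
    rcases fin4_cases b with rfl | rfl | rfl | rfl <;>
    rcases fin4_cases d with rfl | rfl | rfl | rfl <;>
    simp only [jT, jCoef, jCoefDeriv, jIdx, structConst, vec4_zero, vec4_one, vec4_two, vec4_three,
      Fin.reduceEq, if_true, if_false, mul_zero, add_zero, zero_add, sub_self, mul_one,
      one_mul, neg_zero, sub_zero, zero_sub, neg_neg] <;>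
    (try field_simp) <;> (try ring)

namespace IsProfile

variable {I : Set ℝ} {F C : ℝ → ℝ} (h : IsProfile I F C)

include h

/-- The Kähler form is `C (ε / 2 dz ∧ η¹ + η² ∧ η³)`, with exterior derivative
`(C' + ε C) dz ∧ η² ∧ η³`; the other conditions in the definition hold for all `F` and `C`. -/
theorem isKahlerOn_iff {ε : ℝ} (hε : ε = 1 ∨ ε = -1) {f : ℝ → ℝ} (hf : ∀ z, f z = ε * F z) :
    IsKahlerOn (ansatzMetric F C) (ansatzJ f) (mfd I) ↔ ∀ z ∈ I, logDeriv C z = -ε := by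
  have hε0 : ε ≠ 0 := by rcases hε with rfl | rfl <;> norm_num
  have hf0 : ∀ z ∈ I, f z ≠ 0 := fun z hz => by
    rw [hf]
    exact mul_ne_zero hε0 (h.pos_F z hz).ne'
  have hω : ∀ q ∈ mfd I, ∀ v c, ansatzMetric F C q (ansatzJ f q v) (frame c q)
      = C (zcoord q) * diagT (F (zcoord q)) c
        * jT (ε * F (zcoord q)) (fun a => coframe a q v) c := by
    intro q hq v c
    rw [ansatzMetric_frame_right F C hq.1, coframe_ansatzJ f hq.1, hf]
  have hωf : ∀ b c, ∀ q ∈ mfd I, ansatzMetric F C q (ansatzJ f q (frame b q)) (frame c q)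
      = (fun z => C z * asymT (ε / 2) 0 0 0 0 1 b c) (zcoord q) := by
    intro b c q hq
    have hF := (h.pos_F _ hq.2).ne'
    rw [hω q hq]
    simp only [coframe_frame hq.1]
    generalize F (zcoord q) = s at *
    rcases fin4_cases b with rfl | rfl | rfl | rfl <;>
      rcases fin4_cases c with rfl | rfl | rfl | rfl <;>
      simp only [diagT, jT, asymT, vec4_zero, vec4_one, vec4_two, vec4_three, Fin.reduceEq,
        if_true, if_false, mul_zero, mul_one, neg_zero] <;>
      rcases hε with rfl | rfl <;> field_simp <;> ring
  have hd : ∀ b c, ∀ z ∈ I, HasDerivAt (fun z => C z * asymT (ε / 2) 0 0 0 0 1 b c)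
      (C z * logDeriv C z * asymT (ε / 2) 0 0 0 0 1 b c) z := fun b c z hz =>
    (h.hasDerivAt_C hz).mul_const _
  have hext : ∀ q ∈ mfd I, ∀ a b c,
      extDerivTwo (fun x v w => ansatzMetric F C x (ansatzJ f x v) w) a b c q
        = C (zcoord q) * (logDeriv C (zcoord q) + ε) * altSymbol a 1 b c := by
    intro q hq a b c
    have hF := (h.pos_F _ hq.2).ne'
    simp only [extDerivTwo, frameDeriv_radial h.isOpen (hωf _ _) hq (hd _ _ _ hq.2), hω q hq,
      lieBracket_frame, coframe_sum_smul_frame hq.1, altSymbol_eq]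
    generalize F (zcoord q) = s at *
    rcases fin4_cases a with rfl | rfl | rfl | rfl <;>
      rcases fin4_cases b with rfl | rfl | rfl | rfl <;>
      rcases fin4_cases c with rfl | rfl | rfl | rfl <;>
      simp only [diagT, jT, asymT, altT, structConst, vec4_zero, vec4_one, vec4_two, vec4_three,
        Fin.reduceEq, if_true, if_false, mul_zero, mul_one, neg_zero, Pi.neg_apply,
        Pi.zero_apply, Int.cast_zero, Int.cast_one, Int.cast_neg, sub_self, add_zero, zero_sub,
        sub_zero] <;>
      (try rcases hε with rfl | rfl) <;> (try field_simp) <;> (try ring)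
  constructor
  · intro hK z hz
    obtain ⟨q, hq, rfl⟩ := exists_mem_mfd hz
    have h1 := hK.closed q hq 0 2 3
    have hC := (h.pos_C _ hz).ne'
    rw [hext q hq, altSymbol_eq] at h1
    simp only [altT, asymT, vec4_zero, vec4_one, vec4_two, vec4_three, Int.cast_one, mul_one,
      mul_eq_zero, hC, false_or] at h1
    linarith
  · intro hK
    refine ⟨fun q hq v => ?_, fun q hq v w => ?_, fun q hq a b => ?_, fun q hq a b c => ?_⟩
    · have hs := hf0 _ hq.2
      rw [ansatzJ_eq f q v, ansatzJ_sum f hq.1]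
      conv_rhs => rw [← sum_coframe_smul hq.1 v, ← Finset.sum_neg_distrib]
      refine Finset.sum_congr rfl fun d _ => ?_
      rw [← neg_smul]
      congr 1
      rcases fin4_cases d with rfl | rfl | rfl | rfl <;>
        simp only [jT, vec4_zero, vec4_one, vec4_two, vec4_three] <;> field_simp
    · have hF := (h.pos_F _ hq.2).ne'
      simp only [ansatzMetric, coframe_ansatzJ f hq.1, jT, vec4_zero, vec4_one, vec4_two,
        vec4_three, hf]
      rcases hε with rfl | rfl <;> field_simp <;> ring
    · exact nijenhuis_ansatzJ h.isOpen (((h.smooth_F.differentiableOn (by simp)).const_mul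
        ε).congr fun z _ => hf z) hf0 hq a b
    · rw [hext q hq, hK _ hq.2, neg_add_cancel, mul_zero, zero_mul]

theorem grad_radial {S : ℝ → ℝ} {S' : ℝ} {T : ℍ[ℝ] → ℝ} (hT : ∀ x ∈ mfd I, T x = S (zcoord x))
    {q : ℍ[ℝ]} (hq : q ∈ mfd I) (hS : HasDerivAt S S' (zcoord q)) :
    grad (ansatzMetric F C) T q
      = ((C (zcoord q))⁻¹ * (4 * F (zcoord q)) * S') • frame 0 q := by
  simp only [grad, h.gramInv_ansatz hq, frameDeriv_radial h.isOpen hT hq hS, mul_ite, mul_zero,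
    ite_mul, zero_mul, ite_smul, zero_smul, Finset.sum_ite_eq', Finset.mem_univ, if_true,
    diagInvT, vec4_zero]

/-- The field `u ∂/∂z` is holomorphic if and only if `u / F` is constant: up to sign, `F ∂/∂z` is
half the image under the complex structure of the Killing field `e₁`. -/
theorem isHolomorphicOn_iff {ε : ℝ} (hε : ε = 1 ∨ ε = -1) {f : ℝ → ℝ}
    (hf : ∀ z, f z = ε * F z) {X : ℍ[ℝ] → ℍ[ℝ]} {u u' : ℝ → ℝ}
    (hX : ∀ q ∈ mfd I, X q = u (zcoord q) • frame 0 q) (hu : ∀ z ∈ I, HasDerivAt u (u' z) z) :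
    IsHolomorphicOn (ansatzJ f) X (mfd I)
      ↔ ∀ z ∈ I, u' z = u z * logDeriv F z := by
  have hε0 : ε ≠ 0 := by rcases hε with rfl | rfl <;> norm_num
  have hf0 : ∀ z ∈ I, f z ≠ 0 := fun z hz => by
    rw [hf]
    exact mul_ne_zero hε0 (h.pos_F z hz).ne'
  -- the defect `(L_X J) e_a`, which vanishes for `a = 2, 3`
  have key : ∀ q ∈ mfd I, ∀ a, VectorField.lieBracket ℝ X (fun x => ansatzJ f x (frame a x)) q
      = ansatzJ f q (VectorField.lieBracket ℝ X (frame a) q)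
        + ∑ d, (![0, 2 * (ε * F (zcoord q)) * (u' (zcoord q)
            - u (zcoord q) * logDeriv F (zcoord q)), 0, 0] a * (if d = 0 then 1 else 0)
          + ![(u' (zcoord q) - u (zcoord q) * logDeriv F (zcoord q))
            / (2 * (ε * F (zcoord q))), 0, 0, 0] a * (if d = 1 then 1 else 0)) • frame d q := by
    intro q hq a
    have hd : HasDerivAt f (ε * (F (zcoord q) * logDeriv F (zcoord q))) (zcoord q) := by
      rw [show f = fun z => ε * F z from funext hf]
      exact (h.hasDerivAt_F hq.2).const_mul ε
    have hs := hf0 _ hq.2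
    have hJ : (fun x => ansatzJ f x (frame a x))
        =ᶠ[𝓝 q] fun x => (fun z => jCoef (f z) a) (zcoord x) • frame (jIdx a) x :=
      Filter.mem_of_superset (mfd_mem_nhds h.isOpen hq) fun x hx => ansatzJ_frame f hx.1 a
    have h1 : frame a =ᶠ[𝓝 q] fun x => (fun _ => (1 : ℝ)) (zcoord x) • frame a x :=
      Filter.Eventually.of_forall fun x => (one_smul ℝ _).symm
    have hX1 : X =ᶠ[𝓝 q] fun x => u (zcoord x) • frame 0 x :=
      Filter.mem_of_superset (mfd_mem_nhds h.isOpen hq) hX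
    rw [hX1.lieBracket_vectorField_eq hJ, hX1.lieBracket_vectorField_eq h1,
      lieBracket_smul_frame hq.1 (hu _ hq.2) (hasDerivAt_jCoef hd hs a),
      lieBracket_smul_frame hq.1 (hu _ hq.2) (hasDerivAt_const _ 1), ansatzJ_sum f hq.1,
      ← Finset.sum_add_distrib]
    refine Finset.sum_congr rfl fun d _ => ?_
    rw [← add_smul]
    congr 1
    rw [hf] at hs ⊢
    generalize F (zcoord q) = s at *
    generalize u (zcoord q) = v at *
    generalize u' (zcoord q) = v' at *
    rcases fin4_cases a with rfl | rfl | rfl | rfl <;>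
      rcases fin4_cases d with rfl | rfl | rfl | rfl <;>
      simp only [jT, jCoef, jCoefDeriv, jIdx, structConst, vec4_zero, vec4_one, vec4_two,
        vec4_three, Fin.reduceEq, if_true, if_false, mul_zero, add_zero, zero_add, sub_self,
        mul_one, one_mul, neg_zero, sub_zero, zero_sub] <;>
      (try field_simp) <;> (try ring)
  constructor
  · intro hH z hz
    obtain ⟨q, hq, rfl⟩ := exists_mem_mfd hz
    have h1 := key q hq 1
    rw [hH q hq 1, left_eq_add] at h1
    have h2 := congrArg (coframe 0 q) h1
    rw [coframe_sum_smul_frame hq.1] at h2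
    have hF := (h.pos_F _ hz).ne'
    have h3 : coframe 0 q 0 = 0 := by simp [coframe]
    rw [h3] at h2
    simp only [vec4_one, Fin.reduceEq, if_true, if_false, mul_one, mul_zero, add_zero, mul_eq_zero,
      hF, hε0, false_or, OfNat.ofNat_ne_zero] at h2
    linarith
  · intro hH q hq a
    rw [key q hq a, hH _ hq.2]
    simp [Fin.sum_univ_four]
    rcases fin4_cases a with rfl | rfl | rfl | rfl <;> simp

end IsProfile

/-! ### Extremal Kähler and Kähler–Einstein metrics -/

namespace IsProfile

variable {I : Set ℝ} {F C : ℝ → ℝ} (h : IsProfile I F C)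

include h

/-- The scalar curvature of a Kähler metric of the ansatz is a multiple of `(𝓛^± F - 1) / C`. -/
theorem scal_of_kahler {ε : ℝ} (hε : ε = 1 ∨ ε = -1) (hC : ∀ z ∈ I, logDeriv C z = -ε)
    {q : ℍ[ℝ]} (hq : q ∈ mfd I) :
    scal (ansatzMetric F C) q = (C (zcoord q))⁻¹
      * (-4 * (deriv (deriv F) (zcoord q) - 3 * ε * deriv F (zcoord q) + 2 * F (zcoord q)
        - 2)) := by
  have hk₁ : deriv (logDeriv C) (zcoord q) = 0 := by
    have h1 : logDeriv C =ᶠ[𝓝 (zcoord q)] fun _ => -ε :=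
      Filter.mem_of_superset (h.isOpen.mem_nhds hq.2) hC
    rw [h1.deriv_eq, deriv_const]
  rw [h.scal_eq hq rfl rfl rfl (hC _ hq.2) hk₁, scalT]
  rcases hε with rfl | rfl <;> ring

/-- The gradient of the scalar curvature `s` is `4 F s' / C ∂/∂z`, and so it is holomorphic if and
only if `s' / C` is constant, which is an equation of order four for `F`. -/
theorem isExtremalKahlerOn_iff_jet {ε : ℝ} (hε : ε = 1 ∨ ε = -1) {f : ℝ → ℝ}
    (hf : ∀ z, f z = ε * F z) :
    IsExtremalKahlerOn (ansatzMetric F C) (ansatzJ f) (mfd I) ↔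
      (∀ z ∈ I, logDeriv C z = -ε) ∧
        ∀ z ∈ I, deriv (deriv (deriv (deriv F))) z - 5 * deriv (deriv F) z + 4 * F z - 4 = 0 := by
  rw [IsExtremalKahlerOn, h.isKahlerOn_iff hε hf]
  refine and_congr_right fun hC => ?_
  have hF := fun z (hz : z ∈ I) => hasDerivAt_of_contDiffOn_infty h.isOpen h.smooth_F hz
  have sF1 := contDiffOn_infty_deriv h.isOpen h.smooth_F
  have hF1 := fun z (hz : z ∈ I) => hasDerivAt_of_contDiffOn_infty h.isOpen sF1 hz
  have sF2 := contDiffOn_infty_deriv h.isOpen sF1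
  have hF2 := fun z (hz : z ∈ I) => hasDerivAt_of_contDiffOn_infty h.isOpen sF2 hz
  have hF3 := fun z (hz : z ∈ I) => hasDerivAt_of_contDiffOn_infty h.isOpen
    (contDiffOn_infty_deriv h.isOpen sF2) hz
  have hCinv : ∀ z ∈ I, HasDerivAt (fun z => (C z)⁻¹) (ε * (C z)⁻¹) z := by
    intro z hz
    have hC0 := (h.pos_C z hz).ne'
    refine ((h.hasDerivAt_C hz).inv hC0).congr_deriv ?_
    rw [hC z hz]
    field_simp
  -- the derivative of the scalar curvature is `-4 (C z)⁻¹ t z`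
  set t : ℝ → ℝ := fun z => deriv (deriv (deriv F)) z - 2 * ε * deriv (deriv F) z - deriv F z
    + 2 * ε * F z - 2 * ε with ht
  have hS : ∀ z ∈ I, HasDerivAt (fun z => (C z)⁻¹
      * (-4 * (deriv (deriv F) z - 3 * ε * deriv F z + 2 * F z - 2))) (-4 * (C z)⁻¹ * t z) z := by
    intro z hz
    refine ((hCinv z hz).mul (((((hF2 z hz).sub ((hF1 z hz).const_mul (3 * ε))).add
      ((hF z hz).const_mul 2)).sub_const 2).const_mul (-4))).congr_deriv ?_
    simp only [ht, Pi.add_apply, Pi.sub_apply]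
    rcases hε with rfl | rfl <;> ring
  have hX : ∀ q ∈ mfd I, grad (ansatzMetric F C) (scal (ansatzMetric F C)) q
      = (fun z => (C z)⁻¹ * (4 * F z) * (-4 * (C z)⁻¹ * t z)) (zcoord q) • frame 0 q :=
    fun q hq => h.grad_radial (fun x hx => h.scal_of_kahler hε hC hx) hq (hS _ hq.2)
  have hu : ∀ z ∈ I, HasDerivAt (fun z => (C z)⁻¹ * (4 * F z) * (-4 * (C z)⁻¹ * t z))
      ((C z)⁻¹ * (4 * F z) * (-4 * (C z)⁻¹ * t z) * logDeriv F z - 16 * (C z)⁻¹ ^ 2 * F z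
        * (deriv (deriv (deriv (deriv F))) z - 5 * deriv (deriv F) z + 4 * F z - 4)) z := by
    intro z hz
    have hF0 := h.hasDerivAt_F hz
    have ht' : HasDerivAt t (deriv (deriv (deriv (deriv F))) z
        - 2 * ε * deriv (deriv (deriv F)) z - deriv (deriv F) z + 2 * ε * deriv F z) z :=
      ((((hF3 z hz).sub ((hF2 z hz).const_mul (2 * ε))).sub (hF1 z hz)).add
        ((hF z hz).const_mul (2 * ε))).sub_const _
    refine (((hCinv z hz).mul (hF0.const_mul 4)).mul
      (((hCinv z hz).const_mul (-4)).mul ht')).congr_deriv ?_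
    simp only [ht, Pi.mul_apply]
    rcases hε with rfl | rfl <;> ring
  rw [h.isHolomorphicOn_iff hε hf hX hu]
  refine forall₂_congr fun z hz => ?_
  have hC0 := (h.pos_C z hz).ne'
  have hF0 := (h.pos_F z hz).ne'
  rw [sub_eq_self]
  simp [hC0, hF0]

/-- The Ricci tensor is diagonal, and `Ric = k g` gives one equation for the directions `∂/∂z`, `e₁`
and one for the directions `e₂`, `e₃`. -/
theorem isKahlerEinsteinOn_iff_jet :
    IsKahlerEinsteinOn (ansatzMetric F C) (JPlus F) (mfd I) ↔
      (∀ z ∈ I, logDeriv C z = -1) ∧ ∃ k : ℝ, ∀ z ∈ I,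
        4 * deriv F z - 2 * deriv (deriv F) z = k * C z ∧
          4 - 4 * F z + 2 * deriv F z = k * C z := by
  rw [IsKahlerEinsteinOn, JPlus, h.isKahlerOn_iff (Or.inl rfl) fun z => (one_mul (F z)).symm]
  refine and_congr_right fun hC => exists_congr fun k => ?_
  have hric : ∀ q ∈ mfd I, ∀ a b, ricci (ansatzMetric F C) a b q
      = if a = b then ricciT (F (zcoord q)) (deriv F (zcoord q)) (deriv (deriv F) (zcoord q))
        (-1) 0 a else 0 := by
    intro q hq a b
    have hk₁ : deriv (logDeriv C) (zcoord q) = 0 := by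
      have h1 : logDeriv C =ᶠ[𝓝 (zcoord q)] fun _ => -1 :=
        Filter.mem_of_superset (h.isOpen.mem_nhds hq.2) hC
      rw [h1.deriv_eq, deriv_const]
    exact h.ricci_eq hq rfl rfl rfl (hC _ hq.2) hk₁ a b
  constructor
  · intro hE z hz
    obtain ⟨q, hq, rfl⟩ := exists_mem_mfd hz
    have hF := (h.pos_F _ hz).ne'
    have h1 := hE q hq 1 1
    have h2 := hE q hq 2 2
    rw [hric q hq, gram_ansatz F C hq.1] at h1 h2
    simp only [if_true, ricciT, diagT, vec4_one, vec4_two] at h1 h2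
    constructor
    · apply mul_left_cancel₀ hF
      linear_combination h1
    · linear_combination h2
  · intro hE q hq a b
    obtain ⟨h1, h2⟩ := hE _ hq.2
    have hF := (h.pos_F _ hq.2).ne'
    rw [hric q hq, gram_ansatz F C hq.1]
    split_ifs with hab
    · rcases fin4_cases a with rfl | rfl | rfl | rfl <;>
        simp only [ricciT, diagT, vec4_zero, vec4_one, vec4_two, vec4_three]
      · field_simp
        linear_combination 2 * h1
      · linear_combination F (zcoord q) * h1
      · linear_combination h2
      · linear_combination h2
    · rw [mul_zero]

end IsProfile

/-! ### Linear differential equations with constant coefficients -/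

theorem exists_eq_const_mul_exp {I : Set ℝ} (hI : IsOpen I) (hI' : I.OrdConnected) {u : ℝ → ℝ}
    {a : ℝ} (hu : ∀ z ∈ I, HasDerivAt u (a * u z) z) :
    ∃ c, ∀ z ∈ I, u z = c * Real.exp (a * z) := by
  have hd : ∀ z ∈ I, HasDerivAt (fun z => u z * Real.exp (-a * z)) 0 z := by
    intro z hz
    refine ((hu z hz).mul (((hasDerivAt_id z).const_mul (-a)).exp)).congr_deriv ?_
    simp only [id]
    ring
  obtain ⟨c, hc⟩ := hI.exists_is_const_of_deriv_eq_zero hI'.isPreconnected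
    (fun z hz => (hd z hz).differentiableAt.differentiableWithinAt) fun z hz => (hd z hz).deriv
  refine ⟨c, fun z hz => ?_⟩
  rw [← hc z hz, mul_assoc, ← Real.exp_add]
  simp

theorem famF_eq (c₁ c₂ c₃ c₄ z : ℝ) : famF c₁ c₂ c₃ c₄ z
    = 1 + 1 / 2 * c₁ * Real.exp (-z) ^ 2 + c₂ * Real.exp (-z) + c₃ * Real.exp z
      + 1 / 2 * c₄ * Real.exp z ^ 2 := by
  rw [famF, ← Real.exp_nat_mul, ← Real.exp_nat_mul]
  push_cast
  ring_nf

theorem hasDerivAt_famF (c₁ c₂ c₃ c₄ z : ℝ) :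
    HasDerivAt (famF c₁ c₂ c₃ c₄) (famF (-2 * c₁) (-c₂) c₃ (2 * c₄) z - 1) z := by
  have h1 : HasDerivAt (fun z : ℝ => Real.exp (-2 * z)) (Real.exp (-2 * z) * (-2 * 1)) z :=
    ((hasDerivAt_id z).const_mul (-2)).exp
  have h2 : HasDerivAt (fun z : ℝ => Real.exp (-z)) (Real.exp (-z) * (-1)) z :=
    (hasDerivAt_id z).neg.exp
  have h3 := Real.hasDerivAt_exp z
  have h4 : HasDerivAt (fun z : ℝ => Real.exp (2 * z)) (Real.exp (2 * z) * (2 * 1)) z :=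
    ((hasDerivAt_id z).const_mul 2).exp
  refine (((((h1.const_mul (1 / 2 * c₁)).const_add 1).add (h2.const_mul c₂)).add
    (h3.const_mul c₃)).add (h4.const_mul (1 / 2 * c₄))).congr_deriv ?_
  rw [famF]
  ring

theorem deriv_of_eq_famF_sub {I : Set ℝ} (hI : IsOpen I) {u : ℝ → ℝ} {r c₁ c₂ c₃ c₄ : ℝ}
    (hu : ∀ z ∈ I, u z = famF c₁ c₂ c₃ c₄ z - r) :
    ∀ z ∈ I, deriv u z = famF (-2 * c₁) (-c₂) c₃ (2 * c₄) z - 1 := by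
  intro z hz
  have h1 : u =ᶠ[𝓝 z] fun z => famF c₁ c₂ c₃ c₄ z - r :=
    Filter.mem_of_superset (hI.mem_nhds hz) hu
  rw [h1.deriv_eq]
  exact ((hasDerivAt_famF c₁ c₂ c₃ c₄ z).sub_const r).deriv

/-- The derivatives of a function in the family `famF`, as polynomials in `e^{-z}` and `e^z`. -/
theorem jet_of_eq_famF {I : Set ℝ} (hI : IsOpen I) {F : ℝ → ℝ} {c₁ c₂ c₃ c₄ : ℝ}
    (hF : ∀ z ∈ I, F z = famF c₁ c₂ c₃ c₄ z) {z : ℝ} (hz : z ∈ I) :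
    F z = 1 + 1 / 2 * c₁ * Real.exp (-z) ^ 2 + c₂ * Real.exp (-z) + c₃ * Real.exp z
        + 1 / 2 * c₄ * Real.exp z ^ 2 ∧
      deriv F z = -c₁ * Real.exp (-z) ^ 2 - c₂ * Real.exp (-z) + c₃ * Real.exp z
        + c₄ * Real.exp z ^ 2 ∧
      deriv (deriv F) z = 2 * c₁ * Real.exp (-z) ^ 2 + c₂ * Real.exp (-z) + c₃ * Real.exp z
        + 2 * c₄ * Real.exp z ^ 2 ∧
      deriv (deriv (deriv F)) z = -4 * c₁ * Real.exp (-z) ^ 2 - c₂ * Real.exp (-z)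
        + c₃ * Real.exp z + 4 * c₄ * Real.exp z ^ 2 ∧
      deriv (deriv (deriv (deriv F))) z = 8 * c₁ * Real.exp (-z) ^ 2 + c₂ * Real.exp (-z)
        + c₃ * Real.exp z + 8 * c₄ * Real.exp z ^ 2 := by
  have h1 := deriv_of_eq_famF_sub hI (r := 0) fun z hz => (hF z hz).trans (sub_zero _).symm
  have h2 := deriv_of_eq_famF_sub hI h1
  have h3 := deriv_of_eq_famF_sub hI h2
  have h4 := deriv_of_eq_famF_sub hI h3
  rw [hF z hz, h1 z hz, h2 z hz, h3 z hz, h4 z hz]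
  simp only [famF_eq]
  refine ⟨trivial, by ring, by ring, by ring, by ring⟩

section ODE

variable {I : Set ℝ} (hI : IsOpen I) (hI' : I.OrdConnected) {F : ℝ → ℝ} (sF : ContDiffOn ℝ ∞ F I)

include hI hI' sF

/-- Each of the four exponents `λ = ±1, ±2` is split off by applying to `F - 1` the operator
`(D⁴ - 5 D² + 4) / (D - λ)`, which gives a multiple of `e^{λ z}`. -/
theorem exists_eq_famF_iff :
    (∃ c₁ c₂ c₃ c₄, ∀ z ∈ I, F z = famF c₁ c₂ c₃ c₄ z) ↔
      ∀ z ∈ I, deriv (deriv (deriv (deriv F))) z - 5 * deriv (deriv F) z + 4 * F z - 4 = 0 := by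
  constructor
  · rintro ⟨c₁, c₂, c₃, c₄, hF⟩ z hz
    obtain ⟨h0, -, h2, -, h4⟩ := jet_of_eq_famF hI hF hz
    rw [h0, h2, h4]
    ring
  · intro hL
    have s1 := contDiffOn_infty_deriv hI sF
    have s2 := contDiffOn_infty_deriv hI s1
    have s3 := contDiffOn_infty_deriv hI s2
    have d0 := fun z (hz : z ∈ I) => hasDerivAt_of_contDiffOn_infty hI sF hz
    have d1 := fun z (hz : z ∈ I) => hasDerivAt_of_contDiffOn_infty hI s1 hz
    have d2 := fun z (hz : z ∈ I) => hasDerivAt_of_contDiffOn_infty hI s2 hz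
    have d3 := fun z (hz : z ∈ I) => hasDerivAt_of_contDiffOn_infty hI s3 hz
    have key : ∀ a : ℝ, a * (a * (a ^ 2 - 5)) = -4 → ∃ K, ∀ z ∈ I,
        deriv (deriv (deriv F)) z + a * deriv (deriv F) z + (a ^ 2 - 5) * deriv F z
          + a * (a ^ 2 - 5) * (F z - 1) = K * Real.exp (a * z) := fun a ha =>
      exists_eq_const_mul_exp hI hI' fun z hz =>
        ((((d3 z hz).add ((d2 z hz).const_mul a)).add ((d1 z hz).const_mul (a ^ 2 - 5))).add
          (((d0 z hz).sub_const 1).const_mul (a * (a ^ 2 - 5)))).congr_deriv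
          (by linear_combination hL z hz - (F z - 1) * ha)
    obtain ⟨K₁, h1⟩ := key (-2) (by norm_num)
    obtain ⟨K₂, h2⟩ := key (-1) (by norm_num)
    obtain ⟨K₃, h3⟩ := key 1 (by norm_num)
    obtain ⟨K₄, h4⟩ := key 2 (by norm_num)
    refine ⟨-K₁ / 6, K₂ / 6, -K₃ / 6, K₄ / 6, fun z hz => ?_⟩
    have h1 := h1 z hz
    have h2 := h2 z hz
    have h3 := h3 z hz
    have h4 := h4 z hz
    rw [neg_one_mul z] at h2
    rw [one_mul z] at h3
    rw [famF]
    linear_combination -1 / 12 * h1 + 1 / 6 * h2 - 1 / 6 * h3 + 1 / 12 * h4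

/-- As for `exists_eq_famF_iff`, with the exponents `1` and `2`. -/
theorem exists_eq_famF_plus_iff :
    (∃ c₃ c₄, ∀ z ∈ I, F z = famF 0 0 c₃ c₄ z) ↔
      ∀ z ∈ I, deriv (deriv F) z - 3 * deriv F z + 2 * F z - 2 = 0 := by
  constructor
  · rintro ⟨c₃, c₄, hF⟩ z hz
    obtain ⟨h0, h1, h2, -, -⟩ := jet_of_eq_famF hI hF hz
    rw [h0, h1, h2]
    ring
  · intro hL
    have d0 := fun z (hz : z ∈ I) => hasDerivAt_of_contDiffOn_infty hI sF hz
    have d1 := fun z (hz : z ∈ I) =>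
      hasDerivAt_of_contDiffOn_infty hI (contDiffOn_infty_deriv hI sF) hz
    obtain ⟨K, hK⟩ := exists_eq_const_mul_exp hI hI' (a := 1)
      (u := fun z => deriv F z - 2 * (F z - 1)) fun z hz =>
        ((d1 z hz).sub (((d0 z hz).sub_const 1).const_mul 2)).congr_deriv (by linarith [hL z hz])
    obtain ⟨K', hK'⟩ := exists_eq_const_mul_exp hI hI' (a := 2)
      (u := fun z => deriv F z - (F z - 1)) fun z hz =>
        ((d1 z hz).sub ((d0 z hz).sub_const 1)).congr_deriv (by linarith [hL z hz])
    refine ⟨-K, 2 * K', fun z hz => ?_⟩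
    have h1 := hK z hz
    have h2 := hK' z hz
    simp only [one_mul] at h1
    rw [famF]
    linear_combination h2 - h1

/-- As for `exists_eq_famF_iff`, with the exponents `-1` and `-2`. -/
theorem exists_eq_famF_minus_iff :
    (∃ c₁ c₂, ∀ z ∈ I, F z = famF c₁ c₂ 0 0 z) ↔
      ∀ z ∈ I, deriv (deriv F) z + 3 * deriv F z + 2 * F z - 2 = 0 := by
  constructor
  · rintro ⟨c₁, c₂, hF⟩ z hz
    obtain ⟨h0, h1, h2, -, -⟩ := jet_of_eq_famF hI hF hz
    rw [h0, h1, h2]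
    ring
  · intro hL
    have d0 := fun z (hz : z ∈ I) => hasDerivAt_of_contDiffOn_infty hI sF hz
    have d1 := fun z (hz : z ∈ I) =>
      hasDerivAt_of_contDiffOn_infty hI (contDiffOn_infty_deriv hI sF) hz
    obtain ⟨K, hK⟩ := exists_eq_const_mul_exp hI hI' (a := -1)
      (u := fun z => deriv F z + 2 * (F z - 1)) fun z hz =>
        ((d1 z hz).add (((d0 z hz).sub_const 1).const_mul 2)).congr_deriv (by linarith [hL z hz])
    obtain ⟨K', hK'⟩ := exists_eq_const_mul_exp hI hI' (a := -2)
      (u := fun z => deriv F z + (F z - 1)) fun z hz =>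
        ((d1 z hz).add ((d0 z hz).sub_const 1)).congr_deriv (by linarith [hL z hz])
    refine ⟨-2 * K', K, fun z hz => ?_⟩
    have h1 := hK z hz
    have h2 := hK' z hz
    simp only [neg_mul, one_mul] at h1
    rw [famF]
    linear_combination h1 - h2

/-- The second equation of the pair is linear of first order in `F`, with solutions
`1 - k C / 6 + const e^{2z}`, and these solve the first equation as well. -/
theorem einstein_ode_iff {C : ℝ → ℝ} {c₀ : ℝ} (hc₀ : c₀ ≠ 0)
    (hC : ∀ z ∈ I, C z = c₀ * Real.exp (-z)) :
    (∃ k : ℝ, ∀ z ∈ I, 4 * deriv F z - 2 * deriv (deriv F) z = k * C z ∧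
        4 - 4 * F z + 2 * deriv F z = k * C z) ↔
      ∃ c₂ c₄, ∀ z ∈ I, F z = famF 0 c₂ 0 c₄ z := by
  constructor
  · rintro ⟨k, hk⟩
    have hexp : ∀ z : ℝ, HasDerivAt (fun z : ℝ => Real.exp (-z)) (Real.exp (-z) * (-1)) z :=
      fun z => (hasDerivAt_id z).neg.exp
    -- the inhomogeneous equation `F' - 2 F + 2 = k C / 2` has the particular solution
    -- `1 - k C / 6`
    obtain ⟨K, hK⟩ := exists_eq_const_mul_exp hI hI' (a := 2)
      (u := fun z => F z - 1 + k * c₀ / 6 * Real.exp (-z)) fun z hz => by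
        have h1 := hasDerivAt_of_contDiffOn_infty hI sF hz
        have h2 := (hk z hz).2
        rw [hC z hz] at h2
        refine ((h1.sub_const 1).add ((hexp z).const_mul (k * c₀ / 6))).congr_deriv ?_
        linear_combination h2 / 2
    refine ⟨-(k * c₀ / 6), 2 * K, fun z hz => ?_⟩
    rw [famF]
    linear_combination hK z hz
  · rintro ⟨c₂, c₄, hF⟩
    refine ⟨-6 * c₂ / c₀, fun z hz => ?_⟩
    obtain ⟨h0, h1, h2, -, -⟩ := jet_of_eq_famF hI hF hz
    rw [h0, h1, h2, hC z hz]
    field_simp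
    constructor <;> ring

end ODE

section Operators

variable {I : Set ℝ} (hI : IsOpen I) {F : ℝ → ℝ} (sF : ContDiffOn ℝ ∞ F I)

include hI sF

theorem shiftOp_shiftOp_eq (a : ℝ) {z : ℝ} (hz : z ∈ I) :
    shiftOp (a / 2) (shiftOp a F) z
      = a ^ 2 / 2 * deriv (deriv F) z + 3 / 2 * a * deriv F z + F z := by
  have d0 := fun z (hz : z ∈ I) => hasDerivAt_of_contDiffOn_infty hI sF hz
  have d1 := fun z (hz : z ∈ I) =>
    hasDerivAt_of_contDiffOn_infty hI (contDiffOn_infty_deriv hI sF) hz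
  have h1 : HasDerivAt (shiftOp a F) _ z := ((d1 z hz).const_mul a).add (d0 z hz)
  rw [shiftOp, h1.deriv, shiftOp]
  ring

theorem LPlus_eq {z : ℝ} (hz : z ∈ I) :
    LPlus F z = 1 / 2 * deriv (deriv F) z - 3 / 2 * deriv F z + F z := by
  have h1 := shiftOp_shiftOp_eq hI sF (-1) hz
  rw [LPlus, ← neg_div, h1]
  ring

theorem LMinus_eq {z : ℝ} (hz : z ∈ I) :
    LMinus F z = 1 / 2 * deriv (deriv F) z + 3 / 2 * deriv F z + F z := by
  rw [LMinus, shiftOp_shiftOp_eq hI sF 1 hz]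
  ring

theorem LPlus_LMinus_eq {z : ℝ} (hz : z ∈ I) :
    LPlus (LMinus F) z
      = 1 / 4 * deriv (deriv (deriv (deriv F))) z - 5 / 4 * deriv (deriv F) z + F z := by
  have s1 := contDiffOn_infty_deriv hI sF
  have s2 := contDiffOn_infty_deriv hI s1
  have s3 := contDiffOn_infty_deriv hI s2
  have d0 := fun z (hz : z ∈ I) => hasDerivAt_of_contDiffOn_infty hI sF hz
  have d1 := fun z (hz : z ∈ I) => hasDerivAt_of_contDiffOn_infty hI s1 hz
  have d2 := fun z (hz : z ∈ I) => hasDerivAt_of_contDiffOn_infty hI s2 hz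
  have d3 := fun z (hz : z ∈ I) => hasDerivAt_of_contDiffOn_infty hI s3 hz
  have hM : ∀ z ∈ I, LMinus F z = 1 / 2 * deriv (deriv F) z + 3 / 2 * deriv F z + F z :=
    fun z hz => LMinus_eq hI sF hz
  have sM : ContDiffOn ℝ ∞ (LMinus F) I :=
    (((contDiffOn_const.mul s2).add (contDiffOn_const.mul s1)).add sF).congr hM
  have hM1 : ∀ z ∈ I, deriv (LMinus F) z
      = 1 / 2 * deriv (deriv (deriv F)) z + 3 / 2 * deriv (deriv F) z + deriv F z := by
    intro z hz
    have he : LMinus F =ᶠ[𝓝 z] fun z => 1 / 2 * deriv (deriv F) z + 3 / 2 * deriv F z + F z :=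
      Filter.mem_of_superset (hI.mem_nhds hz) hM
    rw [he.deriv_eq]
    exact ((((d2 z hz).const_mul (1 / 2)).add ((d1 z hz).const_mul (3 / 2))).add (d0 z hz)).deriv
  have hM2 : deriv (deriv (LMinus F)) z = 1 / 2 * deriv (deriv (deriv (deriv F))) z
      + 3 / 2 * deriv (deriv (deriv F)) z + deriv (deriv F) z := by
    have he : deriv (LMinus F) =ᶠ[𝓝 z] fun z =>
        1 / 2 * deriv (deriv (deriv F)) z + 3 / 2 * deriv (deriv F) z + deriv F z :=
      Filter.mem_of_superset (hI.mem_nhds hz) hM1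
    rw [he.deriv_eq]
    exact ((((d3 z hz).const_mul (1 / 2)).add ((d2 z hz).const_mul (3 / 2))).add (d1 z hz)).deriv
  rw [LPlus_eq hI sM hz, hM2, hM1 z hz, hM z hz]
  ring

end Operators

/-! ### Classification on an interval -/

namespace IsProfile

variable {I : Set ℝ} {F C : ℝ → ℝ} (h : IsProfile I F C)

include h

theorem logDeriv_C_of_eq {a c₀ : ℝ} (hC : ∀ z ∈ I, C z = c₀ * Real.exp (a * z)) :
    ∀ z ∈ I, logDeriv C z = a := by
  intro z hz
  have h1 : C =ᶠ[𝓝 z] fun z => c₀ * Real.exp (a * z) :=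
    Filter.mem_of_superset (h.isOpen.mem_nhds hz) hC
  have h2 : HasDerivAt (fun z => c₀ * Real.exp (a * z)) (c₀ * (Real.exp (a * z) * (a * 1))) z :=
    (((hasDerivAt_id z).const_mul a).exp).const_mul c₀
  rw [logDeriv_apply, h1.deriv_eq, h2.deriv, div_eq_iff (h.pos_C z hz).ne', hC z hz]
  ring

theorem logDeriv_C_iff (hI' : I.OrdConnected) {a : ℝ} :
    (∀ z ∈ I, logDeriv C z = a) ↔ ∃ c₀, ∀ z ∈ I, C z = c₀ * Real.exp (a * z) := by
  refine ⟨fun hC => exists_eq_const_mul_exp h.isOpen hI' fun z hz => ?_,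
    fun ⟨c₀, hC⟩ => h.logDeriv_C_of_eq hC⟩
  have h1 := h.hasDerivAt_C hz
  rwa [hC z hz, mul_comm] at h1

theorem LPlus_LMinus_iff :
    (∀ z ∈ I, LPlus (LMinus F) z - 1 = 0) ↔
      ∀ z ∈ I, deriv (deriv (deriv (deriv F))) z - 5 * deriv (deriv F) z + 4 * F z - 4 = 0 := by
  refine forall₂_congr fun z hz => ?_
  rw [LPlus_LMinus_eq h.isOpen h.smooth_F hz]
  constructor <;> intro h1 <;> linarith

theorem LPlus_iff : (∀ z ∈ I, LPlus F z - 1 = 0) ↔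
    ∀ z ∈ I, deriv (deriv F) z - 3 * deriv F z + 2 * F z - 2 = 0 := by
  refine forall₂_congr fun z hz => ?_
  rw [LPlus_eq h.isOpen h.smooth_F hz]
  constructor <;> intro h1 <;> linarith

theorem LMinus_iff : (∀ z ∈ I, LMinus F z - 1 = 0) ↔
    ∀ z ∈ I, deriv (deriv F) z + 3 * deriv F z + 2 * F z - 2 = 0 := by
  refine forall₂_congr fun z hz => ?_
  rw [LMinus_eq h.isOpen h.smooth_F hz]
  constructor <;> intro h1 <;> linarith

theorem isExtremalKahlerOn_plus_iff (hI' : I.OrdConnected) :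
    IsExtremalKahlerOn (ansatzMetric F C) (JPlus F) (mfd I) ↔
      (∃ c₀, ∀ z ∈ I, C z = c₀ * Real.exp (-z)) ∧ ∀ z ∈ I, LPlus (LMinus F) z - 1 = 0 := by
  rw [JPlus, h.isExtremalKahlerOn_iff_jet (Or.inl rfl) fun z => (one_mul (F z)).symm,
    h.logDeriv_C_iff hI', h.LPlus_LMinus_iff]
  simp only [neg_one_mul]

theorem isExtremalKahlerOn_minus_iff (hI' : I.OrdConnected) :
    IsExtremalKahlerOn (ansatzMetric F C) (JMinus F) (mfd I) ↔
      (∃ c₀, ∀ z ∈ I, C z = c₀ * Real.exp z) ∧ ∀ z ∈ I, LPlus (LMinus F) z - 1 = 0 := by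
  rw [JMinus, h.isExtremalKahlerOn_iff_jet (Or.inr rfl) fun z => (neg_one_mul (F z)).symm,
    h.logDeriv_C_iff hI', h.LPlus_LMinus_iff]
  simp only [neg_neg, one_mul]

/-- A function of the form taken by the scalar curvature is constant only if its exponential term is
absent. -/
theorem exp_sub_const_iff (hne : I.Nonempty) {a c₀ c s : ℝ} (ha : a ≠ 0) (hc₀ : c₀ ≠ 0)
    {S : ℍ[ℝ] → ℝ} (hS : ∀ q ∈ mfd I, S q = -24 / c₀ * (c * Real.exp (a * zcoord q) + s)) :
    (∃ s₀, ∀ q ∈ mfd I, S q = s₀) ↔ c = 0 := by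
  constructor
  · rintro ⟨s₀, hs⟩
    obtain ⟨z, hz⟩ := hne
    have hconst : ∀ y ∈ I, c * Real.exp (a * y) = c * Real.exp (a * z) := by
      intro y hy
      obtain ⟨q, hq, rfl⟩ := exists_mem_mfd hy
      obtain ⟨q', hq', rfl⟩ := exists_mem_mfd hz
      have h1 := (hS q hq).symm.trans ((hs q hq).trans ((hs q' hq').symm.trans (hS q' hq')))
      have h2 := mul_left_cancel₀ (div_ne_zero (by norm_num) hc₀) h1
      linarith
    have h1 : (fun y => c * Real.exp (a * y)) =ᶠ[𝓝 z] fun _ => c * Real.exp (a * z) :=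
      Filter.mem_of_superset (h.isOpen.mem_nhds hz) hconst
    have h2 : HasDerivAt (fun y => c * Real.exp (a * y)) (c * (Real.exp (a * z) * (a * 1))) z :=
      (((hasDerivAt_id z).const_mul a).exp).const_mul c
    have h3 := h1.deriv_eq
    rw [h2.deriv, deriv_const] at h3
    simpa [ha] using h3
  · rintro rfl
    exact ⟨-24 / c₀ * s, fun q hq => by rw [hS q hq, zero_mul, zero_add]⟩

theorem scal_of_eq_famF_plus {c₀ c₁ c₂ c₃ c₄ : ℝ} (hF : ∀ z ∈ I, F z = famF c₁ c₂ c₃ c₄ z)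
    (hC : ∀ z ∈ I, C z = c₀ * Real.exp (-z)) {q : ℍ[ℝ]} (hq : q ∈ mfd I) :
    scal (ansatzMetric F C) q = -24 / c₀ * (c₁ * Real.exp (-zcoord q) + c₂) := by
  have hC' := h.logDeriv_C_of_eq (a := -1) fun z hz => by rw [neg_one_mul z, hC z hz]
  obtain ⟨h0, h1, h2, -, -⟩ := jet_of_eq_famF h.isOpen hF hq.2
  have hpos := (h.pos_C _ hq.2).ne'
  rw [hC _ hq.2] at hpos
  rw [h.scal_of_kahler (Or.inl rfl) hC' hq, hC _ hq.2, h0, h1, h2]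
  have hc₀ := left_ne_zero_of_mul hpos
  have he := right_ne_zero_of_mul hpos
  field_simp
  ring

theorem scal_of_eq_famF_minus {c₀ c₁ c₂ c₃ c₄ : ℝ} (hF : ∀ z ∈ I, F z = famF c₁ c₂ c₃ c₄ z)
    (hC : ∀ z ∈ I, C z = c₀ * Real.exp z) {q : ℍ[ℝ]} (hq : q ∈ mfd I) :
    scal (ansatzMetric F C) q = -24 / c₀ * (c₃ + c₄ * Real.exp (zcoord q)) := by
  have hC' := h.logDeriv_C_of_eq (a := 1) fun z hz => by rw [one_mul z, hC z hz]
  obtain ⟨h0, h1, h2, -, -⟩ := jet_of_eq_famF h.isOpen hF hq.2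
  have hpos := (h.pos_C _ hq.2).ne'
  rw [hC _ hq.2] at hpos
  rw [h.scal_of_kahler (Or.inr rfl) (fun z hz => by rw [hC' z hz, neg_neg]) hq, hC _ hq.2,
    h0, h1, h2]
  have hc₀ := left_ne_zero_of_mul hpos
  have he := right_ne_zero_of_mul hpos
  field_simp
  ring

/-- On a solution of the fourth-order equation the first integral `B_00` is a quadratic form in the
coefficients. The set `I` need not be connected. -/
theorem isBachFlatOn_iff_of_eq_famF (hne : I.Nonempty) {c₁ c₂ c₃ c₄ : ℝ}
    (hF : ∀ z ∈ I, F z = famF c₁ c₂ c₃ c₄ z) :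
    IsBachFlatOn (ansatzMetric F C) (mfd I) ↔ c₁ * c₄ - c₂ * c₃ = 0 := by
  have key : ∀ z ∈ I, -(2 / 3) * (F z - 1) ^ 2 + 5 / 6 * deriv F z ^ 2
        - 1 / 3 * deriv F z * deriv (deriv (deriv F)) z + 1 / 6 * deriv (deriv F) z ^ 2
      = 2 * (c₁ * c₄ - c₂ * c₃) := by
    intro z hz
    obtain ⟨h0, h1, h2, h3, -⟩ := jet_of_eq_famF h.isOpen hF hz
    have he : Real.exp (-z) * Real.exp z = 1 := by rw [← Real.exp_add]; simp
    rw [h0, h1, h2, h3]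
    linear_combination (2 * c₁ * c₄ * (Real.exp (-z) * Real.exp z + 1) - 2 * c₂ * c₃) * he
  rw [h.isBachFlatOn_iff_jet]
  constructor
  · intro hB
    obtain ⟨z, hz⟩ := hne
    have h1 := key z hz
    rw [(hB z hz).2] at h1
    linarith
  · intro hc z hz
    refine ⟨?_, by rw [key z hz, hc, mul_zero]⟩
    obtain ⟨h0, -, h2, -, h4⟩ := jet_of_eq_famF h.isOpen hF hz
    rw [h0, h2, h4]
    ring

theorem isBachFlatOn_iff (hI' : I.OrdConnected) (hne : I.Nonempty) :
    IsBachFlatOn (ansatzMetric F C) (mfd I) ↔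
      ∃ c₁ c₂ c₃ c₄, (∀ z ∈ I, F z = famF c₁ c₂ c₃ c₄ z) ∧ c₁ * c₄ - c₂ * c₃ = 0 := by
  constructor
  · intro hB
    obtain ⟨c₁, c₂, c₃, c₄, hF⟩ := (exists_eq_famF_iff h.isOpen hI' h.smooth_F).2
      fun z hz => (h.isBachFlatOn_iff_jet.1 hB z hz).1
    exact ⟨c₁, c₂, c₃, c₄, hF, (h.isBachFlatOn_iff_of_eq_famF hne hF).1 hB⟩
  · rintro ⟨c₁, c₂, c₃, c₄, hF, hc⟩
    exact (h.isBachFlatOn_iff_of_eq_famF hne hF).2 hc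

theorem isKahlerEinsteinOn_iff (hI' : I.OrdConnected) (hne : I.Nonempty) :
    IsKahlerEinsteinOn (ansatzMetric F C) (JPlus F) (mfd I) ↔
      (∃ c₀, ∀ z ∈ I, C z = c₀ * Real.exp (-z)) ∧
        ∃ c₂ c₄, ∀ z ∈ I, F z = famF 0 c₂ 0 c₄ z := by
  rw [h.isKahlerEinsteinOn_iff_jet, h.logDeriv_C_iff hI']
  simp only [neg_one_mul]
  refine and_congr_right fun ⟨c₀, hC⟩ => ?_
  obtain ⟨z, hz⟩ := hne
  have hpos := (h.pos_C z hz).ne'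
  rw [hC z hz] at hpos
  exact einstein_ode_iff h.isOpen hI' h.smooth_F (left_ne_zero_of_mul hpos) hC

theorem exists_conformal_extremal (hI' : I.OrdConnected)
    (hB : IsBachFlatOn (ansatzMetric F C) (mfd I)) :
    ∃ C' : ℝ → ℝ, ContDiffOn ℝ ∞ C' I ∧ (∀ z ∈ I, 0 < C' z) ∧
      IsExtremalKahlerOn (ansatzMetric F C') (JPlus F) (mfd I) := by
  have hs : ContDiffOn ℝ ∞ (fun z : ℝ => Real.exp (-z)) I := contDiff_neg.exp.contDiffOn
  refine ⟨fun z => Real.exp (-z), hs, fun z _ => Real.exp_pos _, ?_⟩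
  have h' : IsProfile I F fun z => Real.exp (-z) :=
    ⟨h.isOpen, h.smooth_F, hs, h.pos_F, fun z _ => Real.exp_pos _⟩
  rw [h'.isExtremalKahlerOn_plus_iff hI']
  refine ⟨⟨1, fun z _ => (one_mul _).symm⟩, ?_⟩
  rw [h'.LPlus_LMinus_iff]
  exact fun z hz => ((h.isBachFlatOn_iff_jet.1 hB) z hz).1

end IsProfile

/-- The classification of the metrics of the ansatz over an interval. -/
theorem classification_on_interval (I : Set ℝ) (F C : ℝ → ℝ) (hI : IsOpen I)
    (hI' : I.OrdConnected) (hne : I.Nonempty) (sF : ContDiffOn ℝ ∞ F I) (sC : ContDiffOn ℝ ∞ C I)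
    (pF : ∀ z ∈ I, 0 < F z) (pC : ∀ z ∈ I, 0 < C z) :
      (IsExtremalKahlerOn (ansatzMetric F C) (JPlus F) (mfd I) ↔
        (∃ c₀, ∀ z ∈ I, C z = c₀ * Real.exp (-z)) ∧ ∀ z ∈ I, LPlus (LMinus F) z - 1 = 0) ∧
      (IsExtremalKahlerOn (ansatzMetric F C) (JMinus F) (mfd I) ↔
        (∃ c₀, ∀ z ∈ I, C z = c₀ * Real.exp z) ∧ ∀ z ∈ I, LPlus (LMinus F) z - 1 = 0) ∧
      ((∀ z ∈ I, LPlus (LMinus F) z - 1 = 0) ↔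
        ∃ c₁ c₂ c₃ c₄, ∀ z ∈ I, F z = famF c₁ c₂ c₃ c₄ z) ∧
      (∀ c₀ c₁ c₂ c₃ c₄, (∀ z ∈ I, F z = famF c₁ c₂ c₃ c₄ z) →
        ((∀ z ∈ I, C z = c₀ * Real.exp (-z)) →
          (∀ q ∈ mfd I, scal (ansatzMetric F C) q
            = -24 / c₀ * (c₁ * Real.exp (-zcoord q) + c₂)) ∧
          ((∃ s₀, ∀ q ∈ mfd I, scal (ansatzMetric F C) q = s₀) ↔ c₁ = 0)) ∧
        ((∀ z ∈ I, C z = c₀ * Real.exp z) →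
          (∀ q ∈ mfd I, scal (ansatzMetric F C) q
            = -24 / c₀ * (c₃ + c₄ * Real.exp (zcoord q))) ∧
          ((∃ s₀, ∀ q ∈ mfd I, scal (ansatzMetric F C) q = s₀) ↔ c₄ = 0))) ∧
      (IsBachFlatOn (ansatzMetric F C) (mfd I) ↔
        ∃ c₁ c₂ c₃ c₄, (∀ z ∈ I, F z = famF c₁ c₂ c₃ c₄ z) ∧ c₁ * c₄ - c₂ * c₃ = 0) ∧
      (IsKahlerEinsteinOn (ansatzMetric F C) (JPlus F) (mfd I) ↔
        (∃ c₀, ∀ z ∈ I, C z = c₀ * Real.exp (-z)) ∧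
          ∃ c₁ c₂ c₃ c₄, (∀ z ∈ I, F z = famF c₁ c₂ c₃ c₄ z) ∧ c₁ = 0 ∧ c₃ = 0) ∧
      (IsWeylPlusFlatOn (ansatzMetric F C) (mfd I) ↔ ∀ z ∈ I, LPlus F z - 1 = 0) ∧
      ((∀ z ∈ I, LPlus F z - 1 = 0) ↔ ∃ c₃ c₄, ∀ z ∈ I, F z = famF 0 0 c₃ c₄ z) ∧
      (IsWeylMinusFlatOn (ansatzMetric F C) (mfd I) ↔ ∀ z ∈ I, LMinus F z - 1 = 0) ∧
      ((∀ z ∈ I, LMinus F z - 1 = 0) ↔ ∃ c₁ c₂, ∀ z ∈ I, F z = famF c₁ c₂ 0 0 z) ∧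
      (IsBachFlatOn (ansatzMetric F C) (mfd I) →
        ∃ C' : ℝ → ℝ, ContDiffOn ℝ ∞ C' I ∧ (∀ z ∈ I, 0 < C' z) ∧
          IsExtremalKahlerOn (ansatzMetric F C') (JPlus F) (mfd I)) ∧
      (IsWeylPlusFlatOn (ansatzMetric F C) (mfd I) → IsBachFlatOn (ansatzMetric F C) (mfd I)) ∧
      (IsWeylMinusFlatOn (ansatzMetric F C) (mfd I) → IsBachFlatOn (ansatzMetric F C) (mfd I)) ∧
      (IsKahlerEinsteinOn (ansatzMetric F C) (JPlus F) (mfd I) →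
        IsBachFlatOn (ansatzMetric F C) (mfd I)) := by
  have h : IsProfile I F C := ⟨hI, sF, sC, pF, pC⟩
  obtain ⟨z₀, hz₀⟩ := hne
  refine ⟨h.isExtremalKahlerOn_plus_iff hI', h.isExtremalKahlerOn_minus_iff hI',
    h.LPlus_LMinus_iff.trans (exists_eq_famF_iff hI hI' sF).symm, fun c₀ c₁ c₂ c₃ c₄ hF =>
      ⟨fun hC => ?_, fun hC => ?_⟩,
    h.isBachFlatOn_iff hI' ⟨z₀, hz₀⟩, ?_, h.isWeylPlusFlatOn_iff_jet.trans h.LPlus_iff.symm,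
    h.LPlus_iff.trans (exists_eq_famF_plus_iff hI hI' sF).symm,
    h.isWeylMinusFlatOn_iff_jet.trans h.LMinus_iff.symm,
    h.LMinus_iff.trans (exists_eq_famF_minus_iff hI hI' sF).symm,
    h.exists_conformal_extremal hI', fun hW => ?_, fun hW => ?_, fun hE => ?_⟩
  · have hpos := (pC z₀ hz₀).ne'
    rw [hC z₀ hz₀] at hpos
    refine ⟨fun q hq => h.scal_of_eq_famF_plus hF hC hq,
      h.exp_sub_const_iff ⟨z₀, hz₀⟩ (a := -1) (s := c₂) (by norm_num) (left_ne_zero_of_mul hpos)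
        fun q hq => ?_⟩
    rw [neg_one_mul]
    exact h.scal_of_eq_famF_plus hF hC hq
  · have hpos := (pC z₀ hz₀).ne'
    rw [hC z₀ hz₀] at hpos
    refine ⟨fun q hq => h.scal_of_eq_famF_minus hF hC hq,
      h.exp_sub_const_iff ⟨z₀, hz₀⟩ (a := 1) (s := c₃) (by norm_num) (left_ne_zero_of_mul hpos)
        fun q hq => ?_⟩
    rw [one_mul, add_comm (c₄ * _)]
    exact h.scal_of_eq_famF_minus hF hC hq
  · rw [h.isKahlerEinsteinOn_iff hI' ⟨z₀, hz₀⟩]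
    refine and_congr_right fun _ => ⟨fun ⟨c₂, c₄, hF⟩ => ⟨0, c₂, 0, c₄, hF, rfl, rfl⟩, ?_⟩
    rintro ⟨c₁, c₂, c₃, c₄, hF, rfl, rfl⟩
    exact ⟨c₂, c₄, hF⟩
  · rw [h.isWeylPlusFlatOn_iff_jet, ← exists_eq_famF_plus_iff hI hI' sF] at hW
    obtain ⟨c₃, c₄, hF⟩ := hW
    exact (h.isBachFlatOn_iff hI' ⟨z₀, hz₀⟩).2 ⟨0, 0, c₃, c₄, hF, by ring⟩
  · rw [h.isWeylMinusFlatOn_iff_jet, ← exists_eq_famF_minus_iff hI hI' sF] at hW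
    obtain ⟨c₁, c₂, hF⟩ := hW
    exact (h.isBachFlatOn_iff hI' ⟨z₀, hz₀⟩).2 ⟨c₁, c₂, 0, 0, hF, by ring⟩
  · obtain ⟨c₂, c₄, hF⟩ := ((h.isKahlerEinsteinOn_iff hI' ⟨z₀, hz₀⟩).1 hE).2
    exact (h.isBachFlatOn_iff hI' ⟨z₀, hz₀⟩).2 ⟨0, c₂, 0, c₄, hF, by ring⟩

/-! ### The moduli of coefficient vectors -/

/-- `famF` as a function of the vector of its coefficients. -/
noncomputable def famV (c : Fin 4 → ℝ) : ℝ → ℝ := famF (c 0) (c 1) (c 2) (c 3)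

/-- The weights with which translation in `z` acts on the coefficients. -/
noncomputable def weight : Fin 4 → ℝ := ![2, 1, -1, -2]

/-- The action on the coefficients of translation in `z`. -/
noncomputable def translate (t : ℝ) (c : Fin 4 → ℝ) : Fin 4 → ℝ := fun i =>
  Real.exp (weight i * t) * c i

theorem translate_zero (c : Fin 4 → ℝ) : translate 0 c = c := by
  funext i
  simp [translate]

theorem translate_translate (s t : ℝ) (c : Fin 4 → ℝ) :
    translate s (translate t c) = translate (s + t) c := by
  funext i
  simp only [translate]
  rw [← mul_assoc, ← Real.exp_add, mul_add]

theorem continuous_translate (t : ℝ) : Continuous (translate t) :=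
  continuous_pi fun i => (continuous_apply i).const_mul _

theorem weight_ne_zero (i : Fin 4) : weight i ≠ 0 := by
  rcases fin4_cases i with rfl | rfl | rfl | rfl <;> simp [weight]

theorem famV_translate (t : ℝ) (c : Fin 4 → ℝ) (z : ℝ) :
    famV (translate t c) (z + t) = famV c z := by
  have h : ∀ a x : ℝ, Real.exp (a * t) * x * Real.exp (-a * (z + t)) = x * Real.exp (-a * z) := by
    intro a x
    rw [mul_right_comm, ← Real.exp_add, mul_comm]
    ring_nf
  have h1 := h 2 (c 0)
  have h2 := h 1 (c 1)
  have h3 := h (-1) (c 2)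
  have h4 := h (-2) (c 3)
  simp only [neg_neg, one_mul, neg_one_mul] at h1 h2 h3 h4
  simp only [famV, famF, translate, weight, vec4_zero, vec4_one, vec4_two, vec4_three, one_mul,
    neg_one_mul]
  linear_combination 1 / 2 * h1 + h2 + h3 + 1 / 2 * h4

/-- The linear part `famV - 1` of the affine map `famV`. -/
noncomputable def famLin : (Fin 4 → ℝ) →ₗ[ℝ] (ℝ → ℝ) where
  toFun c z := famV c z - 1
  map_add' c d := by
    funext z
    simp only [famV, famF, Pi.add_apply]
    ring
  map_smul' r c := by
    funext z
    simp only [famV, famF, Pi.smul_apply, smul_eq_mul, RingHom.id_apply]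
    ring

/-- The functions `e^{-2z}`, `e^{-z}`, `e^z`, `e^{2z}` are linearly independent: a combination of
them that vanishes has vanishing derivatives at `0`. -/
theorem famLin_injective : LinearMap.ker famLin = ⊥ := by
  rw [LinearMap.ker_eq_bot']
  intro c hc
  have hF : ∀ z ∈ Set.univ, (fun _ => (1 : ℝ)) z = famF (c 0) (c 1) (c 2) (c 3) z := fun z _ =>
    (sub_eq_zero.1 (congrFun hc z)).symm
  obtain ⟨h0, h1, h2, h3, -⟩ := jet_of_eq_famF isOpen_univ hF (Set.mem_univ 0)
  simp only [deriv_const', deriv_const, neg_zero, Real.exp_zero] at h0 h1 h2 h3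
  funext i
  rcases fin4_cases i with rfl | rfl | rfl | rfl <;> simp only [Pi.zero_apply] <;> linarith

/-- A function in the family depends continuously on its coefficients, and conversely, for the
topology of pointwise convergence: an injective linear map from a finite-dimensional space is an
embedding. -/
theorem isEmbedding_famV : IsEmbedding famV := by
  have h1 := (LinearMap.isClosedEmbedding_of_injective famLin_injective).isEmbedding
  have h2 : famV = (Homeomorph.addRight (fun _ => (1 : ℝ)) : (ℝ → ℝ) ≃ₜ (ℝ → ℝ)) ∘ famLin := by
    funext c z
    simp [famLin]
  rw [h2]
  exact (Homeomorph.isEmbedding _).comp h1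

theorem famV_injective : Function.Injective famV := isEmbedding_famV.injective

theorem famV_zero : famV 0 = fun _ => 1 := by
  funext z
  simp [famV, famF]

theorem translate_iff {t : ℝ} {c d : Fin 4 → ℝ} :
    (∀ z, famV d (z + t) = famV c z) ↔ d = translate t c := by
  constructor
  · intro h
    apply famV_injective
    funext z
    have h1 := h (z - t)
    rw [sub_add_cancel] at h1
    rw [h1, ← famV_translate t c (z - t), sub_add_cancel]
  · rintro rfl z
    exact famV_translate t c z

/-- The relation of being translates of each other. -/
def orbitSetoid (A : Set (Fin 4 → ℝ)) : Setoid A where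
  r c d := ∃ t, d.1 = translate t c.1
  iseqv :=
    { refl := fun c => ⟨0, (translate_zero c.1).symm⟩
      symm := by
        rintro c d ⟨t, h⟩
        exact ⟨-t, by rw [h, translate_translate, neg_add_cancel, translate_zero]⟩
      trans := by
        rintro c d e ⟨t, h⟩ ⟨t', h'⟩
        exact ⟨t' + t, by rw [h', h, translate_translate]⟩ }

/-- A set of coefficient vectors is invariant when it is stable under translation. -/
def IsInvariant (A : Set (Fin 4 → ℝ)) : Prop := ∀ t, ∀ c ∈ A, translate t c ∈ A

theorem isOpenQuotientMap_orbit {A : Set (Fin 4 → ℝ)} (hA : IsInvariant A) :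
    IsOpenQuotientMap (Quotient.mk (orbitSetoid A)) := by
  refine ⟨Quotient.mk_surjective, continuous_quotient_mk', fun U hU => ?_⟩
  have h1 : Quotient.mk (orbitSetoid A) ⁻¹' (Quotient.mk (orbitSetoid A) '' U)
      = ⋃ t, (fun c : A => (⟨translate t c.1, hA t c.1 c.2⟩ : A)) ⁻¹' U := by
    ext c
    simp only [Set.mem_preimage, Set.mem_image, Set.mem_iUnion]
    constructor
    · rintro ⟨d, hd, hdc⟩
      obtain ⟨t, ht⟩ := (orbitSetoid A).symm (Quotient.exact hdc)
      refine ⟨t, ?_⟩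
      have h2 : (⟨translate t c.1, hA t c.1 c.2⟩ : A) = d := Subtype.ext ht.symm
      rwa [h2]
    · rintro ⟨t, ht⟩
      exact ⟨_, ht, Quotient.sound ((orbitSetoid A).symm ⟨t, rfl⟩)⟩
  rw [← isQuotientMap_quotient_mk'.isOpen_preimage]
  refine h1 ▸ isOpen_iUnion fun t => hU.preimage ?_
  exact ((continuous_translate t).comp continuous_subtype_val).subtype_mk _

/-- Inclusion of invariant sets induces an embedding of orbit spaces. -/
theorem exists_isEmbedding_orbit {A B : Set (Fin 4 → ℝ)} (hA : IsInvariant A) (hB : IsInvariant B)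
    (hAB : A ⊆ B) :
    ∃ j : Quotient (orbitSetoid A) → Quotient (orbitSetoid B), IsEmbedding j ∧
      ∀ c : A, j (Quotient.mk _ c) = Quotient.mk _ (Set.inclusion hAB c) := by
  let j : Quotient (orbitSetoid A) → Quotient (orbitSetoid B) :=
    Quotient.map' (s₁ := orbitSetoid A) (s₂ := orbitSetoid B) (Set.inclusion hAB) fun _ _ h => h
  have hj : ∀ c : A, j (Quotient.mk _ c) = Quotient.mk _ (Set.inclusion hAB c) := fun c => rfl
  have hcont : Continuous j :=
    (continuous_quotient_mk'.comp (continuous_inclusion hAB)).quotient_lift _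
  refine ⟨j, ⟨⟨le_antisymm hcont.le_induced ?_⟩, ?_⟩, hj⟩
  · intro W hW
    have hW' : IsOpen (Quotient.mk (orbitSetoid A) ⁻¹' W) := hW
    obtain ⟨O, hO, hOW⟩ := isOpen_induced_iff.1 hW'
    refine isOpen_induced_iff.2 ⟨Quotient.mk (orbitSetoid B) '' (Subtype.val ⁻¹' O),
      (isOpenQuotientMap_orbit hB).isOpenMap _ (hO.preimage continuous_subtype_val), ?_⟩
    ext q
    obtain ⟨a, rfl⟩ := Quotient.mk_surjective q
    have ha : a.1 ∈ O ↔ Quotient.mk (orbitSetoid A) a ∈ W := by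
      rw [← Set.mem_preimage (f := Quotient.mk (orbitSetoid A)), ← hOW]
      rfl
    rw [Set.mem_preimage, hj, ← ha]
    constructor
    · rintro ⟨o, ho, hoa⟩
      obtain ⟨t, ht⟩ := (orbitSetoid B).symm (Quotient.exact hoa)
      have ht' : o.1 = translate t a.1 := ht
      have ho' : o.1 ∈ A := by rw [ht']; exact hA t _ a.2
      rw [ha]
      have h2 : Quotient.mk (orbitSetoid A) a = Quotient.mk (orbitSetoid A) ⟨o.1, ho'⟩ :=
        Quotient.sound ⟨t, ht'⟩
      have h3 : (⟨o.1, ho'⟩ : A) ∈ Quotient.mk (orbitSetoid A) ⁻¹' W := by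
        rw [← hOW]
        exact ho
      rw [h2]
      exact h3
    · intro haO
      exact ⟨Set.inclusion hAB a, haO, rfl⟩
  · intro q q' hqq
    obtain ⟨a, rfl⟩ := Quotient.mk_surjective q
    obtain ⟨b, rfl⟩ := Quotient.mk_surjective q'
    exact Quotient.sound (Quotient.exact hqq : (orbitSetoid B).r _ _)

/-- A set of pairs `(F, C)` in which `F` runs through a family and `C` through a fixed set, modulo
a relation that amounts to translating `F`, is homeomorphic to the space of orbits of the
coefficients of `F`. -/
theorem exists_homeomorph_orbit {S : Set ((ℝ → ℝ) × (ℝ → ℝ))} {s : Setoid S}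
    {A : Set (Fin 4 → ℝ)} {𝒞 : Set (ℝ → ℝ)} (hne : 𝒞.Nonempty) (hA : IsInvariant A)
    (hS : ∀ p, p ∈ S ↔ (∃ c ∈ A, p.1 = famV c) ∧ p.2 ∈ 𝒞)
    (hs : ∀ p p' : S, s p p' ↔ ∃ t, ∀ z, p'.1.1 (z + t) = p.1.1 z) :
    ∃ e : Quotient s ≃ₜ Quotient (orbitSetoid A),
      ∀ (p : S) (c : A), p.1.1 = famV c.1 → e (Quotient.mk s p) = Quotient.mk _ c := by
  choose coef hcoefA hcoef using fun p : S => ((hS p.1).1 p.2).1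
  let f : S → Quotient (orbitSetoid A) := fun p => Quotient.mk _ ⟨coef p, hcoefA p⟩
  have hcont : Continuous f := by
    refine continuous_quotient_mk'.comp (Continuous.subtype_mk ?_ _)
    rw [isEmbedding_famV.continuous_iff]
    have h1 : famV ∘ coef = fun p : S => p.1.1 := funext fun p => (hcoef p).symm
    rw [h1]
    exact continuous_fst.comp continuous_subtype_val
  have hf : ∀ (p : S) (c : A), p.1.1 = famV c.1 → f p = Quotient.mk _ c := fun p c hpc =>
    congrArg _ (Subtype.ext (famV_injective ((hcoef p).symm.trans hpc)))
  obtain ⟨C₀, hC₀⟩ := hne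
  have hq : IsQuotientMap f := by
    let σ : A → S := fun c => ⟨(famV c.1, C₀), (hS _).2 ⟨⟨c.1, c.2, rfl⟩, hC₀⟩⟩
    have hσ : Continuous σ :=
      ((isEmbedding_famV.continuous.comp continuous_subtype_val).prodMk
        continuous_const).subtype_mk _
    refine IsQuotientMap.of_comp hσ hcont ?_
    have h1 : f ∘ σ = Quotient.mk (orbitSetoid A) := funext fun c => hf (σ c) c rfl
    rw [h1]
    exact (isOpenQuotientMap_orbit hA).isQuotientMap
  obtain rfl : s = Setoid.ker f := by
    ext p p'
    rw [hs, Setoid.ker_def]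
    have h1 : f p = f p' ↔ ∃ t, coef p' = translate t (coef p) :=
      ⟨fun h => Quotient.exact h, fun h => Quotient.sound h⟩
    rw [h1]
    refine exists_congr fun t => ?_
    rw [← translate_iff, hcoef p, hcoef p']
  have hq' : IsQuotientMap (⟨f, hcont⟩ : C(S, Quotient (orbitSetoid A))) := hq
  refine ⟨hq'.homeomorph, fun p c hpc => ?_⟩
  exact hf p c hpc

/-! ### Charts of the moduli spaces -/

/-- The representative of the orbit of `c` whose `i`-th coordinate is `±1`; it makes sense only if
`c i ≠ 0`. -/
noncomputable def normalize (i : Fin 4) (c : Fin 4 → ℝ) : Fin 4 → ℝ :=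
  translate (-Real.log |c i| / weight i) c

theorem normalize_apply_self {i : Fin 4} {s : ℝ} (hs : |s| = 1) {c : Fin 4 → ℝ}
    (hc : 0 < s * c i) : normalize i c i = s := by
  have h0 : c i ≠ 0 := (right_ne_zero_of_mul hc.ne')
  have h1 : s * c i = |c i| := by rw [← abs_of_pos hc, abs_mul, hs, one_mul]
  rw [normalize, translate, mul_div_cancel₀ _ (weight_ne_zero i), Real.exp_neg,
    Real.exp_log (abs_pos.2 h0), inv_mul_eq_iff_eq_mul₀ (abs_ne_zero.2 h0), ← h1]
  rw [mul_right_comm, ← abs_mul_abs_self s, hs]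
  ring

theorem normalize_of_apply_self {i : Fin 4} {c : Fin 4 → ℝ} (hc : |c i| = 1) :
    normalize i c = c := by
  rw [normalize, hc, Real.log_one, neg_zero, zero_div, translate_zero]

/-- Where the `i`-th coordinate does not vanish, `normalize i` is constant on orbits. -/
theorem normalize_translate {i : Fin 4} {c : Fin 4 → ℝ} (hc : c i ≠ 0) (t : ℝ) :
    normalize i (translate t c) = normalize i c := by
  rw [normalize, normalize, translate_translate]
  congr 1
  have h := weight_ne_zero i
  rw [translate, abs_mul, Real.abs_exp, Real.log_mul (Real.exp_ne_zero _) (abs_ne_zero.2 hc),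
    Real.log_exp]
  field_simp
  ring

theorem continuousAt_normalize {i : Fin 4} {c : Fin 4 → ℝ} (hc : c i ≠ 0) :
    ContinuousAt (normalize i) c := by
  have h1 : ContinuousAt (fun c : Fin 4 → ℝ => -Real.log |c i| / weight i) c :=
    (ContinuousAt.log (f := fun c : Fin 4 → ℝ => |c i|) (continuous_apply i).abs.continuousAt
      (abs_ne_zero.2 hc)).neg.div_const _
  exact continuousAt_pi.2 fun j =>
    ((h1.const_mul (weight j)).rexp).mul (continuous_apply j).continuousAt

/-- The coefficient vectors that give a metric which is defined somewhere and is not conformally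
flat. -/
def admissible : Set (Fin 4 → ℝ) := {c | c ≠ 0 ∧ ∃ z, 0 < famV c z}

theorem isOpen_admissible : IsOpen admissible := by
  have h1 : admissible = {0}ᶜ ∩ ⋃ z, {c | 0 < famV c z} := by
    ext c
    simp [admissible]
  rw [h1]
  exact isOpen_compl_singleton.inter (isOpen_iUnion fun z =>
    isOpen_lt continuous_const ((continuous_apply z).comp isEmbedding_famV.continuous))

theorem translate_ne_zero {t : ℝ} {c : Fin 4 → ℝ} (hc : c ≠ 0) : translate t c ≠ 0 := by
  intro h
  obtain ⟨i, hi⟩ := Function.ne_iff.1 hc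
  exact hi (by simpa [translate] using congrFun h i)

theorem isInvariant_admissible_inter {Z : Set (Fin 4 → ℝ)} (hZ : IsInvariant Z) :
    IsInvariant (admissible ∩ Z) := by
  rintro t c ⟨⟨h0, z, hz⟩, hc⟩
  exact ⟨⟨translate_ne_zero h0, z + t, by rwa [famV_translate]⟩, hZ t c hc⟩

/-- `P` parametrizes, with inverse `R`, the part of `Z` where the `i`-th coordinate equals `s`. -/
structure IsSlice {n : ℕ} (Z : Set (Fin 4 → ℝ)) (i : Fin 4) (s : ℝ)
    (P : EuclideanSpace ℝ (Fin n) → Fin 4 → ℝ) (R : (Fin 4 → ℝ) → EuclideanSpace ℝ (Fin n)) :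
    Prop where
  continuous_P : Continuous P
  continuous_R : Continuous R
  mem : ∀ y, P y ∈ Z
  apply_self : ∀ y, P y i = s
  left_inv : ∀ y, R (P y) = y
  right_inv : ∀ c ∈ Z, c i = s → P (R c) = c

/-- Every orbit on which the `i`-th coordinate has the sign `s = ±1` meets a slice exactly once, so
that the slice gives a chart. -/
theorem IsSlice.exists_chart {n : ℕ} {Z : Set (Fin 4 → ℝ)} (hZ : IsInvariant Z) {i : Fin 4} {s : ℝ}
    (hs : |s| = 1) {P : EuclideanSpace ℝ (Fin n) → Fin 4 → ℝ}
    {R : (Fin 4 → ℝ) → EuclideanSpace ℝ (Fin n)} (h : IsSlice Z i s P R)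
    (a : ↥(admissible ∩ Z)) (ha : 0 < s * a.1 i) :
    ∃ φ : OpenPartialHomeomorph (Quotient (orbitSetoid (admissible ∩ Z)))
      (EuclideanSpace ℝ (Fin n)), Quotient.mk _ a ∈ φ.source := by
  classical
  have hA := isInvariant_admissible_inter hZ
  have hs0 : s ≠ 0 := by
    rintro rfl
    simp at hs
  let π := Quotient.mk (orbitSetoid (admissible ∩ Z))
  have hπ : IsOpenQuotientMap π := isOpenQuotientMap_orbit hA
  -- the sign of a coordinate and the normalized vector do not depend on the representative
  have hout : ∀ b : ↥(admissible ∩ Z), ∃ t, (π b).out.1 = translate t b.1 := fun b =>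
    (orbitSetoid _).symm (Quotient.mk_out (s := orbitSetoid _) b)
  have hsrc : ∀ b : ↥(admissible ∩ Z), 0 < s * (π b).out.1 i ↔ 0 < s * b.1 i := by
    intro b
    obtain ⟨t, ht⟩ := hout b
    rw [ht, translate, mul_left_comm]
    exact mul_pos_iff_of_pos_left (Real.exp_pos _)
  have hnorm : ∀ b : ↥(admissible ∩ Z), 0 < s * b.1 i →
      normalize i (π b).out.1 = normalize i b.1 := by
    intro b hb
    obtain ⟨t, ht⟩ := hout b
    rw [ht, normalize_translate (right_ne_zero_of_mul hb.ne')]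
  have hnormA : ∀ c ∈ admissible ∩ Z, normalize i c ∈ admissible ∩ Z := fun c hc => hA _ _ hc
  have hPR : ∀ c ∈ admissible ∩ Z, 0 < s * c i → P (R (normalize i c)) = normalize i c :=
    fun c hc hci => h.right_inv _ (hnormA c hc).2 (normalize_apply_self hs hci)
  have hpos : 0 < s * s := mul_self_pos.2 hs0
  let inv : EuclideanSpace ℝ (Fin n) → Quotient (orbitSetoid (admissible ∩ Z)) := fun y =>
    if hy : P y ∈ admissible ∩ Z then π ⟨P y, hy⟩ else π a
  have hinv : ∀ y (hy : P y ∈ admissible ∩ Z), inv y = π ⟨P y, hy⟩ := fun y hy => dif_pos hy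
  have hopen : IsOpen {b : ↥(admissible ∩ Z) | 0 < s * b.1 i} :=
    isOpen_lt continuous_const (((continuous_apply i).comp continuous_subtype_val :
      Continuous fun b : ↥(admissible ∩ Z) => b.1 i).const_mul s)
  refine ⟨
    { toFun := fun q => R (normalize i q.out.1)
      invFun := inv
      source := {q | 0 < s * q.out.1 i}
      target := {y | P y ∈ admissible}
      map_source' := fun q hq => ?_
      map_target' := fun y hy => ?_
      left_inv' := fun q hq => ?_
      right_inv' := fun y hy => ?_
      open_source := ?_
      open_target := isOpen_admissible.preimage h.continuous_P
      continuousOn_toFun := fun q hq => ?_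
      continuousOn_invFun := ?_ }, (hsrc a).2 ha⟩
  · change P (R (normalize i q.out.1)) ∈ admissible
    rw [hPR _ q.out.2 hq]
    exact (hnormA _ q.out.2).1
  · change 0 < s * (inv y).out.1 i
    rw [hinv y ⟨hy, h.mem y⟩, hsrc]
    change 0 < s * P y i
    rwa [h.apply_self]
  · have h1 := hPR _ q.out.2 hq
    have h2 : P (R (normalize i q.out.1)) ∈ admissible ∩ Z := by
      rw [h1]
      exact hnormA _ q.out.2
    rw [hinv _ h2]
    refine Eq.trans ?_ (Quotient.out_eq q)
    exact Quotient.sound ((orbitSetoid _).symm ⟨-Real.log |q.out.1 i| / weight i, h1⟩)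
  · have h1 : 0 < s * P y i := by rwa [h.apply_self]
    change R (normalize i (inv y).out.1) = y
    rw [hinv y ⟨hy, h.mem y⟩, hnorm _ h1,
      normalize_of_apply_self (c := P y) (by rw [h.apply_self, hs]), h.left_inv]
  · obtain ⟨b, rfl⟩ := hπ.surjective q
    have hb := (hsrc b).1 hq
    refine ContinuousAt.continuousWithinAt (hπ.continuousAt_comp_iff.1 ?_)
    refine ContinuousAt.congr (f := fun b : ↥(admissible ∩ Z) => R (normalize i b.1)) ?_
      (Filter.mem_of_superset (hopen.mem_nhds hb) fun b' hb' => (congrArg R (hnorm b' hb')).symm)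
    exact h.continuous_R.continuousAt.comp
      ((continuousAt_normalize (right_ne_zero_of_mul hb.ne')).comp continuousAt_subtype_val)
  · rw [continuousOn_iff_continuous_domRestrict]
    have h1 : Set.domRestrict {y | P y ∈ admissible} inv
        = fun y => π ⟨P y.1, y.2, h.mem y.1⟩ := funext fun y => hinv y.1 ⟨y.2, h.mem y.1⟩
    refine Eq.mpr (congrArg Continuous h1) ?_
    exact hπ.continuous.comp ((h.continuous_P.comp continuous_subtype_val).subtype_mk _)
  · rw [← hπ.isQuotientMap.isOpen_preimage]
    have h1 : π ⁻¹' {q | 0 < s * q.out.1 i} = {b | 0 < s * b.1 i} := Set.ext hsrc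
    rw [h1]
    exact hopen

/-- A set cut out of the admissible vectors by conditions that have slices everywhere is a manifold
modulo translation. -/
theorem isParameterFamily_of_slices {n : ℕ} {S : Set ((ℝ → ℝ) × (ℝ → ℝ))} {s : Setoid S}
    {Z : Set (Fin 4 → ℝ)} (hZ : IsInvariant Z)
    (e : Quotient s ≃ₜ Quotient (orbitSetoid (admissible ∩ Z)))
    (hne : ∃ c ∈ Z, c ≠ 0 ∧ ∀ i, 0 ≤ c i)
    (hslice : ∀ c ∈ Z, c ≠ 0 → ∃ i, c i ≠ 0 ∧ ∀ s : ℝ, |s| = 1 →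
      ∃ (P : EuclideanSpace ℝ (Fin n) → Fin 4 → ℝ) (R : (Fin 4 → ℝ) → EuclideanSpace ℝ (Fin n)),
        IsSlice Z i s P R) :
    IsParameterFamily n s := by
  constructor
  · obtain ⟨c, hcZ, hc, hpos⟩ := hne
    refine ⟨e.symm (Quotient.mk _ ⟨c, ⟨hc, 0, ?_⟩, hcZ⟩)⟩
    simp only [famV, famF]
    have := hpos 0
    have := hpos 1
    have := hpos 2
    have := hpos 3
    positivity
  · have hchart : ∀ q : Quotient s, ∃ φ : OpenPartialHomeomorph (Quotient s)
        (EuclideanSpace ℝ (Fin n)), q ∈ φ.source := by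
      intro q
      obtain ⟨a, ha⟩ := Quotient.mk_surjective (e q)
      obtain ⟨i, hi, hsl⟩ := hslice a.1 a.2.2 a.2.1.1
      have hs : |a.1 i / abs (a.1 i)| = 1 := by
        rw [abs_div, abs_abs, div_self (abs_ne_zero.2 hi)]
      obtain ⟨P, R, h⟩ := hsl _ hs
      obtain ⟨φ, hφ⟩ := h.exists_chart hZ hs a (by
        rw [div_mul_eq_mul_div]
        exact div_pos (mul_self_pos.2 hi) (abs_pos.2 hi))
      refine ⟨e.toOpenPartialHomeomorph.trans φ, ?_⟩
      rw [ha] at hφ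
      simpa using hφ
    choose φ hφ using hchart
    exact ⟨{ atlas := Set.range φ
             chartAt := φ
             mem_chart_source := hφ
             chart_mem_atlas := Set.mem_range_self }⟩

/-! ### The strata and their slices -/

theorem isInvariant_univ : IsInvariant Set.univ := fun _ _ _ => trivial

/-- The coefficient vectors supported on two coordinates. -/
def coordPlane (i j : Fin 4) : Set (Fin 4 → ℝ) := {c | ∀ k, k ≠ i → k ≠ j → c k = 0}

/-- The coefficient vectors of the Bach-flat metrics. -/
def bachCone : Set (Fin 4 → ℝ) := {c | c 0 * c 3 - c 1 * c 2 = 0}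

theorem isInvariant_coordPlane (i j : Fin 4) : IsInvariant (coordPlane i j) := by
  intro t c hc k hki hkj
  rw [translate, hc k hki hkj, mul_zero]

/-- The two products have the same weight, `2 - 2 = 1 - 1`. -/
theorem translate_mem_bachCone_iff {t : ℝ} {c : Fin 4 → ℝ} :
    translate t c ∈ bachCone ↔ c ∈ bachCone := by
  have h1 : Real.exp (2 * t) * Real.exp (-2 * t) = 1 := by
    rw [← Real.exp_add]
    simp
  have h2 : Real.exp (1 * t) * Real.exp (-1 * t) = 1 := by
    rw [← Real.exp_add]
    simp
  simp only [bachCone, Set.mem_ofPred_eq, translate, weight, vec4_zero, vec4_one, vec4_two,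
    vec4_three]
  rw [mul_mul_mul_comm, h1, mul_mul_mul_comm (Real.exp (1 * t)), h2, one_mul, one_mul]

theorem isInvariant_bachCone : IsInvariant bachCone := fun _ _ hc =>
  translate_mem_bachCone_iff.2 hc

theorem isSlice_univ (i : Fin 4) (s : ℝ) :
    IsSlice (n := 3) Set.univ i s (fun y => Fin.insertNth i s fun k => y k)
      (fun c => WithLp.toLp 2 fun k => c (i.succAbove k)) where
  continuous_P := continuous_const.finInsertNth i (by fun_prop)
  continuous_R := by fun_prop
  mem _ := trivial
  apply_self y := by simp
  left_inv y := by
    ext k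
    simp
  right_inv c _ hc := by
    rw [← hc]
    exact Fin.insertNth_self_removeNth i c

theorem isSlice_coordPlane {i j : Fin 4} (hij : i ≠ j) {Z : Set (Fin 4 → ℝ)}
    (hZ : ∀ c, c ∈ Z ↔ ∀ k, k ≠ i → k ≠ j → c k = 0) (s : ℝ) :
    IsSlice (n := 1) Z i s (fun y => Pi.single i s + Pi.single j (y 0))
      (fun c => WithLp.toLp 2 fun _ => c j) where
  continuous_P := continuous_const.add ((continuous_single j).comp (by fun_prop))
  continuous_R := by fun_prop
  mem y := by
    rw [hZ]
    intro k hki hkj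
    simp [hki, hkj]
  apply_self y := by simp [hij]
  left_inv y := by
    ext k
    rw [Fin.fin_one_eq_zero k]
    simp [hij.symm]
  right_inv c hc hci := by
    rw [hZ] at hc
    funext k
    by_cases hki : k = i
    · subst hki
      simp [hij, hci]
    · by_cases hkj : k = j
      · subst hkj
        simp [hij.symm]
      · simp [hki, hkj, hc k hki hkj]

theorem exists_isSlice_univ (c : Fin 4 → ℝ) (hc : c ≠ 0) : ∃ i, c i ≠ 0 ∧ ∀ s : ℝ, |s| = 1 →
    ∃ (P : EuclideanSpace ℝ (Fin 3) → Fin 4 → ℝ) (R : (Fin 4 → ℝ) → EuclideanSpace ℝ (Fin 3)),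
      IsSlice Set.univ i s P R := by
  obtain ⟨i, hi⟩ := Function.ne_iff.1 hc
  exact ⟨i, hi, fun s _ => ⟨_, _, isSlice_univ i s⟩⟩

theorem exists_isSlice_coordPlane {i j : Fin 4} (hij : i ≠ j) {c : Fin 4 → ℝ}
    (hcZ : c ∈ coordPlane i j) (hc : c ≠ 0) : ∃ i', c i' ≠ 0 ∧ ∀ s : ℝ, |s| = 1 →
    ∃ (P : EuclideanSpace ℝ (Fin 1) → Fin 4 → ℝ) (R : (Fin 4 → ℝ) → EuclideanSpace ℝ (Fin 1)),
      IsSlice (coordPlane i j) i' s P R := by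
  obtain ⟨k, hk⟩ := Function.ne_iff.1 hc
  refine ⟨k, hk, fun s _ => ?_⟩
  by_cases hki : k = i
  · subst hki
    exact ⟨_, _, isSlice_coordPlane hij (fun _ => Iff.rfl) s⟩
  · have hkj : k = j := by
      by_contra hkj
      exact hk (hcZ k hki hkj)
    subst hkj
    exact ⟨_, _, isSlice_coordPlane hij.symm
      (fun c => forall_congr' fun k => ⟨fun h a b => h b a, fun h a b => h b a⟩) s⟩

/-- On the Bach cone a coordinate that equals `±1` determines the opposite one as a product of the
other two. -/
theorem exists_isSlice_bachCone (c : Fin 4 → ℝ) (hc : c ≠ 0) : ∃ i, c i ≠ 0 ∧ ∀ s : ℝ, |s| = 1 →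
    ∃ (P : EuclideanSpace ℝ (Fin 2) → Fin 4 → ℝ) (R : (Fin 4 → ℝ) → EuclideanSpace ℝ (Fin 2)),
      IsSlice bachCone i s P R := by
  obtain ⟨i, hi⟩ := Function.ne_iff.1 hc
  refine ⟨i, hi, fun s hs => ?_⟩
  have hss : s * s = 1 := by rw [← abs_mul_abs_self, hs, one_mul]
  have hP : ∀ {f₀ f₁ f₂ f₃ : EuclideanSpace ℝ (Fin 2) → ℝ}, Continuous f₀ → Continuous f₁ →
      Continuous f₂ → Continuous f₃ → Continuous fun y => ![f₀ y, f₁ y, f₂ y, f₃ y] := by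
    intro f₀ f₁ f₂ f₃ h0 h1 h2 h3
    refine continuous_pi fun k => ?_
    rcases fin4_cases k with rfl | rfl | rfl | rfl <;> assumption
  have hR : ∀ j k : Fin 4, Continuous fun c : Fin 4 → ℝ => (!₂[c j, c k] : EuclideanSpace ℝ (Fin 2))
      := by
    intro j k
    refine (PiLp.continuous_toLp 2 _).comp (continuous_pi fun l => ?_)
    fin_cases l
    · exact continuous_apply j
    · exact continuous_apply k
  have hy : ∀ j : Fin 2, Continuous fun y : EuclideanSpace ℝ (Fin 2) => y j := fun j => by fun_prop
  have hyy : Continuous fun y : EuclideanSpace ℝ (Fin 2) => s * y 0 * y 1 :=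
    ((hy 0).const_mul s).mul (hy 1)
  rcases fin4_cases i with rfl | rfl | rfl | rfl
  · refine ⟨fun y => ![s, y 0, y 1, s * y 0 * y 1], fun c => !₂[c 1, c 2],
      hP continuous_const (hy 0) (hy 1) hyy, hR 1 2, fun y => ?_, fun y => rfl, fun y => ?_,
      fun c hc hci => ?_⟩
    · change s * (s * y 0 * y 1) - y 0 * y 1 = 0
      linear_combination y 0 * y 1 * hss
    · ext k
      fin_cases k <;> rfl
    · have hc' : c 0 * c 3 - c 1 * c 2 = 0 := hc
      rw [hci] at hc'
      funext k
      rcases fin4_cases k with rfl | rfl | rfl | rfl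
      · exact hci.symm
      · rfl
      · rfl
      · change s * c 1 * c 2 = c 3
        linear_combination -s * hc' + c 3 * hss
  · refine ⟨fun y => ![y 0, s, s * y 0 * y 1, y 1], fun c => !₂[c 0, c 3],
      hP (hy 0) continuous_const hyy (hy 1), hR 0 3, fun y => ?_, fun y => rfl, fun y => ?_,
      fun c hc hci => ?_⟩
    · change y 0 * y 1 - s * (s * y 0 * y 1) = 0
      linear_combination -y 0 * y 1 * hss
    · ext k
      fin_cases k <;> rfl
    · have hc' : c 0 * c 3 - c 1 * c 2 = 0 := hc
      rw [hci] at hc'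
      funext k
      rcases fin4_cases k with rfl | rfl | rfl | rfl
      · rfl
      · exact hci.symm
      · change s * c 0 * c 3 = c 2
        linear_combination s * hc' + c 2 * hss
      · rfl
  · refine ⟨fun y => ![y 0, s * y 0 * y 1, s, y 1], fun c => !₂[c 0, c 3],
      hP (hy 0) hyy continuous_const (hy 1), hR 0 3, fun y => ?_, fun y => rfl, fun y => ?_,
      fun c hc hci => ?_⟩
    · change y 0 * y 1 - s * y 0 * y 1 * s = 0
      linear_combination -y 0 * y 1 * hss
    · ext k
      fin_cases k <;> rfl
    · have hc' : c 0 * c 3 - c 1 * c 2 = 0 := hc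
      rw [hci] at hc'
      funext k
      rcases fin4_cases k with rfl | rfl | rfl | rfl
      · rfl
      · change s * c 0 * c 3 = c 1
        linear_combination s * hc' + c 1 * hss
      · exact hci.symm
      · rfl
  · refine ⟨fun y => ![s * y 0 * y 1, y 0, y 1, s], fun c => !₂[c 1, c 2],
      hP hyy (hy 0) (hy 1) continuous_const, hR 1 2, fun y => ?_, fun y => rfl, fun y => ?_,
      fun c hc hci => ?_⟩
    · change s * y 0 * y 1 * s - y 0 * y 1 = 0
      linear_combination y 0 * y 1 * hss
    · ext k
      fin_cases k <;> rfl
    · have hc' : c 0 * c 3 - c 1 * c 2 = 0 := hc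
      rw [hci] at hc'
      funext k
      rcases fin4_cases k with rfl | rfl | rfl | rfl
      · change s * c 1 * c 2 = c 0
        linear_combination -s * hc' + c 0 * hss
      · rfl
      · rfl
      · exact hci.symm

/-! ### The families of global solutions -/

/-- The conformal factors allowed in a global solution. -/
def analyticPos : Set (ℝ → ℝ) := {C | AnalyticOnNhd ℝ C Set.univ ∧ ∀ z, 0 < C z}

/-- The conformal factors that make the ansatz Kähler for `J⁺`. -/
def expRay : Set (ℝ → ℝ) := {C | ∃ c₀, 0 < c₀ ∧ ∀ z, C z = c₀ * Real.exp (-z)}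

theorem analyticOnNhd_const_mul_exp_neg (c₀ : ℝ) :
    AnalyticOnNhd ℝ (fun z : ℝ => c₀ * Real.exp (-z)) Set.univ := fun z _ => by
  fun_prop

theorem expRay_subset : expRay ⊆ analyticPos := by
  rintro C ⟨c₀, h0, hC⟩
  obtain rfl : C = fun z => c₀ * Real.exp (-z) := funext hC
  exact ⟨analyticOnNhd_const_mul_exp_neg c₀, fun z => mul_pos h0 (Real.exp_pos _)⟩

theorem expRay_nonempty : expRay.Nonempty :=
  ⟨fun z => 1 * Real.exp (-z), 1, one_pos, fun _ => rfl⟩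

theorem analyticPos_nonempty : analyticPos.Nonempty := expRay_nonempty.mono expRay_subset

theorem analyticOnNhd_famV (c : Fin 4 → ℝ) : AnalyticOnNhd ℝ (famV c) Set.univ := by
  intro z _
  have h1 : AnalyticAt ℝ (fun z => famF (c 0) (c 1) (c 2) (c 3) z) z := by
    unfold famF
    fun_prop
  exact h1

/-- An analytic function that vanishes on a non-empty open set vanishes. -/
theorem forall_eq_zero_of_analytic {G : ℝ → ℝ} (hG : AnalyticOnNhd ℝ G Set.univ) {I : Set ℝ}
    (hI : IsOpen I) (hne : I.Nonempty) (h : ∀ z ∈ I, G z = 0) : ∀ z, G z = 0 := by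
  obtain ⟨z₀, hz₀⟩ := hne
  exact fun z => hG.eqOn_zero_of_preconnected_of_eventuallyEq_zero isPreconnected_univ
    (Set.mem_univ z₀) (Filter.mem_of_superset (hI.mem_nhds hz₀) h) (Set.mem_univ z)

theorem exists_eq_famV_iff {Z : Set (Fin 4 → ℝ)} {F : ℝ → ℝ} :
    (∃ c ∈ Z, F = famV c) ↔ ∃ c₁ c₂ c₃ c₄, ![c₁, c₂, c₃, c₄] ∈ Z ∧
      ∀ z ∈ Set.univ, F z = famF c₁ c₂ c₃ c₄ z := by
  constructor
  · rintro ⟨c, hc, rfl⟩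
    refine ⟨c 0, c 1, c 2, c 3, ?_, fun z _ => rfl⟩
    convert hc using 1
    funext k
    rcases fin4_cases k with rfl | rfl | rfl | rfl <;> rfl
  · rintro ⟨c₁, c₂, c₃, c₄, hc, hF⟩
    exact ⟨_, hc, funext fun z => hF z trivial⟩

section Global

variable {p : (ℝ → ℝ) × (ℝ → ℝ)} (hp : p ∈ globalPairs)

include hp

theorem isOpen_posSet : IsOpen {z | 0 < p.1 z} :=
  isOpen_lt continuous_const
    (continuousOn_univ.1 (AnalyticOnNhd.continuousOn hp.1))

theorem contDiffOn_fst : ContDiffOn ℝ ∞ p.1 Set.univ :=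
  hp.1.contDiffOn uniqueDiffOn_univ

theorem isProfile_of_mem_globalPairs : IsProfile {z | 0 < p.1 z} p.1 p.2 :=
  ⟨isOpen_posSet hp, (contDiffOn_fst hp).mono (Set.subset_univ _),
    (hp.2.1.contDiffOn uniqueDiffOn_univ).mono (Set.subset_univ _), fun _ hz => hz,
    fun z _ => hp.2.2.1 z⟩

/-- Identities between analytic functions of `z` that hold where the metric is defined hold on the
whole line. -/
theorem forall_posSet_iff {G : ℝ → ℝ} (hG : AnalyticOnNhd ℝ G Set.univ) :
    (∀ z ∈ {z | 0 < p.1 z}, G z = 0) ↔ ∀ z ∈ Set.univ, G z = 0 :=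
  ⟨fun h z _ => forall_eq_zero_of_analytic hG (isOpen_posSet hp) hp.2.2.2.1 h z,
    fun h z _ => h z trivial⟩

theorem logDeriv_iff_mem_expRay :
    (∀ z ∈ {z | 0 < p.1 z}, logDeriv p.2 z = -1) ↔ p.2 ∈ expRay := by
  have h1 : (∀ z ∈ {z | 0 < p.1 z}, logDeriv p.2 z = -1) ↔
      ∀ z ∈ {z | 0 < p.1 z}, deriv p.2 z + p.2 z = 0 := by
    refine forall₂_congr fun z _ => ?_
    rw [logDeriv_apply, div_eq_iff (hp.2.2.1 z).ne', neg_one_mul, eq_neg_iff_add_eq_zero]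
  rw [h1, forall_posSet_iff hp (G := fun z => deriv p.2 z + p.2 z) (hp.2.1.deriv.add hp.2.1)]
  constructor
  · intro h
    obtain ⟨c₀, hc₀⟩ := exists_eq_const_mul_exp isOpen_univ Set.ordConnected_univ (u := p.2)
      (a := -1) fun z hz => by
        have h2 := (hp.2.1 z hz).differentiableAt.hasDerivAt
        rwa [eq_neg_of_add_eq_zero_left (h z hz), ← neg_one_mul (p.2 z)] at h2
    refine ⟨c₀, ?_, fun z => by rw [hc₀ z trivial, neg_one_mul]⟩
    have h3 := hp.2.2.1 0
    rw [hc₀ 0 trivial] at h3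
    exact pos_of_mul_pos_left h3 (Real.exp_pos _).le
  · rintro ⟨c₀, -, hC⟩ z -
    have h2 : HasDerivAt (fun z : ℝ => c₀ * Real.exp (-z)) (c₀ * (Real.exp (-z) * (-1))) z :=
      ((hasDerivAt_id z).neg.exp).const_mul c₀
    rw [funext hC, h2.deriv]
    ring

theorem exists_eq_famV_univ_iff :
    (∀ z ∈ {z | 0 < p.1 z}, deriv (deriv (deriv (deriv p.1))) z - 5 * deriv (deriv p.1) z
      + 4 * p.1 z - 4 = 0) ↔ ∃ c ∈ Set.univ, p.1 = famV c := by
  have hF := hp.1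
  rw [forall_posSet_iff hp (G := fun z =>
      deriv (deriv (deriv (deriv p.1))) z - 5 * deriv (deriv p.1) z + 4 * p.1 z - 4)
      (((hF.deriv.deriv.deriv.deriv.sub (analyticOnNhd_const.mul hF.deriv.deriv)).add
        (analyticOnNhd_const.mul hF)).sub analyticOnNhd_const),
    ← exists_eq_famF_iff isOpen_univ Set.ordConnected_univ (contDiffOn_fst hp),
    exists_eq_famV_iff]
  simp only [Set.mem_univ, true_and]

theorem isExtremalKahlerOn_pair_iff :
    IsExtremalKahlerOn (ansatzMetric p.1 p.2) (JPlus p.1) (pairDomain p) ↔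
      (∃ c ∈ Set.univ, p.1 = famV c) ∧ p.2 ∈ expRay := by
  rw [pairDomain, JPlus, (isProfile_of_mem_globalPairs hp).isExtremalKahlerOn_iff_jet (Or.inl rfl)
      fun z => (one_mul (p.1 z)).symm, logDeriv_iff_mem_expRay hp, exists_eq_famV_univ_iff hp,
    and_comm]

theorem isBachFlatOn_pair_iff :
    IsBachFlatOn (ansatzMetric p.1 p.2) (pairDomain p) ↔
      (∃ c ∈ bachCone, p.1 = famV c) ∧ p.2 ∈ analyticPos := by
  have h := isProfile_of_mem_globalPairs hp
  rw [pairDomain, and_iff_left (show p.2 ∈ analyticPos from ⟨hp.2.1, hp.2.2.1⟩)]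
  constructor
  · intro hB
    obtain ⟨c, -, hc⟩ := (exists_eq_famV_univ_iff hp).1 fun z hz =>
      (h.isBachFlatOn_iff_jet.1 hB z hz).1
    exact ⟨c, (h.isBachFlatOn_iff_of_eq_famF hp.2.2.2.1 fun z _ => congrFun hc z).1 hB, hc⟩
  · rintro ⟨c, hcB, hc⟩
    exact (h.isBachFlatOn_iff_of_eq_famF hp.2.2.2.1 fun z _ => congrFun hc z).2 hcB

theorem isWeylPlusFlatOn_pair_iff :
    IsWeylPlusFlatOn (ansatzMetric p.1 p.2) (pairDomain p) ↔
      (∃ c ∈ coordPlane 2 3, p.1 = famV c) ∧ p.2 ∈ analyticPos := by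
  rw [pairDomain, (isProfile_of_mem_globalPairs hp).isWeylPlusFlatOn_iff_jet,
    and_iff_left (show p.2 ∈ analyticPos from ⟨hp.2.1, hp.2.2.1⟩)]
  have hF := hp.1
  rw [forall_posSet_iff hp (G := fun z => deriv (deriv p.1) z - 3 * deriv p.1 z + 2 * p.1 z - 2)
      (((hF.deriv.deriv.sub (analyticOnNhd_const.mul hF.deriv)).add
        (analyticOnNhd_const.mul hF)).sub analyticOnNhd_const),
    ← exists_eq_famF_plus_iff isOpen_univ Set.ordConnected_univ (contDiffOn_fst hp),
    exists_eq_famV_iff]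
  constructor
  · rintro ⟨c₃, c₄, h⟩
    refine ⟨0, 0, c₃, c₄, fun k h2 h3 => ?_, h⟩
    rcases fin4_cases k with rfl | rfl | rfl | rfl <;> first | rfl | contradiction
  · rintro ⟨c₁, c₂, c₃, c₄, hc, h⟩
    obtain rfl : c₁ = 0 := hc 0 (by decide) (by decide)
    obtain rfl : c₂ = 0 := hc 1 (by decide) (by decide)
    exact ⟨c₃, c₄, h⟩

theorem isWeylMinusFlatOn_pair_iff :
    IsWeylMinusFlatOn (ansatzMetric p.1 p.2) (pairDomain p) ↔
      (∃ c ∈ coordPlane 0 1, p.1 = famV c) ∧ p.2 ∈ analyticPos := by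
  rw [pairDomain, (isProfile_of_mem_globalPairs hp).isWeylMinusFlatOn_iff_jet,
    and_iff_left (show p.2 ∈ analyticPos from ⟨hp.2.1, hp.2.2.1⟩)]
  have hF := hp.1
  rw [forall_posSet_iff hp (G := fun z => deriv (deriv p.1) z + 3 * deriv p.1 z + 2 * p.1 z - 2)
      (((hF.deriv.deriv.add (analyticOnNhd_const.mul hF.deriv)).add
        (analyticOnNhd_const.mul hF)).sub analyticOnNhd_const),
    ← exists_eq_famF_minus_iff isOpen_univ Set.ordConnected_univ (contDiffOn_fst hp),
    exists_eq_famV_iff]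
  constructor
  · rintro ⟨c₁, c₂, h⟩
    refine ⟨c₁, c₂, 0, 0, fun k h2 h3 => ?_, h⟩
    rcases fin4_cases k with rfl | rfl | rfl | rfl <;> first | rfl | contradiction
  · rintro ⟨c₁, c₂, c₃, c₄, hc, h⟩
    obtain rfl : c₃ = 0 := hc 2 (by decide) (by decide)
    obtain rfl : c₄ = 0 := hc 3 (by decide) (by decide)
    exact ⟨c₁, c₂, h⟩

theorem isKahlerEinsteinOn_pair_iff :
    IsKahlerEinsteinOn (ansatzMetric p.1 p.2) (JPlus p.1) (pairDomain p) ↔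
      (∃ c ∈ coordPlane 1 3, p.1 = famV c) ∧ p.2 ∈ expRay := by
  rw [pairDomain, (isProfile_of_mem_globalPairs hp).isKahlerEinsteinOn_iff_jet,
    logDeriv_iff_mem_expRay hp, and_comm]
  have hF := hp.1
  have hC := hp.2.1
  refine and_congr_left fun hray => ?_
  obtain ⟨c₀, hc₀, hc⟩ := hray
  have h1 : (∃ k : ℝ, ∀ z ∈ {z | 0 < p.1 z}, 4 * deriv p.1 z - 2 * deriv (deriv p.1) z = k * p.2 z
        ∧ 4 - 4 * p.1 z + 2 * deriv p.1 z = k * p.2 z) ↔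
      ∃ k : ℝ, ∀ z ∈ Set.univ, 4 * deriv p.1 z - 2 * deriv (deriv p.1) z = k * p.2 z
        ∧ 4 - 4 * p.1 z + 2 * deriv p.1 z = k * p.2 z := by
    refine exists_congr fun k => ?_
    have a1 := forall_posSet_iff hp (G := fun z =>
      4 * deriv p.1 z - 2 * deriv (deriv p.1) z - k * p.2 z)
      (((analyticOnNhd_const.mul hF.deriv).sub (analyticOnNhd_const.mul hF.deriv.deriv)).sub
        (analyticOnNhd_const.mul hC))
    have a2 := forall_posSet_iff hp (G := fun z => 4 - 4 * p.1 z + 2 * deriv p.1 z - k * p.2 z)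
      (((analyticOnNhd_const.sub (analyticOnNhd_const.mul hF)).add
        (analyticOnNhd_const.mul hF.deriv)).sub (analyticOnNhd_const.mul hC))
    simp only [sub_eq_zero (b := k * _)] at a1 a2
    simp only [forall_and]
    rw [a1, a2]
  rw [h1, einstein_ode_iff isOpen_univ Set.ordConnected_univ (contDiffOn_fst hp) hc₀.ne'
      (fun z _ => hc z), exists_eq_famV_iff]
  constructor
  · rintro ⟨c₂, c₄, h⟩
    refine ⟨0, c₂, 0, c₄, fun k h2 h3 => ?_, h⟩
    rcases fin4_cases k with rfl | rfl | rfl | rfl <;> first | rfl | contradiction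
  · rintro ⟨c₁, c₂, c₃, c₄, hc, h⟩
    obtain rfl : c₁ = 0 := hc 0 (by decide) (by decide)
    obtain rfl : c₃ = 0 := hc 2 (by decide) (by decide)
    exact ⟨c₂, c₄, h⟩

end Global

/-- A condition on global solutions that amounts to `F` being in a family and `C` in a set, as a
condition on coefficient vectors; the requirements on `F` in `globalPairs` become those in
`admissible`. -/
theorem mem_sep_globalPairs_iff {Z : Set (Fin 4 → ℝ)} {𝒞 : Set (ℝ → ℝ)} (h𝒞 : 𝒞 ⊆ analyticPos)
    {Q : (ℝ → ℝ) × (ℝ → ℝ) → Prop}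
    (hQ : ∀ {p}, p ∈ globalPairs → (Q p ↔ (∃ c ∈ Z, p.1 = famV c) ∧ p.2 ∈ 𝒞))
    (p : (ℝ → ℝ) × (ℝ → ℝ)) :
    p ∈ {p ∈ globalPairs | Q p} ↔ (∃ c ∈ admissible ∩ Z, p.1 = famV c) ∧ p.2 ∈ 𝒞 := by
  constructor
  · rintro ⟨hp, hQp⟩
    obtain ⟨⟨c, hcZ, hc⟩, hC⟩ := (hQ hp).1 hQp
    refine ⟨⟨c, ⟨⟨?_, ?_⟩, hcZ⟩, hc⟩, hC⟩
    · rintro rfl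
      exact hp.2.2.2.2 (hc.trans famV_zero)
    · rw [← hc]
      exact hp.2.2.2.1
  · rintro ⟨⟨c, ⟨⟨h0, hpos⟩, hcZ⟩, hc⟩, hC⟩
    have hp : p ∈ globalPairs := by
      refine ⟨hc ▸ analyticOnNhd_famV c, (h𝒞 hC).1, (h𝒞 hC).2, hc ▸ hpos, fun h1 => h0 ?_⟩
      exact famV_injective (hc.symm.trans (h1.trans famV_zero.symm))
    exact ⟨hp, (hQ hp).2 ⟨⟨c, hcZ, hc⟩, hC⟩⟩

/-- Any two positive functions differ by a positive factor. -/
theorem conformalSetoid_iff {S : Set ((ℝ → ℝ) × (ℝ → ℝ))} (hS : ∀ p ∈ S, p.2 ∈ analyticPos)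
    (p p' : S) : conformalSetoid S p p' ↔ ∃ t, ∀ z, p'.1.1 (z + t) = p.1.1 z := by
  constructor
  · rintro ⟨t, u, -, h⟩
    exact ⟨t, fun z => (h z).1⟩
  · rintro ⟨t, h⟩
    have hp := (hS p.1 p.2).2
    have hp' := (hS p'.1 p'.2).2
    refine ⟨t, fun z => p'.1.2 (z + t) / p.1.2 z, fun z => div_pos (hp' _) (hp _), fun z =>
      ⟨h z, (div_mul_cancel₀ _ (hp z).ne').symm⟩⟩

/-- Any two multiples of `e^{-z}` differ by a constant factor, also after a translation. -/
theorem homothetySetoid_iff {S : Set ((ℝ → ℝ) × (ℝ → ℝ))} (hS : ∀ p ∈ S, p.2 ∈ expRay)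
    (p p' : S) : homothetySetoid S p p' ↔ ∃ t, ∀ z, p'.1.1 (z + t) = p.1.1 z := by
  constructor
  · rintro ⟨t, l, -, h⟩
    exact ⟨t, fun z => (h z).1⟩
  · rintro ⟨t, h⟩
    obtain ⟨c, hc, hpc⟩ := hS p.1 p.2
    obtain ⟨c', hc', hpc'⟩ := hS p'.1 p'.2
    refine ⟨t, c' * Real.exp (-t) / c, by positivity, fun z => ⟨h z, ?_⟩⟩
    rw [hpc', hpc, neg_add, Real.exp_add]
    field_simp

theorem exists_homeomorph_conformal {Z : Set (Fin 4 → ℝ)} (hZ : IsInvariant Z)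
    {Q : (ℝ → ℝ) × (ℝ → ℝ) → Prop}
    (hQ : ∀ {p}, p ∈ globalPairs → (Q p ↔ (∃ c ∈ Z, p.1 = famV c) ∧ p.2 ∈ analyticPos)) :
    ∃ e : Quotient (conformalSetoid {p ∈ globalPairs | Q p}) ≃ₜ
        Quotient (orbitSetoid (admissible ∩ Z)),
      ∀ (p : {p ∈ globalPairs | Q p}) (c : ↥(admissible ∩ Z)), p.1.1 = famV c.1 →
        e (Quotient.mk _ p) = Quotient.mk _ c :=
  exists_homeomorph_orbit analyticPos_nonempty (isInvariant_admissible_inter hZ)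
    (mem_sep_globalPairs_iff subset_rfl hQ)
    (conformalSetoid_iff fun p hp => ((mem_sep_globalPairs_iff subset_rfl hQ p).1 hp).2)

theorem exists_homeomorph_homothety {Z : Set (Fin 4 → ℝ)} (hZ : IsInvariant Z)
    {Q : (ℝ → ℝ) × (ℝ → ℝ) → Prop}
    (hQ : ∀ {p}, p ∈ globalPairs → (Q p ↔ (∃ c ∈ Z, p.1 = famV c) ∧ p.2 ∈ expRay)) :
    ∃ e : Quotient (homothetySetoid {p ∈ globalPairs | Q p}) ≃ₜ
        Quotient (orbitSetoid (admissible ∩ Z)),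
      ∀ (p : {p ∈ globalPairs | Q p}) (c : ↥(admissible ∩ Z)), p.1.1 = famV c.1 →
        e (Quotient.mk _ p) = Quotient.mk _ c :=
  exists_homeomorph_orbit expRay_nonempty (isInvariant_admissible_inter hZ)
    (mem_sep_globalPairs_iff expRay_subset hQ)
    (homothetySetoid_iff fun p hp => ((mem_sep_globalPairs_iff expRay_subset hQ p).1 hp).2)

/-- An inclusion of sets of coefficient vectors makes one family a subfamily of the other: replacing
the conformal factor is a conformal change. -/
theorem isSubfamily_of_subset {Z Z' : Set (Fin 4 → ℝ)} (hZ : IsInvariant Z) (hZ' : IsInvariant Z')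
    (hsub : Z ⊆ Z') {𝒞 𝒞' : Set (ℝ → ℝ)} (h𝒞 : 𝒞 ⊆ analyticPos) (h𝒞' : 𝒞' ⊆ analyticPos)
    (hne : 𝒞'.Nonempty) {Q Q' : (ℝ → ℝ) × (ℝ → ℝ) → Prop}
    (hQ : ∀ {p}, p ∈ globalPairs → (Q p ↔ (∃ c ∈ Z, p.1 = famV c) ∧ p.2 ∈ 𝒞))
    (hQ' : ∀ {p}, p ∈ globalPairs → (Q' p ↔ (∃ c ∈ Z', p.1 = famV c) ∧ p.2 ∈ 𝒞'))
    {s : Setoid {p ∈ globalPairs | Q p}} {s' : Setoid {p ∈ globalPairs | Q' p}}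
    (he : ∃ e : Quotient s ≃ₜ Quotient (orbitSetoid (admissible ∩ Z)),
      ∀ (p : {p ∈ globalPairs | Q p}) (c : ↥(admissible ∩ Z)), p.1.1 = famV c.1 →
        e (Quotient.mk _ p) = Quotient.mk _ c)
    (he' : ∃ e : Quotient s' ≃ₜ Quotient (orbitSetoid (admissible ∩ Z')),
      ∀ (p : {p ∈ globalPairs | Q' p}) (c : ↥(admissible ∩ Z')), p.1.1 = famV c.1 →
        e (Quotient.mk _ p) = Quotient.mk _ c) :
    IsSubfamily s s' := by
  obtain ⟨e, he⟩ := he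
  obtain ⟨e', he'⟩ := he'
  have hsub' : admissible ∩ Z ⊆ admissible ∩ Z' := Set.inter_subset_inter_right _ hsub
  obtain ⟨j, hj, hjmk⟩ := exists_isEmbedding_orbit (isInvariant_admissible_inter hZ)
    (isInvariant_admissible_inter hZ') hsub'
  refine ⟨e'.symm ∘ j ∘ e, e'.symm.isEmbedding.comp (hj.comp e.isEmbedding), fun p => ?_⟩
  obtain ⟨⟨c, hcA, hc⟩, hpC⟩ := (mem_sep_globalPairs_iff h𝒞 hQ p.1).1 p.2
  obtain ⟨C', hC'⟩ := hne
  refine ⟨⟨(famV c, C'), (mem_sep_globalPairs_iff h𝒞' hQ' _).2 ⟨⟨c, hsub' hcA, rfl⟩, hC'⟩⟩, ?_,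
    0, fun z => C' z / p.1.2 z, fun z => div_pos ((h𝒞' hC').2 z) ((h𝒞 hpC).2 z), fun z => ⟨?_, ?_⟩⟩
  · rw [Function.comp_apply, Function.comp_apply, he p ⟨c, hcA⟩ hc, hjmk, Homeomorph.symm_apply_eq,
      he' _ ⟨c, hsub' hcA⟩ rfl]
  · rw [add_zero, hc]
  · rw [add_zero, div_mul_cancel₀ _ ((h𝒞 hpC).2 z).ne']

theorem coordPlane_subset_bachCone {i j : Fin 4} (h₁ : i ≠ 0 ∧ j ≠ 0 ∨ i ≠ 3 ∧ j ≠ 3)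
    (h₂ : i ≠ 1 ∧ j ≠ 1 ∨ i ≠ 2 ∧ j ≠ 2) : coordPlane i j ⊆ bachCone := by
  intro c hc
  change c 0 * c 3 - c 1 * c 2 = 0
  have e1 : c 0 * c 3 = 0 := by
    rcases h₁ with ⟨h, h'⟩ | ⟨h, h'⟩
    · rw [hc 0 h.symm h'.symm, zero_mul]
    · rw [hc 3 h.symm h'.symm, mul_zero]
  have e2 : c 1 * c 2 = 0 := by
    rcases h₂ with ⟨h, h'⟩ | ⟨h, h'⟩
    · rw [hc 1 h.symm h'.symm, zero_mul]
    · rw [hc 2 h.symm h'.symm, mul_zero]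
  rw [e1, e2, sub_zero]

theorem exists_nonneg_mem_coordPlane (i j : Fin 4) :
    ∃ c ∈ coordPlane i j, c ≠ 0 ∧ ∀ k, 0 ≤ c k := by
  refine ⟨Pi.single i 1, fun k hki _ => Pi.single_eq_of_ne hki 1, ?_, fun k => ?_⟩
  · rw [Ne, Pi.single_eq_zero_iff]
    exact one_ne_zero
  · exact (Pi.single_nonneg.2 zero_le_one : (0 : Fin 4 → ℝ) ≤ Pi.single i 1) k

/-- The dimensions of the moduli spaces, and the embeddings between them. -/
theorem moduli_of_global_solutions :
    IsParameterFamily 3 (homothetySetoid extremalPairs) ∧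
    IsParameterFamily 2 (conformalSetoid bachFlatPairs) ∧
    IsParameterFamily 1 (conformalSetoid weylPlusFlatPairs) ∧
    IsParameterFamily 1 (conformalSetoid weylMinusFlatPairs) ∧
    IsParameterFamily 1 (homothetySetoid kahlerEinsteinPairs) ∧
    IsSubfamily (conformalSetoid bachFlatPairs) (homothetySetoid extremalPairs) ∧
    IsSubfamily (conformalSetoid weylPlusFlatPairs) (conformalSetoid bachFlatPairs) ∧
    IsSubfamily (conformalSetoid weylMinusFlatPairs) (conformalSetoid bachFlatPairs) ∧
    IsSubfamily (homothetySetoid kahlerEinsteinPairs) (conformalSetoid bachFlatPairs) := by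
  have hE := exists_homeomorph_homothety isInvariant_univ isExtremalKahlerOn_pair_iff
  have hB := exists_homeomorph_conformal isInvariant_bachCone isBachFlatOn_pair_iff
  have hP := exists_homeomorph_conformal (isInvariant_coordPlane 2 3) isWeylPlusFlatOn_pair_iff
  have hM := exists_homeomorph_conformal (isInvariant_coordPlane 0 1) isWeylMinusFlatOn_pair_iff
  have hK := exists_homeomorph_homothety (isInvariant_coordPlane 1 3) isKahlerEinsteinOn_pair_iff
  have sP : coordPlane 2 3 ⊆ bachCone := coordPlane_subset_bachCone (by decide) (by decide)
  have sM : coordPlane 0 1 ⊆ bachCone := coordPlane_subset_bachCone (by decide) (by decide)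
  have sK : coordPlane 1 3 ⊆ bachCone := coordPlane_subset_bachCone (by decide) (by decide)
  refine ⟨?_, ?_, ?_, ?_, ?_, ?_, ?_, ?_, ?_⟩
  · obtain ⟨e, -⟩ := hE
    obtain ⟨c, -, hc⟩ := exists_nonneg_mem_coordPlane 0 1
    exact isParameterFamily_of_slices isInvariant_univ e ⟨c, trivial, hc⟩ fun c _ hc =>
      exists_isSlice_univ c hc
  · obtain ⟨e, -⟩ := hB
    obtain ⟨c, hcZ, hc⟩ := exists_nonneg_mem_coordPlane 0 1
    exact isParameterFamily_of_slices isInvariant_bachCone e ⟨c, sM hcZ, hc⟩ fun c _ hc =>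
      exists_isSlice_bachCone c hc
  · obtain ⟨e, -⟩ := hP
    exact isParameterFamily_of_slices (isInvariant_coordPlane 2 3) e
      (exists_nonneg_mem_coordPlane 2 3) fun c hcZ hc =>
        exists_isSlice_coordPlane (by decide) hcZ hc
  · obtain ⟨e, -⟩ := hM
    exact isParameterFamily_of_slices (isInvariant_coordPlane 0 1) e
      (exists_nonneg_mem_coordPlane 0 1) fun c hcZ hc =>
        exists_isSlice_coordPlane (by decide) hcZ hc
  · obtain ⟨e, -⟩ := hK
    exact isParameterFamily_of_slices (isInvariant_coordPlane 1 3) e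
      (exists_nonneg_mem_coordPlane 1 3) fun c hcZ hc =>
        exists_isSlice_coordPlane (by decide) hcZ hc
  · exact isSubfamily_of_subset isInvariant_bachCone isInvariant_univ (Set.subset_univ _)
      subset_rfl expRay_subset expRay_nonempty isBachFlatOn_pair_iff isExtremalKahlerOn_pair_iff
      hB hE
  · exact isSubfamily_of_subset (isInvariant_coordPlane 2 3) isInvariant_bachCone sP
      subset_rfl subset_rfl analyticPos_nonempty isWeylPlusFlatOn_pair_iff isBachFlatOn_pair_iff
      hP hB
  · exact isSubfamily_of_subset (isInvariant_coordPlane 0 1) isInvariant_bachCone sM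
      subset_rfl subset_rfl analyticPos_nonempty isWeylMinusFlatOn_pair_iff isBachFlatOn_pair_iff
      hM hB
  · exact isSubfamily_of_subset (isInvariant_coordPlane 1 3) isInvariant_bachCone sK
      expRay_subset subset_rfl analyticPos_nonempty isKahlerEinsteinOn_pair_iff
      isBachFlatOn_pair_iff hK hB

end U2Ansatz

theorem mainTheorem7 :
    (∀ (I : Set ℝ) (F C : ℝ → ℝ), IsOpen I → I.OrdConnected → I.Nonempty →
      ContDiffOn ℝ ∞ F I → ContDiffOn ℝ ∞ C I → (∀ z ∈ I, 0 < F z) → (∀ z ∈ I, 0 < C z) →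
      -- extremal Kähler metrics for `J⁺` and for `J⁻`
      (IsExtremalKahlerOn (ansatzMetric F C) (JPlus F) (mfd I) ↔
        (∃ c₀, ∀ z ∈ I, C z = c₀ * Real.exp (-z)) ∧ ∀ z ∈ I, LPlus (LMinus F) z - 1 = 0) ∧
      (IsExtremalKahlerOn (ansatzMetric F C) (JMinus F) (mfd I) ↔
        (∃ c₀, ∀ z ∈ I, C z = c₀ * Real.exp z) ∧ ∀ z ∈ I, LPlus (LMinus F) z - 1 = 0) ∧
      ((∀ z ∈ I, LPlus (LMinus F) z - 1 = 0) ↔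
        ∃ c₁ c₂ c₃ c₄, ∀ z ∈ I, F z = famF c₁ c₂ c₃ c₄ z) ∧
      (∀ c₀ c₁ c₂ c₃ c₄, (∀ z ∈ I, F z = famF c₁ c₂ c₃ c₄ z) →
        ((∀ z ∈ I, C z = c₀ * Real.exp (-z)) →
          (∀ q ∈ mfd I, scal (ansatzMetric F C) q
            = -24 / c₀ * (c₁ * Real.exp (-zcoord q) + c₂)) ∧
          ((∃ s₀, ∀ q ∈ mfd I, scal (ansatzMetric F C) q = s₀) ↔ c₁ = 0)) ∧
        ((∀ z ∈ I, C z = c₀ * Real.exp z) →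
          (∀ q ∈ mfd I, scal (ansatzMetric F C) q
            = -24 / c₀ * (c₃ + c₄ * Real.exp (zcoord q))) ∧
          ((∃ s₀, ∀ q ∈ mfd I, scal (ansatzMetric F C) q = s₀) ↔ c₄ = 0))) ∧
      -- Bach-flat metrics
      (IsBachFlatOn (ansatzMetric F C) (mfd I) ↔
        ∃ c₁ c₂ c₃ c₄, (∀ z ∈ I, F z = famF c₁ c₂ c₃ c₄ z) ∧ c₁ * c₄ - c₂ * c₃ = 0) ∧
      -- Kähler–Einstein metrics
      (IsKahlerEinsteinOn (ansatzMetric F C) (JPlus F) (mfd I) ↔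
        (∃ c₀, ∀ z ∈ I, C z = c₀ * Real.exp (-z)) ∧
          ∃ c₁ c₂ c₃ c₄, (∀ z ∈ I, F z = famF c₁ c₂ c₃ c₄ z) ∧ c₁ = 0 ∧ c₃ = 0) ∧
      -- half-conformally flat metrics
      (IsWeylPlusFlatOn (ansatzMetric F C) (mfd I) ↔ ∀ z ∈ I, LPlus F z - 1 = 0) ∧
      ((∀ z ∈ I, LPlus F z - 1 = 0) ↔ ∃ c₃ c₄, ∀ z ∈ I, F z = famF 0 0 c₃ c₄ z) ∧
      (IsWeylMinusFlatOn (ansatzMetric F C) (mfd I) ↔ ∀ z ∈ I, LMinus F z - 1 = 0) ∧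
      ((∀ z ∈ I, LMinus F z - 1 = 0) ↔ ∃ c₁ c₂, ∀ z ∈ I, F z = famF c₁ c₂ 0 0 z) ∧
      -- inclusions between the classes
      (IsBachFlatOn (ansatzMetric F C) (mfd I) →
        ∃ C' : ℝ → ℝ, ContDiffOn ℝ ∞ C' I ∧ (∀ z ∈ I, 0 < C' z) ∧
          IsExtremalKahlerOn (ansatzMetric F C') (JPlus F) (mfd I)) ∧
      (IsWeylPlusFlatOn (ansatzMetric F C) (mfd I) → IsBachFlatOn (ansatzMetric F C) (mfd I)) ∧
      (IsWeylMinusFlatOn (ansatzMetric F C) (mfd I) → IsBachFlatOn (ansatzMetric F C) (mfd I)) ∧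
      (IsKahlerEinsteinOn (ansatzMetric F C) (JPlus F) (mfd I) →
        IsBachFlatOn (ansatzMetric F C) (mfd I))) ∧
    -- dimensions of the moduli spaces
    IsParameterFamily 3 (homothetySetoid extremalPairs) ∧
    IsParameterFamily 2 (conformalSetoid bachFlatPairs) ∧
    IsParameterFamily 1 (conformalSetoid weylPlusFlatPairs) ∧
    IsParameterFamily 1 (conformalSetoid weylMinusFlatPairs) ∧
    IsParameterFamily 1 (homothetySetoid kahlerEinsteinPairs) ∧
    IsSubfamily (conformalSetoid bachFlatPairs) (homothetySetoid extremalPairs) ∧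
    IsSubfamily (conformalSetoid weylPlusFlatPairs) (conformalSetoid bachFlatPairs) ∧
    IsSubfamily (conformalSetoid weylMinusFlatPairs) (conformalSetoid bachFlatPairs) ∧
    IsSubfamily (homothetySetoid kahlerEinsteinPairs) (conformalSetoid bachFlatPairs) :=
  ⟨classification_on_interval, moduli_of_global_solutions⟩
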